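/- \textbf{Theorem.} Let $(M,g)$ be a smooth four-dimensional space-time, i.e. a smooth (Hausdorff, second countable) 4-manifold with a smooth Lorentzian metric $g$ of signature $(-,+,+,+)$. Suppose that $(M,g)$ is of Petrov--Bel type D at every point, that is, on the complex 3-dimensional space of self-dual 2-forms ($*F=\mathrm{i}F$) the trace-free endomorphism induced by the Weyl tensor is diagonalizable with eigenvalues $\rho,\rho,-2\rho$, $\rho\neq 0$. Suppose also that $(M,g)$ admits a conformal Killing tensor of type 2+2, that is, a smooth symmetric tensor $K$ such that $$\nabla_{(a}K_{bc)} = g_{(ab}\,t_{c)}$$ for some 1-form $t$, and such that at every point $K=\alpha\, v+\beta\, h$ with real numbers $\alpha\neq\beta$, where $v$ and $h=g-v$ are the orthogonal projectors on a time-like 2-plane and on its space-like orthogonal complement. Then $(M,g)$ also admits, locally, a conformal Killing--Yano tensor: every point of $M$ has an open neighbourhood $N$ carrying a smooth 2-form $F$ with $$\nabla_a F_{bc}+\nabla_b F_{ac} = 2\,g_{ab}\,\xi_c-g_{ac}\,\xi_b-g_{bc}\,\xi_a$$ for some 1-form $\xi$, where $F$ is non-null at every point of $N$, i.e. the invariants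 $(F,F)$ and $(F,*F)$, with $(F,H)=\tfrac12F_{ab}H^{ab}$, do not vanish simultaneously. If moreover $M$ is simply connected, then such an $F$ exists on the whole of $M$. -/

import Mathlib

open scoped Manifold ContDiff

noncomputable section

namespace Spacetime

/-- The coordinate space of a four-dimensional chart. -/
abbrev Coord : Type := EuclideanSpace ℝ (Fin 4)

/-! ### Component calculus in one coordinate system

Tensors of type `(0,2)` are given by their component matrices as functions on `ℝ⁴`. -/

/-- The partial derivative `∂_i f` at `u`. -/
def pd (i : Fin 4) (f : Coord → ℝ) (u : Coord) : ℝ :=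
  fderiv ℝ f u (EuclideanSpace.single i 1)

/-- The contravariant metric components `g^{ij}`. -/
def gInv (g : Coord → Matrix (Fin 4) (Fin 4) ℝ) (u : Coord) : Matrix (Fin 4) (Fin 4) ℝ :=
  (g u)⁻¹

/-- Christoffel symbols `Γ^k_{ij}` of the Levi-Civita connection; arguments in the order `k i j`. -/
def christoffel (g : Coord → Matrix (Fin 4) (Fin 4) ℝ) (k i j : Fin 4) (u : Coord) : ℝ :=
  1 / 2 * ∑ l, gInv g u k l *
    (pd i (fun v => g v j l) u + pd j (fun v => g v i l) u - pd l (fun v => g v i j) u)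

/-- The covariant derivative `∇_a T_{bc}` of a tensor of type `(0,2)`. -/
def covDeriv (g T : Coord → Matrix (Fin 4) (Fin 4) ℝ) (u : Coord) (a b c : Fin 4) : ℝ :=
  pd a (fun v => T v b c) u
    - ∑ d, christoffel g d a b u * T u d c - ∑ d, christoffel g d a c u * T u b d

/-- The Riemann tensor `R^a_{bcd} = ∂_c Γ^a_{db} - ∂_d Γ^a_{cb} + Γ^a_{ce} Γ^e_{db}
- Γ^a_{de} Γ^e_{cb}`. -/
def riemannUp (g : Coord → Matrix (Fin 4) (Fin 4) ℝ) (u : Coord) (a b c d : Fin 4) : ℝ :=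
  pd c (christoffel g a d b) u - pd d (christoffel g a c b) u
    + ∑ e, christoffel g a c e u * christoffel g e d b u
    - ∑ e, christoffel g a d e u * christoffel g e c b u

/-- The Riemann tensor with all indices lowered. -/
def riemann (g : Coord → Matrix (Fin 4) (Fin 4) ℝ) (u : Coord) (a b c d : Fin 4) : ℝ :=
  ∑ e, g u a e * riemannUp g u e b c d

/-- The Ricci tensor `R_{bd} = R^a_{bad}`. -/
def ricci (g : Coord → Matrix (Fin 4) (Fin 4) ℝ) (u : Coord) (b d : Fin 4) : ℝ :=
  ∑ a, riemannUp g u a b a d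

/-- The scalar curvature. -/
def scalarCurv (g : Coord → Matrix (Fin 4) (Fin 4) ℝ) (u : Coord) : ℝ :=
  ∑ b, ∑ d, gInv g u b d * ricci g u b d

/-- The Weyl tensor `W_{abcd}` of a four-dimensional metric. -/
def weyl (g : Coord → Matrix (Fin 4) (Fin 4) ℝ) (u : Coord) (a b c d : Fin 4) : ℝ :=
  riemann g u a b c d
    - 1 / 2 * (g u a c * ricci g u b d - g u a d * ricci g u b c
        + g u b d * ricci g u a c - g u b c * ricci g u a d)
    + scalarCurv g u / 6 * (g u a c * g u b d - g u a d * g u b c)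

/-- The Levi-Civita symbol `ε_{abcd}`, with `ε_{0123} = 1`. -/
def leviCivita (a b c d : Fin 4) : ℝ :=
  Matrix.det (Matrix.of fun i j : Fin 4 => if ![a, b, c, d] i = j then (1 : ℝ) else 0)

/-- The metric volume element `η_{abcd}` for the orientation of the coordinates. -/
def volForm (g : Coord → Matrix (Fin 4) (Fin 4) ℝ) (u : Coord) (a b c d : Fin 4) : ℝ :=
  Real.sqrt |(g u).det| * leviCivita a b c d

/-- The action `P(F)_{ab} = ½ P_{ab}^{cd} F_{cd}` of a double 2-form `P` on a complex 2-form `F`. -/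
def dblAct (g : Coord → Matrix (Fin 4) (Fin 4) ℝ) (u : Coord)
    (P : Fin 4 → Fin 4 → Fin 4 → Fin 4 → ℝ) (F : Matrix (Fin 4) (Fin 4) ℂ) :
    Matrix (Fin 4) (Fin 4) ℂ :=
  Matrix.of fun a b => 1 / 2 * ∑ c, ∑ d, ∑ p, ∑ q,
    (P a b c d : ℂ) * (gInv g u c p : ℂ) * (gInv g u d q : ℂ) * F p q

/-- The Hodge dual `*F` of a complex 2-form. -/
def hodge (g : Coord → Matrix (Fin 4) (Fin 4) ℝ) (u : Coord) (F : Matrix (Fin 4) (Fin 4) ℂ) :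
    Matrix (Fin 4) (Fin 4) ℂ :=
  dblAct g u (volForm g u) F

/-- The Weyl tensor as an endomorphism of the complex 2-forms. -/
def weylAct (g : Coord → Matrix (Fin 4) (Fin 4) ℝ) (u : Coord) (F : Matrix (Fin 4) (Fin 4) ℂ) :
    Matrix (Fin 4) (Fin 4) ℂ :=
  dblAct g u (weyl g u) F

/-- The product `(F, H) = ½ F_{ab} H^{ab}` of complex 2-forms. -/
def formInner (g : Coord → Matrix (Fin 4) (Fin 4) ℝ) (u : Coord)
    (F H : Matrix (Fin 4) (Fin 4) ℂ) : ℂ :=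
  1 / 2 * ∑ a, ∑ b, ∑ c, ∑ d, F a b * (gInv g u a c : ℂ) * (gInv g u b d : ℂ) * H c d

/-- `F` is a self-dual 2-form (SD bivector): antisymmetric with `*F = i F`. -/
def IsSelfDual (g : Coord → Matrix (Fin 4) (Fin 4) ℝ) (u : Coord)
    (F : Matrix (Fin 4) (Fin 4) ℂ) : Prop :=
  F.transpose = -F ∧ hodge g u F = Complex.I • F

/-- Petrov-Bel type D at `u`: on the three-dimensional complex space of SD bivectors the
(trace-free) Weyl endomorphism `𝒲` has minimal polynomial `(x - ρ)(x + 2ρ)` with `ρ ≠ 0`, that is,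
it is diagonalizable with eigenvalues `ρ, ρ, -2ρ`, `ρ ≠ 0`. -/
def IsTypeDAt (g : Coord → Matrix (Fin 4) (Fin 4) ℝ) (u : Coord) : Prop :=
  ∃ ρ : ℂ, ρ ≠ 0 ∧ ∀ F : Matrix (Fin 4) (Fin 4) ℂ, IsSelfDual g u F →
    weylAct g u (weylAct g u F + (2 * ρ) • F) - ρ • (weylAct g u F + (2 * ρ) • F) = 0

/-- The conformal Killing tensor equation `∇_{(a} K_{bc)} = g_{(ab} t_{c)}` at `u`. -/
def CKTEqAt (g K : Coord → Matrix (Fin 4) (Fin 4) ℝ) (u : Coord) : Prop :=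
  ∃ t : Fin 4 → ℝ, ∀ a b c,
    covDeriv g K u a b c + covDeriv g K u b c a + covDeriv g K u c a b
      = g u a b * t c + g u b c * t a + g u c a * t b

/-- The conformal Killing-Yano equation
`∇_a F_{bc} + ∇_b F_{ac} = 2 g_{ab} ξ_c - g_{ac} ξ_b - g_{bc} ξ_a` at `u`. -/
def CKYEqAt (g F : Coord → Matrix (Fin 4) (Fin 4) ℝ) (u : Coord) : Prop :=
  ∃ ξ : Fin 4 → ℝ, ∀ a b c,
    covDeriv g F u a b c + covDeriv g F u b a c
      = 2 * g u a b * ξ c - g u a c * ξ b - g u b c * ξ a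

/-- A real 2-form is non-null when its invariants `(F, F)` and `(F, *F)` are not both zero. -/
def IsNonNullAt (g F : Coord → Matrix (Fin 4) (Fin 4) ℝ) (u : Coord) : Prop :=
  formInner g u ((F u).map Complex.ofReal) ((F u).map Complex.ofReal) ≠ 0 ∨
    formInner g u ((F u).map Complex.ofReal) (hodge g u ((F u).map Complex.ofReal)) ≠ 0

/-! ### Space-times -/

variable (M : Type*) [TopologicalSpace M] [ChartedSpace Coord M]

/-- A (not necessarily continuous) field of bilinear forms on the tangent spaces of `M`. -/
abbrev BilinField : Type _ :=
  (x : M) → TangentSpace (𝓡 4) x →ₗ[ℝ] TangentSpace (𝓡 4) x →ₗ[ℝ] ℝ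

variable {M}

/-- The components `T_{ij}` of `T` in the chart `e`, as functions of the coordinates: the values of
`T` on the coordinate vector fields of `e`. -/
def components (e : OpenPartialHomeomorph M Coord) (T : BilinField M) (u : Coord) :
    Matrix (Fin 4) (Fin 4) ℝ :=
  Matrix.of fun i j => T (e.symm u)
    (mfderiv (𝓡 4) (𝓡 4) e.symm u (EuclideanSpace.single i 1 : Coord))
    (mfderiv (𝓡 4) (𝓡 4) e.symm u (EuclideanSpace.single j 1 : Coord))

/-- `T` is smooth on the open set `N`: its components in every smooth chart are smooth. -/
def SmoothOn (T : BilinField M) (N : Set M) : Prop :=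
  ∀ e ∈ IsManifold.maximalAtlas (𝓡 4) ∞ M, ∀ i j : Fin 4,
    ContDiffOn ℝ ∞ (fun u => components e T u i j) (e.target ∩ e.symm ⁻¹' N)

/-- `b` is an orthonormal basis for the bilinear form `g` on `V`, with `b 0` time-like and
`b 1, b 2, b 3` space-like (signature `-+++`). -/
def IsOrthonormalFrame {V : Type*} [AddCommGroup V] [Module ℝ V] (g : V →ₗ[ℝ] V →ₗ[ℝ] ℝ)
    (b : Module.Basis (Fin 4) ℝ V) : Prop :=
  ∀ i j, g (b i) (b j) = if i = j then (if i = 0 then -1 else 1) else 0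

variable (M) in
/-- A smooth Lorentzian metric of signature `-+++`. -/
structure LorentzMetric where
  /-- the inner product on each tangent space -/
  val : BilinField M
  symm : ∀ x v w, val x v w = val x w v
  signature : ∀ x, ∃ b : Module.Basis (Fin 4) ℝ (TangentSpace (𝓡 4) x),
    IsOrthonormalFrame (val x) b
  smooth : SmoothOn val Set.univ

/-- The space-time `(M, g)` is of Petrov-Bel type D (at every point). -/
def LorentzMetric.IsTypeD (g : LorentzMetric M) : Prop :=
  ∀ e ∈ IsManifold.maximalAtlas (𝓡 4) ∞ M, ∀ u ∈ e.target, IsTypeDAt (components e g.val) u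

/-- `K` is a conformal Killing tensor of `(M, g)`. -/
structure LorentzMetric.IsConformalKillingTensor (g : LorentzMetric M) (K : BilinField M) :
    Prop where
  symm : ∀ x v w, K x v w = K x w v
  smooth : SmoothOn K Set.univ
  eqn : ∀ e ∈ IsManifold.maximalAtlas (𝓡 4) ∞ M, ∀ u ∈ e.target,
    CKTEqAt (components e g.val) (components e K) u

/-- `K` is of type 2+2: at each point it has two distinct double eigenvalues `α ≠ β` whose
eigenspaces are a time-like 2-plane (spanned by `b 0, b 1`) and its space-like orthogonal
complement (spanned by `b 2, b 3`), that is, `K = α v + β h`. -/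
def LorentzMetric.IsTwoPlusTwo (g : LorentzMetric M) (K : BilinField M) : Prop :=
  ∀ x, ∃ b : Module.Basis (Fin 4) ℝ (TangentSpace (𝓡 4) x), IsOrthonormalFrame (g.val x) b ∧
    ∃ α β : ℝ, α ≠ β ∧ ∀ (i : Fin 4) (w : TangentSpace (𝓡 4) x),
      K x (b i) w = (if i = 0 ∨ i = 1 then α else β) * g.val x (b i) w

/-- `F` is, on the open set `N`, a conformal Killing-Yano tensor of `(M, g)`: a smooth 2-form that
satisfies the conformal Killing-Yano equation. -/
structure LorentzMetric.IsConformalKillingYanoOn (g : LorentzMetric M) (F : BilinField M)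
    (N : Set M) : Prop where
  antisymm : ∀ x ∈ N, ∀ v w, F x v w = -F x w v
  smooth : SmoothOn F N
  eqn : ∀ e ∈ IsManifold.maximalAtlas (𝓡 4) ∞ M, ∀ u ∈ e.target, e.symm u ∈ N →
    CKYEqAt (components e g.val) (components e F) u

/-- The 2-form `F` is non-null at every point of `N`. -/
def LorentzMetric.IsNonNullOn (g : LorentzMetric M) (F : BilinField M) (N : Set M) : Prop :=
  ∀ e ∈ IsManifold.maximalAtlas (𝓡 4) ∞ M, ∀ u ∈ e.target, e.symm u ∈ N →
    IsNonNullAt (components e g.val) (components e F) u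

end Spacetime

end

/-! Write `K = α v + β h` and use oriented orthonormal frames with `e₀, e₁` in the time-like plane
and `e₂, e₃` in the space-like one. The conformal Killing equation says that both planes are umbilic
and fixes the pure-trace part of their second fundamental forms: with lowered index these are `-x_i
g_ab + b_i ε_ab`, where `x = d(½ log |α - β|)` and the twist `b` is free (`umbilic_of_equations`).
Seek `F` in the span of the two area forms, with components `p` and `q`. With `f = p + iq` the
conformal Killing-Yano equation becomes `df = (x + iφ) f`, where the real 1-form `φ` is a
rearrangement of `b` (`cky_frame_iff`). Since `x` is exact, a local solution exists as soon as `dφ =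
0`: take `f = |α - β|^{1/2} exp(iθ)` with `dθ = φ` (`exists_sol`). It vanishes nowhere, and the
invariants of `F` are `q² - p²` and `-2pq`, so `F` is non-null. Closedness of `φ` is where type D
enters. Umbilicity makes the null directions `e₀ ± e₁` geodesic and shear-free, whence `Ψ₀ = Ψ₄ = 0`
(`Umbilic.psi_zero_four`). As the Weyl endomorphism is annihilated by `(x - ρ)(x + 2ρ)`, this forces
`Ψ₁ = Ψ₃ = 0` too (`IsCurvatureLike.psi_one_three`). The structure equations, `dx = 0` and the pair
symmetry of the curvature then give `dφ = 0` (`Umbilic.closed`). For the global statement, the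
conformal Killing-Yano 2-forms commuting with `K` are locally exactly the constant complex multiples
of one `f` (`eventually_eq_planeField`). The nonzero ones therefore form a covering space of `M`,
which has a global section when `M` is simply connected (`exists_glued_section`). -/

open Filter Topology Matrix Kronecker

noncomputable section

namespace Spacetime

/-! ### Umbilic frames: algebra of connection and curvature coefficients. -/

section
/-- The diagonal entries of the Minkowski metric. -/
def eta : Fin 4 → ℝ := ![-1, 1, 1, 1]

/-- The curvature components in an orthonormal frame, in terms of the connection coefficients
`γ k i j = θ^i(∇_{e_k} e_j)` and their derivatives `dγ l k i j` along the frame. -/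
def frameCurv (γ : Fin 4 → Matrix (Fin 4) (Fin 4) ℝ)
    (dγ : Fin 4 → Fin 4 → Matrix (Fin 4) (Fin 4) ℝ) (i j k l : Fin 4) : ℝ :=
  eta i * (dγ k l i j - dγ l k i j - ∑ m, (γ k m l - γ l m k) * γ m i j
    + ∑ m, (γ k i m * γ l m j - γ l i m * γ k m j))

/-- Umbilicity. -/
structure Umbilic (γ : Fin 4 → Matrix (Fin 4) (Fin 4) ℝ) (x b : Fin 4 → ℝ) : Prop where
  anti : ∀ k i j, eta i * γ k i j = -(eta j * γ k j i)
  h020 : γ 0 2 0 = x 2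
  h121 : γ 1 2 1 = -x 2
  h021 : γ 0 2 1 = b 2
  h120 : γ 1 2 0 = -b 2
  h030 : γ 0 3 0 = x 3
  h131 : γ 1 3 1 = -x 3
  h031 : γ 0 3 1 = b 3
  h130 : γ 1 3 0 = -b 3
  h202 : γ 2 0 2 = x 0
  h303 : γ 3 0 3 = x 0
  h203 : γ 2 0 3 = -b 0
  h302 : γ 3 0 2 = b 0
  h212 : γ 2 1 2 = -x 1
  h313 : γ 3 1 3 = -x 1
  h213 : γ 2 1 3 = b 1
  h312 : γ 3 1 2 = -b 1

/-- With the middle index lowered, the umbilicity relations read `γ_{aic} = -x_i η_ac + b_i ε_ac`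
for `a, c` in one plane and `i` in the other, `ε₀₁ = ε₂₃ = 1`. Antisymmetry then leaves free only
the boost coefficients `μ` of the first plane and the rotation coefficients `ν` of the second. -/
lemma Umbilic.eq {γ : Fin 4 → Matrix (Fin 4) (Fin 4) ℝ} {x b : Fin 4 → ℝ} (h : Umbilic γ x b) :
    ∃ μ ν : Fin 4 → ℝ, γ = ![
      !![0, μ 0, x 2, x 3; μ 0, 0, -b 2, -b 3; x 2, b 2, 0, ν 0; x 3, b 3, -ν 0, 0],
      !![0, μ 1, -b 2, -b 3; μ 1, 0, x 2, x 3; -b 2, -x 2, 0, ν 1; -b 3, -x 3, -ν 1, 0],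
      !![0, μ 2, x 0, -b 0; μ 2, 0, -x 1, b 1; x 0, x 1, 0, ν 2; -b 0, -b 1, -ν 2, 0],
      !![0, μ 3, b 0, x 0; μ 3, 0, -b 1, -x 1; b 0, b 1, 0, ν 3; x 0, x 1, -ν 3, 0]] := by
  refine ⟨fun k => γ k 0 1, fun k => γ k 2 3, ?_⟩
  obtain ⟨anti, h1, h2, h3, h4, h5, h6, h7, h8, h9, h10, h11, h12, h13, h14, h15, h16⟩ := h
  funext k
  ext i j
  have h := anti k i j
  have h' := anti k j i
  fin_cases k <;> fin_cases i <;> fin_cases j <;> simp [eta] at h h' ⊢ <;> linarith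

/-- The null directions `e₀ ± e₁` are geodesic and shear-free, so the shear equation gives `Ψ₀ = Ψ₄
= 0`; for a curvature tensor the four real equations are equivalent to this. They are symmetrised
because `frameCurv` is not assumed to have pair symmetry here. -/
lemma Umbilic.psi_zero_four {γ : Fin 4 → Matrix (Fin 4) (Fin 4) ℝ}
    {dγ : Fin 4 → Fin 4 → Matrix (Fin 4) (Fin 4) ℝ} {x b : Fin 4 → ℝ} {dx db : Fin 4 → Fin 4 → ℝ}
    (h : Umbilic γ x b) (hd : ∀ l, Umbilic (dγ l) (dx l) (db l))  :
    let R := frameCurv γ dγ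
    R 0 2 0 2 + R 1 2 1 2 - R 0 3 0 3 - R 1 3 1 3 = 0 ∧
    R 0 2 1 2 + R 1 2 0 2 - R 0 3 1 3 - R 1 3 0 3 = 0 ∧
    R 0 2 0 3 + R 0 3 0 2 + R 1 2 1 3 + R 1 3 1 2 = 0 ∧
    R 0 2 1 3 + R 1 2 0 3 + R 0 3 1 2 + R 1 3 0 2 = 0 := by
  obtain ⟨μ, ν, rfl⟩ := h.eq
  choose dμ dν hd using fun l => (hd l).eq
  intro R
  simp only [R, frameCurv, hd, Fin.sum_univ_four, eta]
  simp
  refine ⟨?_, ?_, ?_, ?_⟩ <;> ring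

/-- The conclusion is `dφ = 0` in the frame, where `φ = (b₁, b₀, -b₃, b₂)`. The hypotheses `h1`–`h4`
are `Ψ₁ = Ψ₃ = 0`, and `hx` is `dx = 0`. All of them are linear in the derivatives, and `dφ` is a
linear combination of them and of pair symmetries. -/
lemma Umbilic.closed {γ : Fin 4 → Matrix (Fin 4) (Fin 4) ℝ}
    {dγ : Fin 4 → Fin 4 → Matrix (Fin 4) (Fin 4) ℝ} {x b : Fin 4 → ℝ} {dx db : Fin 4 → Fin 4 → ℝ}
    (h : Umbilic γ x b) (hd : ∀ l, Umbilic (dγ l) (dx l) (db l))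
    (hx : ∀ k l, dx k l - dx l k = ∑ m, (γ k m l - γ l m k) * x m)
    {R : Fin 4 → Fin 4 → Fin 4 → Fin 4 → ℝ} (hR : R = frameCurv γ dγ)
    (hpair : ∀ i j k l, R i j k l = R k l i j)
    (h1 : R 0 1 0 2 + R 3 1 3 2 = 0) (h2 : R 0 1 0 3 + R 2 1 2 3 = 0)
    (h3 : R 0 1 3 1 - R 2 0 2 3 = 0) (h4 : R 0 1 1 2 + R 3 0 3 2 = 0) (k l : Fin 4) :
    ![db k 1, db k 0, -db k 3, db k 2] l - ![db l 1, db l 0, -db l 3, db l 2] k =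
      ∑ m, (γ k m l - γ l m k) * ![b 1, b 0, -b 3, b 2] m := by
  have p1 := hpair 0 2 0 3
  have p2 := hpair 1 2 1 3
  have p3 := hpair 2 0 2 1
  have p4 := hpair 3 0 3 1
  -- With the mixed index pair in front, the curvature component contains derivatives of `x` and `b`
  -- only. Those of `μ` and `ν`, about which nothing is known, drop out.
  rw [hpair 0 1 0 2] at h1
  rw [hpair 0 1 0 3] at h2
  rw [hpair 0 1 3 1] at h3
  rw [hpair 0 1 1 2] at h4
  obtain ⟨μ, ν, rfl⟩ := h.eq
  choose dμ dν hd using fun l => (hd l).eq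
  subst hR
  have x01 := hx 0 1
  have x02 := hx 0 2
  have x03 := hx 0 3
  have x12 := hx 1 2
  have x13 := hx 1 3
  have x23 := hx 2 3
  clear hx hpair
  simp only [frameCurv, hd, Fin.sum_univ_four, eta] at *
  clear hd
  simp at *
  fin_cases k <;> fin_cases l <;> simp

  all_goals linarith

end

/-! ### The Weyl endomorphism on self-dual bivectors in an orthonormal frame. -/

section
/-- The Ricci components in an orthonormal frame. -/
def frameRicci (R : Fin 4 → Fin 4 → Fin 4 → Fin 4 → ℝ) (j l : Fin 4) : ℝ :=
  ∑ i, eta i * R i j i l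

/-- The Weyl components in an orthonormal frame. -/
def frameWeyl (R : Fin 4 → Fin 4 → Fin 4 → Fin 4 → ℝ) (i j k l : Fin 4) : ℝ :=
  let e := Matrix.diagonal eta
  R i j k l - 1 / 2 * (e i k * frameRicci R j l - e i l * frameRicci R j k
      + e j l * frameRicci R i k - e j k * frameRicci R i l)
    + (∑ m, eta m * frameRicci R m m) / 6 * (e i k * e j l - e i l * e j k)

/-- The action of a double 2-form on 2-forms in an orthonormal frame. -/
def frameAct (P : Fin 4 → Fin 4 → Fin 4 → Fin 4 → ℝ) (φ : Matrix (Fin 4) (Fin 4) ℂ) :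
    Matrix (Fin 4) (Fin 4) ℂ :=
  Matrix.of fun i j => 1 / 2 * ∑ k, ∑ l, (P i j k l : ℂ) * (eta k : ℂ) * (eta l : ℂ) * φ k l

/-- The self-dual bivector with electric part `c`. -/
def sdForm (c : Fin 3 → ℂ) : Matrix (Fin 4) (Fin 4) ℂ :=
  !![0, c 0, c 1, c 2; -c 0, 0, Complex.I * c 2, -(Complex.I * c 1);
    -c 1, -(Complex.I * c 2), 0, Complex.I * c 0; -c 2, Complex.I * c 1, -(Complex.I * c 0), 0]

/-- The algebraic symmetries of a curvature tensor. -/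
structure IsCurvatureLike (R : Fin 4 → Fin 4 → Fin 4 → Fin 4 → ℝ) : Prop where
  anti₁ : ∀ i j k l, R i j k l = -R j i k l
  anti₂ : ∀ i j k l, R i j k l = -R i j l k
  bianchi : ∀ i j k l, R i j k l + R i k l j + R i l j k = 0

lemma IsCurvatureLike.pair {R : Fin 4 → Fin 4 → Fin 4 → Fin 4 → ℝ} (h : IsCurvatureLike R)
    (i j k l : Fin 4) : R i j k l = R k l i j := by
  linarith [h.bianchi i j k l, h.bianchi j k l i, h.bianchi k l i j, h.bianchi l i j k,
    h.anti₁ i j k l, h.anti₁ i k l j, h.anti₁ i l j k, h.anti₁ j k l i, h.anti₁ j l i k,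
    h.anti₁ k l i j, h.anti₂ i j k l, h.anti₂ i k l j, h.anti₂ i l j k, h.anti₂ j k l i,
    h.anti₂ j l i k, h.anti₂ k l i j, h.anti₂ j i k l, h.anti₂ k i l j, h.anti₂ l i j k,
    h.anti₂ k j l i, h.anti₂ l j i k, h.anti₂ l k i j]

/-- The matrix of the Weyl endomorphism on self-dual bivectors. -/
def weylQ (W : Fin 4 → Fin 4 → Fin 4 → Fin 4 → ℝ) : Matrix (Fin 3) (Fin 3) ℂ :=
  !![-W 0 1 0 1 + Complex.I * W 0 1 2 3, -W 0 1 0 2 + Complex.I * W 0 1 3 1,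
      -W 0 1 0 3 + Complex.I * W 0 1 1 2;
    -W 0 1 0 2 + Complex.I * W 0 1 3 1, -W 0 2 0 2 + Complex.I * W 0 2 3 1,
      -W 0 2 0 3 + Complex.I * W 0 2 1 2;
    -W 0 1 0 3 + Complex.I * W 0 1 1 2, -W 0 2 0 3 + Complex.I * W 0 2 1 2,
      -W 0 3 0 3 + Complex.I * W 0 3 1 2]

lemma IsCurvatureLike.weyl {R : Fin 4 → Fin 4 → Fin 4 → Fin 4 → ℝ} (h : IsCurvatureLike R) :
    IsCurvatureLike (frameWeyl R) := by
  have hs : ∀ j l, frameRicci R j l = frameRicci R l j := fun j l =>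
    Finset.sum_congr rfl fun i _ => by rw [h.pair]
  refine ⟨fun i j k l => ?_, fun i j k l => ?_, fun i j k l => ?_⟩
  · simp only [Spacetime.frameWeyl]
    linear_combination h.anti₁ i j k l
  · simp only [Spacetime.frameWeyl]
    linear_combination h.anti₂ i j k l
  · have he : ∀ a b : Fin 4, Matrix.diagonal eta a b = Matrix.diagonal eta b a := fun a b =>
      congrFun (congrFun (Matrix.diagonal_transpose eta).symm a) b
    simp only [Spacetime.frameWeyl]
    rw [hs l j, hs k j, hs l k, he l j, he k j, he l k]
    linear_combination h.bianchi i j k l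

lemma frameWeyl_trace (R : Fin 4 → Fin 4 → Fin 4 → Fin 4 → ℝ) (j l : Fin 4) :
    ∑ i, eta i * frameWeyl R i j i l = 0 := by
  have h : ∑ i, eta i * R i j i l = frameRicci R j l := rfl
  simp only [frameWeyl, Fin.sum_univ_four] at h ⊢
  set S := frameRicci R
  fin_cases j <;> fin_cases l <;> simp [eta] at h ⊢ <;> linarith

/-- For a trace-free curvature tensor the left and right Hodge duals agree; in components this
expresses everything through the electric and magnetic parts. -/
lemma weyl_components {W : Fin 4 → Fin 4 → Fin 4 → Fin 4 → ℝ} (h : IsCurvatureLike W)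
    (ht : ∀ j l, ∑ i, eta i * W i j i l = 0) :
    W 0 2 0 1 = W 0 1 0 2 ∧
    W 0 2 2 3 = W 0 1 3 1 ∧
    W 0 3 0 1 = W 0 1 0 3 ∧
    W 0 3 0 2 = W 0 2 0 3 ∧
    W 0 3 2 3 = W 0 1 1 2 ∧
    W 0 3 3 1 = W 0 2 1 2 ∧
    W 2 3 0 1 = W 0 1 2 3 ∧
    W 2 3 0 2 = W 0 1 3 1 ∧
    W 2 3 0 3 = W 0 1 1 2 ∧
    W 2 3 2 3 = -W 0 1 0 1 ∧
    W 2 3 3 1 = -W 0 1 0 2 ∧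
    W 2 3 1 2 = -W 0 1 0 3 ∧
    W 3 1 0 1 = W 0 1 3 1 ∧
    W 3 1 0 2 = W 0 2 3 1 ∧
    W 3 1 0 3 = W 0 2 1 2 ∧
    W 3 1 2 3 = -W 0 1 0 2 ∧
    W 3 1 3 1 = -W 0 2 0 2 ∧
    W 3 1 1 2 = -W 0 2 0 3 ∧
    W 1 2 0 1 = W 0 1 1 2 ∧
    W 1 2 0 2 = W 0 2 1 2 ∧
    W 1 2 0 3 = W 0 3 1 2 ∧
    W 1 2 2 3 = -W 0 1 0 3 ∧
    W 1 2 3 1 = -W 0 2 0 3 ∧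
    W 1 2 1 2 = -W 0 3 0 3 := by
  have p := h.pair
  have z₁ : ∀ i k l, W i i k l = 0 := fun i k l => by linarith [h.anti₁ i i k l]
  have z₂ : ∀ i k l, W k l i i = 0 := fun i k l => by linarith [h.anti₂ k l i i]
  have a01 := h.anti₁ 1 0
  have a02 := h.anti₁ 2 0
  have a03 := h.anti₁ 3 0
  have a23 := h.anti₁ 3 2
  have a31 := h.anti₁ 1 3
  have a12 := h.anti₁ 2 1
  have b01 := fun k l => h.anti₂ k l 1 0
  have b02 := fun k l => h.anti₂ k l 2 0
  have b03 := fun k l => h.anti₂ k l 3 0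
  have b23 := fun k l => h.anti₂ k l 3 2
  have b31 := fun k l => h.anti₂ k l 1 3
  have b12 := fun k l => h.anti₂ k l 2 1
  simp only [Fin.sum_univ_four, eta] at ht
  simp at ht
  have t00 := ht 0 0
  have t01 := ht 0 1
  have t02 := ht 0 2
  have t03 := ht 0 3
  have t11 := ht 1 1
  have t12 := ht 1 2
  have t13 := ht 1 3
  have t22 := ht 2 2
  have t23 := ht 2 3
  have t33 := ht 3 3
  simp only [z₁, z₂, a01, a02, a03, a23, a31, a12,
    b01, b02, b03, b23, b31, b12] at t00 t01 t02 t03 t11 t12 t13 t22 t23 t33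
  refine ⟨?_, ?_, ?_, ?_, ?_, ?_, ?_, ?_, ?_, ?_, ?_, ?_,
    ?_, ?_, ?_, ?_, ?_, ?_, ?_, ?_, ?_, ?_, ?_, ?_⟩ <;>
  linarith [p 0 2 0 1, p 0 3 0 1, p 0 3 0 2, p 2 3 0 1, p 2 3 0 2, p 2 3 0 3, p 3 1 0 1,
    p 3 1 0 2, p 3 1 0 3, p 3 1 2 3, p 1 2 0 1, p 1 2 0 2, p 1 2 0 3,
    p 1 2 2 3, p 1 2 3 1]

lemma frameAct_apply {W : Fin 4 → Fin 4 → Fin 4 → Fin 4 → ℝ}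
    (h : ∀ i j k l, W i j k l = -W i j l k) (c : Fin 3 → ℂ) (i j : Fin 4) :
    frameAct W (sdForm c) i j =
      (-W i j 0 1 + Complex.I * W i j 2 3) * c 0 + (-W i j 0 2 + Complex.I * W i j 3 1) * c 1
        + (-W i j 0 3 + Complex.I * W i j 1 2) * c 2 := by
  have b := h i j
  have z : ∀ k, W i j k k = 0 := fun k => by linarith [b k k]
  simp only [frameAct, Matrix.of_apply, Fin.sum_univ_four, z]
  rw [b 1 0, b 2 0, b 3 0, b 3 2, b 1 3, b 2 1]
  simp [eta, sdForm]
  ring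

lemma sdForm_anti (c : Fin 3 → ℂ) (i j : Fin 4) : sdForm c i j = -sdForm c j i := by
  fin_cases i <;> fin_cases j <;> simp [sdForm]

lemma ext_of_anti {A B : Matrix (Fin 4) (Fin 4) ℂ} (hA : ∀ i j, A i j = -A j i)
    (hB : ∀ i j, B i j = -B j i) (e01 : A 0 1 = B 0 1) (e02 : A 0 2 = B 0 2)
    (e03 : A 0 3 = B 0 3) (e23 : A 2 3 = B 2 3) (e31 : A 3 1 = B 3 1) (e12 : A 1 2 = B 1 2) :
    A = B := by
  have diag : ∀ i, A i i = B i i := fun i => by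
    rw [self_eq_neg.mp (hA i i), self_eq_neg.mp (hB i i)]
  refine Matrix.ext fun i j => ?_
  fin_cases i <;> fin_cases j <;> first
    | exact diag _
    | assumption
    | (refine (hA _ _).trans ((neg_inj.mpr ?_).trans (hB _ _).symm); assumption)

/-- A trace-free curvature tensor commutes with the Hodge star, hence preserves self-dual bivectors:
the entries 23, 31, 12 of the image are `i` times its entries 01, 02, 03. -/
lemma frameAct_sdForm {W : Fin 4 → Fin 4 → Fin 4 → Fin 4 → ℝ} (h : IsCurvatureLike W)
    (ht : ∀ j l, ∑ i, eta i * W i j i l = 0) (c : Fin 3 → ℂ) :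
    frameAct W (sdForm c) = sdForm ((weylQ W).mulVec c) := by
  obtain ⟨h1, h2, h3, h4, h5, h6, h7, h8, h9, h10, h11, h12, h13,
    h14, h15, h16, h17, h18, h19, h20, h21, h22, h23, h24⟩ :=
    weyl_components h ht
  have key : ∀ i j, frameAct W (sdForm c) i j = -frameAct W (sdForm c) j i := fun i j => by
    simp only [frameAct_apply h.anti₂, h.anti₁ i j]
    push_cast
    ring
  have e01 : frameAct W (sdForm c) 0 1 = sdForm ((weylQ W).mulVec c) 0 1 := by
    rw [frameAct_apply h.anti₂]
    simp [sdForm, weylQ, Matrix.mulVec, dotProduct, Fin.sum_univ_three]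
  have e02 : frameAct W (sdForm c) 0 2 = sdForm ((weylQ W).mulVec c) 0 2 := by
    rw [frameAct_apply h.anti₂]
    simp [sdForm, weylQ, Matrix.mulVec, dotProduct, Fin.sum_univ_three, *]
  have e03 : frameAct W (sdForm c) 0 3 = sdForm ((weylQ W).mulVec c) 0 3 := by
    rw [frameAct_apply h.anti₂]
    simp [sdForm, weylQ, Matrix.mulVec, dotProduct, Fin.sum_univ_three, *]
  have e23 : frameAct W (sdForm c) 2 3 = sdForm ((weylQ W).mulVec c) 2 3 := by
    rw [frameAct_apply h.anti₂]
    simp [sdForm, weylQ, Matrix.mulVec, dotProduct, Fin.sum_univ_three, *]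
    ring_nf
    simp
    ring
  have e31 : frameAct W (sdForm c) 3 1 = sdForm ((weylQ W).mulVec c) 3 1 := by
    rw [frameAct_apply h.anti₂]
    simp [sdForm, weylQ, Matrix.mulVec, dotProduct, Fin.sum_univ_three, *]
    ring_nf
    simp
    ring
  have e12 : frameAct W (sdForm c) 1 2 = sdForm ((weylQ W).mulVec c) 1 2 := by
    rw [frameAct_apply h.anti₂]
    simp [sdForm, weylQ, Matrix.mulVec, dotProduct, Fin.sum_univ_three, *]
    ring_nf
    simp
    ring
  exact ext_of_anti key (sdForm_anti _) e01 e02 e03 e23 e31 e12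

end

/-! ### Type D with `Ψ₀ = Ψ₄ = 0` implies `Ψ₁ = Ψ₃ = 0`. -/

section
lemma sdForm_add (c d : Fin 3 → ℂ) : sdForm (c + d) = sdForm c + sdForm d := by
  ext i j
  fin_cases i <;> fin_cases j <;> simp [sdForm] <;> ring

lemma sdForm_smul (a : ℂ) (c : Fin 3 → ℂ) : sdForm (a • c) = a • sdForm c := by
  ext i j
  fin_cases i <;> fin_cases j <;> simp [sdForm] <;> ring

/-- Type D in an orthonormal frame: if moreover `Ψ₀ = Ψ₄ = 0` for the null directions of the first
two frame vectors, then also `Ψ₁ = Ψ₃ = 0`. -/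
lemma IsCurvatureLike.psi_one_three {R : Fin 4 → Fin 4 → Fin 4 → Fin 4 → ℝ}
    (h : IsCurvatureLike R) {ρ : ℂ}
    (hρ : ∀ c, let φ := frameAct (frameWeyl R) (sdForm c) + (2 * ρ) • sdForm c
      frameAct (frameWeyl R) φ - ρ • φ = 0)
    (h₁ : R 0 2 0 2 + R 1 2 1 2 - R 0 3 0 3 - R 1 3 1 3 = 0)
    (h₂ : R 0 2 1 2 + R 1 2 0 2 - R 0 3 1 3 - R 1 3 0 3 = 0)
    (h₃ : R 0 2 0 3 + R 0 3 0 2 + R 1 2 1 3 + R 1 3 1 2 = 0)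
    (h₄ : R 0 2 1 3 + R 1 2 0 3 + R 0 3 1 2 + R 1 3 0 2 = 0) :
    R 0 1 0 2 + R 3 1 3 2 = 0 ∧ R 0 1 0 3 + R 2 1 2 3 = 0 ∧
      R 0 1 3 1 - R 2 0 2 3 = 0 ∧ R 0 1 1 2 + R 3 0 3 2 = 0 := by
  set Q := weylQ (frameWeyl R) with hQ
  have key : ∀ c, Q.mulVec (Q.mulVec c + (2 * ρ) • c) - ρ • (Q.mulVec c + (2 * ρ) • c) = 0 := by
    intro c
    have h1 := hρ c
    simp only [frameAct_sdForm h.weyl (frameWeyl_trace R), ← sdForm_smul, ← sdForm_add] at h1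
    have h2 : sdForm (Q.mulVec (Q.mulVec c + (2 * ρ) • c)) =
      sdForm (ρ • (Q.mulVec c + (2 * ρ) • c)) := sub_eq_zero.mp h1
    rw [sub_eq_zero]
    funext i
    have h3 := fun j => congrFun (congrFun h2 0) j
    have h31 := h3 1
    have h32 := h3 2
    have h33 := h3 3
    simp only [sdForm] at h31 h32 h33
    fin_cases i
    · simpa using h31
    · simpa using h32
    · simpa using h33
  have a1 := h.anti₁
  have a2 := h.anti₂
  have p := h.pair
  have z₁ : ∀ i k l, R i i k l = 0 := fun i k l => by linarith [h.anti₁ i i k l]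
  -- `Ψ₀ = Ψ₄ = 0` says that the lower right 2×2 block of the symmetric matrix `Q` is scalar.
  have e12 : Q 1 2 = 0 := by
    have u : frameWeyl R 0 2 0 3 = 0 := by
      simp [frameWeyl, frameRicci, Fin.sum_univ_four, eta, z₁]
      linarith [a1 3 2 3 3, a2 3 2 3 3, a1 2 3 2 2, p 0 2 0 3, p 1 2 1 3, a2 2 2 2 2, z₁ 2 2 3,
        a2 3 2 3 3]
    have v : frameWeyl R 0 2 1 2 = 0 := by
      simp [frameWeyl, frameRicci, Fin.sum_univ_four, eta, z₁]
      linarith [a1 2 0 2 1, a2 0 2 2 1, a1 3 0 3 1, a2 0 3 3 1, p 0 2 1 2, p 0 3 1 3, a2 1 0 1 1,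
        a1 1 0 1 1]
    simp [hQ, weylQ, u, v]
  have e22 : Q 2 2 = Q 1 1 := by
    have u : frameWeyl R 0 2 0 2 = frameWeyl R 0 3 0 3 := by
      simp [frameWeyl, frameRicci, Fin.sum_univ_four, eta, z₁]
      linarith [a1 3 2 3 2, a2 2 3 3 2]
    have v : frameWeyl R 0 2 3 1 = frameWeyl R 0 3 1 2 := by
      simp [frameWeyl, frameRicci, Fin.sum_univ_four, eta, z₁]
      linarith [a2 0 2 3 1, p 0 2 1 3, p 0 3 1 2]
    simp [hQ, weylQ, u, v]
  have s10 : Q 1 0 = Q 0 1 := rfl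
  have s20 : Q 2 0 = Q 0 2 := rfl
  have s21 : Q 2 1 = Q 1 2 := rfl
  -- Now `Q` has rows `(A, p, q)`, `(p, B, 0)`, `(q, 0, B)`. In `(Q - ρ)(Q + 2ρ) = 0` the entry
  -- (2,1) gives `pq = 0`, and the difference of the entries (1,1) and (2,2) gives `p² = q²`.
  have k1 := key ![0, 1, 0]
  have k2 := key ![0, 0, 1]
  have k11 := congrFun k1 1
  have k12 := congrFun k1 2
  have k22 := congrFun k2 2
  have mv : ∀ v i, Q.mulVec v i = Q i 0 * v 0 + Q i 1 * v 1 + Q i 2 * v 2 := fun v i => by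
    simp [Matrix.mulVec, dotProduct, Fin.sum_univ_three]
  simp only [mv, Pi.add_apply, Pi.smul_apply, Pi.sub_apply, smul_eq_mul] at k11 k12 k22
  simp [s10, s20, s21, e12, e22] at k11 k12 k22
  have hab : Q 0 1 = 0 ∧ Q 0 2 = 0 := by
    have hsq : Q 0 1 * Q 0 1 = Q 0 2 * Q 0 2 := by linear_combination k11 - k22
    rcases k12 with h0 | h0 <;> simp [h0] at hsq <;> simp [h0, hsq]
  have q1 : (-frameWeyl R 0 1 0 2 + Complex.I * frameWeyl R 0 1 3 1 : ℂ) = 0 := hab.1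
  have q2 : (-frameWeyl R 0 1 0 3 + Complex.I * frameWeyl R 0 1 1 2 : ℂ) = 0 := hab.2
  have r1 := congrArg Complex.re q1
  have i1 := congrArg Complex.im q1
  have r2 := congrArg Complex.re q2
  have i2 := congrArg Complex.im q2
  simp [frameWeyl, frameRicci, Fin.sum_univ_four, eta, z₁] at r1 i1 r2 i2
  refine ⟨?_, ?_, ?_, ?_⟩
  · linarith [a2 2 1 2 2, a1 2 1 2 2]
  · linarith [a1 3 1 3 3, a2 3 1 3 3]
  · linarith [a1 0 1 1 3, a2 0 1 3 1, a2 3 0 3 3]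
  · linarith [a1 0 1 1 2, a2 2 0 2 2]

end

section
/-! ### Calculus of smooth functions -/

/-- Smoothness at a point. -/
abbrev Sm {F : Type*} [NormedAddCommGroup F] [NormedSpace ℝ F] (f : Coord → F) (u : Coord) :
    Prop := ContDiffAt ℝ ∞ f u

lemma Sm.diff {f : Coord → ℝ} {u : Coord} (hf : Sm f u) : DifferentiableAt ℝ f u :=
  hf.differentiableAt (by simp)

lemma Sm.pd {f : Coord → ℝ} {u : Coord} (hf : Sm f u) (i : Fin 4) : Sm (pd i f) u :=
  (hf.fderiv_right (m := ∞) (by simp)).clm_apply contDiffAt_const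

lemma pd_congr {f h : Coord → ℝ} {u : Coord} (hfh : f =ᶠ[𝓝 u] h) (i : Fin 4) :
    pd i f u = pd i h u := by
  simp only [pd, hfh.fderiv_eq]

lemma pd_const (c : ℝ) (i : Fin 4) (u : Coord) : pd i (fun _ => c) u = 0 := by
  simp [pd]

lemma pd_add {f h : Coord → ℝ} {u : Coord} (hf : DifferentiableAt ℝ f u)
    (hh : DifferentiableAt ℝ h u) (i : Fin 4) :
    pd i (fun v => f v + h v) u = pd i f u + pd i h u := by
  simp only [pd]
  rw [fderiv_fun_add hf hh]
  rfl

lemma pd_neg {f : Coord → ℝ} {u : Coord} (i : Fin 4) :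
    pd i (fun v => -f v) u = -pd i f u := by
  simp only [pd]
  rw [fderiv_fun_neg]
  rfl

lemma pd_sub {f h : Coord → ℝ} {u : Coord} (hf : DifferentiableAt ℝ f u)
    (hh : DifferentiableAt ℝ h u) (i : Fin 4) :
    pd i (fun v => f v - h v) u = pd i f u - pd i h u := by
  simp only [pd]
  rw [fderiv_fun_sub hf hh]
  rfl

lemma pd_mul {f h : Coord → ℝ} {u : Coord} (hf : DifferentiableAt ℝ f u)
    (hh : DifferentiableAt ℝ h u) (i : Fin 4) :
    pd i (fun v => f v * h v) u = pd i f u * h u + f u * pd i h u := by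
  simp only [pd]
  rw [fderiv_fun_mul hf hh]
  simp
  ring

lemma pd_const_mul {f : Coord → ℝ} {u : Coord} (hf : DifferentiableAt ℝ f u) (c : ℝ)
    (i : Fin 4) : pd i (fun v => c * f v) u = c * pd i f u := by
  rw [pd_mul (differentiableAt_const c) hf, pd_const, zero_mul, zero_add]

lemma pd_sum {ι : Type*} (s : Finset ι) {f : ι → Coord → ℝ} {u : Coord}
    (hf : ∀ k ∈ s, DifferentiableAt ℝ (f k) u) (i : Fin 4) :
    pd i (fun v => ∑ k ∈ s, f k v) u = ∑ k ∈ s, pd i (f k) u := by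
  simp only [pd]
  rw [fderiv_fun_sum hf]
  simp

lemma fderiv_apply_eq_sum {F : Type*} [NormedAddCommGroup F] [NormedSpace ℝ F]
    (A : Coord →L[ℝ] F) (w : Coord) : A w = ∑ a, w a • A (EuclideanSpace.single a 1) := by
  conv_lhs => rw [← (EuclideanSpace.basisFun (Fin 4) ℝ).sum_repr w]
  simp [map_sum]

lemma pd_comm {f : Coord → ℝ} {u : Coord} (hf : Sm f u) (i j : Fin 4) :
    pd i (pd j f) u = pd j (pd i f) u := by
  have h2 : IsSymmSndFDerivAt ℝ f u := by
    apply hf.isSymmSndFDerivAt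
    simp
    exact WithTop.coe_le_coe.mpr le_top
  have hd : DifferentiableAt ℝ (fderiv ℝ f) u :=
    (hf.fderiv_right (m := ∞) (by simp)).differentiableAt (by simp)
  have key : ∀ i j, pd i (pd j f) u
      = fderiv ℝ (fderiv ℝ f) u (EuclideanSpace.single i 1) (EuclideanSpace.single j 1) := by
    intro i j
    change fderiv ℝ (fun v => fderiv ℝ f v (EuclideanSpace.single j 1)) u _ = _
    rw [fderiv_clm_apply hd (differentiableAt_const _)]
    simp
  rw [key, key]
  exact h2 _ _

/-! ### Matrix-valued functions -/

/-- The entrywise partial derivative of a matrix function. -/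
def mpd {m n : Type*} (i : Fin 4) (T : Coord → Matrix m n ℝ) (u : Coord) : Matrix m n ℝ :=
  Matrix.of fun a b => pd i (fun v => T v a b) u

/-- Entrywise smoothness of a matrix function. -/
def MSm {m n : Type*} (T : Coord → Matrix m n ℝ) (u : Coord) : Prop :=
  ∀ a b, Sm (fun v => T v a b) u

/-- Entrywise differentiability of a matrix function. -/
def EntryDiff {m n : Type*} (T : Coord → Matrix m n ℝ) (u : Coord) : Prop :=
  ∀ a b, DifferentiableAt ℝ (fun v => T v a b) u

variable {l m n : Type*}

lemma MSm.diff {T : Coord → Matrix m n ℝ} {u : Coord} (h : MSm T u) : EntryDiff T u :=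
  fun a b => (h a b).diff

lemma MSm.mpd {T : Coord → Matrix m n ℝ} {u : Coord} (h : MSm T u) (i : Fin 4) :
    MSm (mpd i T) u := fun a b => (h a b).pd i

lemma MSm.mul [Fintype m] {S : Coord → Matrix l m ℝ} {T : Coord → Matrix m n ℝ} {u : Coord}
    (hS : MSm S u) (hT : MSm T u) : MSm (fun v => S v * T v) u := fun a b => by
  simp only [Matrix.mul_apply]
  exact ContDiffAt.sum fun k _ => (hS a k).mul (hT k b)

lemma MSm.add {S T : Coord → Matrix m n ℝ} {u : Coord}
    (hS : MSm S u) (hT : MSm T u) : MSm (fun v => S v + T v) u := fun a b =>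
  (hS a b).add (hT a b)

lemma MSm.sub {S T : Coord → Matrix m n ℝ} {u : Coord}
    (hS : MSm S u) (hT : MSm T u) : MSm (fun v => S v - T v) u := fun a b =>
  (hS a b).sub (hT a b)

lemma MSm.smul {f : Coord → ℝ} {T : Coord → Matrix m n ℝ} {u : Coord}
    (hf : Sm f u) (hT : MSm T u) : MSm (fun v => f v • T v) u := fun a b =>
  ContDiffAt.mul hf (hT a b)

lemma MSm.transpose {T : Coord → Matrix m n ℝ} {u : Coord} (hT : MSm T u) :
    MSm (fun v => (T v).transpose) u := fun a b => hT b a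

lemma MSm.const (A : Matrix m n ℝ) (u : Coord) : MSm (fun _ => A) u :=
  fun _ _ => contDiffAt_const

lemma MSm.congr {S T : Coord → Matrix m n ℝ} {u : Coord} (hS : MSm S u) (h : T =ᶠ[𝓝 u] S) :
    MSm T u := fun a b => (hS a b).congr_of_eventuallyEq (h.mono fun v hv => by simp [hv])

lemma mpd_mul [Fintype m] {S : Coord → Matrix l m ℝ} {T : Coord → Matrix m n ℝ} {u : Coord}
    (hS : EntryDiff S u) (hT : EntryDiff T u) (i : Fin 4) :
    mpd i (fun v => S v * T v) u = mpd i S u * T u + S u * mpd i T u := by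
  ext a b
  simp only [mpd, Matrix.of_apply, Matrix.mul_apply, Matrix.add_apply]
  refine (pd_sum _ (f := fun k v => S v a k * T v k b)
    (fun k _ => (hS a k).mul (hT k b)) i).trans ?_
  rw [← Finset.sum_add_distrib]
  exact Finset.sum_congr rfl fun k _ => pd_mul (hS a k) (hT k b) i

lemma mpd_add {S T : Coord → Matrix m n ℝ} {u : Coord} (hS : EntryDiff S u) (hT : EntryDiff T u)
    (i : Fin 4) : mpd i (fun v => S v + T v) u = mpd i S u + mpd i T u := by
  ext a b
  exact pd_add (hS a b) (hT a b) i

lemma mpd_transpose (T : Coord → Matrix m n ℝ) (u : Coord) (i : Fin 4) :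
    mpd i (fun v => (T v).transpose) u = (mpd i T u).transpose := rfl

lemma mpd_const (A : Matrix m n ℝ) (u : Coord) (i : Fin 4) : mpd i (fun _ => A) u = 0 := by
  ext a b
  exact pd_const _ i u

lemma mpd_congr {S T : Coord → Matrix m n ℝ} {u : Coord} (h : S =ᶠ[𝓝 u] T) (i : Fin 4) :
    mpd i S u = mpd i T u := by
  ext a b
  exact pd_congr (h.mono fun v hv => by simp [hv]) i

lemma mpd_comm {T : Coord → Matrix m n ℝ} {u : Coord} (h : MSm T u) (i j : Fin 4) :
    mpd i (mpd j T) u = mpd j (mpd i T) u := by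
  ext a b
  exact pd_comm (h a b) i j

lemma MSm.det [Fintype m] [DecidableEq m] {T : Coord → Matrix m m ℝ} {u : Coord} (h : MSm T u) :
    Sm (fun v => (T v).det) u := by
  simp only [Matrix.det_apply]
  exact ContDiffAt.sum fun σ _ => ContDiffAt.const_smul _ (contDiffAt_prod fun i _ => h _ _)

/-- By Cramer's rule the entries are quotients of determinants. -/
lemma MSm.inv [Fintype m] [DecidableEq m] {T : Coord → Matrix m m ℝ} {u : Coord} (h : MSm T u)
    (hu : (T u).det ≠ 0) : MSm (fun v => (T v)⁻¹) u := by
  intro a b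
  simp only [Matrix.inv_def, Matrix.smul_apply, Ring.inverse_eq_inv', Matrix.adjugate_apply]
  refine ContDiffAt.mul (h.det.inv hu) (MSm.det fun i j => ?_)
  by_cases hi : i = b
  · subst hi
    simp only [Matrix.updateRow_self]
    exact contDiffAt_const
  · simp only [Matrix.updateRow_ne hi]
    exact h i j

end

section
abbrev Mat : Type := Matrix (Fin 4) (Fin 4) ℝ

variable {g T E : Coord → Mat} {u : Coord}

/-! ### The Levi-Civita connection -/

/-- The connection matrices `(Γ_a)^k_b`. -/
def conn (g : Coord → Mat) (a : Fin 4) (u : Coord) : Mat :=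
  Matrix.of fun k b => christoffel g k a b u

lemma covDeriv_eq (a b c : Fin 4) : covDeriv g T u a b c =
    (mpd a T u - (conn g a u)ᵀ * T u - T u * conn g a u) b c := by
  simp [covDeriv, mpd, conn, Matrix.mul_apply, mul_comm]

/-- The curvature matrices `(R_{cd})^a_b`. -/
def curvM (g : Coord → Mat) (c d : Fin 4) (u : Coord) : Mat :=
  mpd c (conn g d) u - mpd d (conn g c) u + conn g c u * conn g d u - conn g d u * conn g c u

lemma riemannUp_eq (a b c d : Fin 4) : riemannUp g u a b c d = curvM g c d u a b := by
  simp [riemannUp, curvM, mpd, conn, Matrix.mul_apply]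

lemma riemann_eq (a b c d : Fin 4) : riemann g u a b c d = (g u * curvM g c d u) a b := by
  simp [riemann, riemannUp_eq, Matrix.mul_apply]

lemma conn_symm (hg : ∀ v, (g v)ᵀ = g v) (a b k : Fin 4) :
    conn g a u k b = conn g b u k a := by
  have h : ∀ i j, (fun v => g v i j) = fun v => g v j i := fun i j => by
    funext v
    exact congrFun (congrFun (hg v).symm i) j
  simp only [conn, christoffel, Matrix.of_apply]
  congr 1
  refine Finset.sum_congr rfl fun l _ => ?_
  rw [h a b]
  ring

lemma mul_conn (hdet : (g u).det ≠ 0) (a k b : Fin 4) :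
    (g u * conn g a u) k b =
      1 / 2 * (mpd a g u b k + mpd b g u a k - mpd k g u a b) := by
  have h : conn g a u = (g u)⁻¹ * Matrix.of fun l b =>
      1 / 2 * (mpd a g u b l + mpd b g u a l - mpd l g u a b) := by
    ext k b
    simp only [conn, christoffel, gInv, Matrix.of_apply, Matrix.mul_apply, Finset.mul_sum, mpd]
    exact Finset.sum_congr rfl fun l _ => by ring
  rw [h, Matrix.mul_nonsing_inv_cancel_left _ _ (isUnit_iff_ne_zero.mpr hdet), Matrix.of_apply]

lemma mpd_symm (hg : ∀ v, (g v)ᵀ = g v) (a i j : Fin 4) : mpd a g u i j = mpd a g u j i := by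
  rw [← Matrix.transpose_apply (mpd a g u), ← mpd_transpose]
  simp only [hg]

lemma metric_compat (hg : ∀ v, (g v)ᵀ = g v) (hdet : (g u).det ≠ 0) (a : Fin 4) :
    mpd a g u = (conn g a u)ᵀ * g u + g u * conn g a u := by
  have h : (conn g a u)ᵀ * g u = (g u * conn g a u)ᵀ := by rw [Matrix.transpose_mul, hg]
  ext i j
  rw [h, Matrix.add_apply, Matrix.transpose_apply, mul_conn hdet, mul_conn hdet,
    mpd_symm hg a j i]
  ring

/-- Koszul's argument: the alternating cyclic sum of metric compatibility isolates `gΓ` once torsion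
vanishes. This yields the transformation law of the connection without transforming Christoffel
symbols by hand. -/
lemma conn_unique (hg : ∀ v, (g v)ᵀ = g v) (hdet : (g u).det ≠ 0) {Γ : Fin 4 → Mat}
    (hs : ∀ a b k, Γ a k b = Γ b k a)
    (hc : ∀ a, mpd a g u = (Γ a)ᵀ * g u + g u * Γ a) (a : Fin 4) : conn g a u = Γ a := by
  have hT : ∀ a, (Γ a)ᵀ * g u = (g u * Γ a)ᵀ := fun a => by rw [Matrix.transpose_mul, hg]
  have hS : ∀ a b k, (g u * Γ a) k b = (g u * Γ b) k a := fun a b k => by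
    simp only [Matrix.mul_apply]
    exact Finset.sum_congr rfl fun l _ => by rw [hs]
  have key : g u * conn g a u = g u * Γ a := by
    ext k b
    rw [mul_conn hdet, hc a, hc b, hc k, hT, hT, hT]
    simp only [Matrix.add_apply, Matrix.transpose_apply]
    rw [hS b a k, hS k a b, hS k b a]
    ring
  have := congrArg (fun M => (g u)⁻¹ * M) key
  simpa [Matrix.nonsing_inv_mul_cancel_left _ _ (isUnit_iff_ne_zero.mpr hdet)] using this

lemma MSm.conn (hg : MSm g u) (hdet : (g u).det ≠ 0) (a : Fin 4) : MSm (conn g a) u := by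
  intro k b
  simp only [Spacetime.conn, Matrix.of_apply, christoffel]
  refine contDiffAt_const.mul (ContDiffAt.sum fun l _ => ?_)
  exact (hg.inv hdet k l).mul
    ((((hg b l).pd a).add ((hg a l).pd b)).sub ((hg a b).pd l))

lemma curvM_anti (c d : Fin 4) : curvM g d c u = -curvM g c d u := by
  simp only [curvM]
  abel

lemma curvM_bianchi (hg : ∀ v, (g v)ᵀ = g v) (a b c d : Fin 4) :
    curvM g c d u a b + curvM g d b u a c + curvM g b c u a d = 0 := by
  have hs : ∀ v a b k, Spacetime.conn g a v k b = Spacetime.conn g b v k a := fun v a b k =>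
    conn_symm hg a b k
  have hd : ∀ i a b k, mpd i (Spacetime.conn g a) u k b = mpd i (Spacetime.conn g b) u k a :=
    fun i a b k => by
      simp only [mpd, Matrix.of_apply]
      congr 1
      funext v
      exact hs v a b k
  simp only [curvM, Matrix.add_apply, Matrix.sub_apply, Matrix.mul_apply]
  rw [hd c d b a, hd d b c a, hd b c d a]
  simp only [fun e => hs u d b e, fun e => hs u b c e, fun e => hs u c d e]
  ring

/-! ### Orthonormal frames -/

/-- The columns of `E` form an orthonormal frame for `g` at `u`. -/
def IsON (g E : Coord → Mat) (u : Coord) : Prop := (E u)ᵀ * g u * E u = Matrix.diagonal eta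

lemma eta_mul_self (i : Fin 4) : eta i * eta i = 1 := by
  fin_cases i <;> simp [eta]

lemma eta_mul_eta : (Matrix.diagonal eta : Mat) * Matrix.diagonal eta = 1 := by
  rw [Matrix.diagonal_mul_diagonal]
  simp [eta_mul_self]

lemma IsON.left_inv (h : IsON g E u) : (Matrix.diagonal eta * (E u)ᵀ * g u) * E u = 1 := by
  rw [Matrix.mul_assoc, Matrix.mul_assoc, ← Matrix.mul_assoc (E u)ᵀ, h, eta_mul_eta]

lemma IsON.inv_eq (h : IsON g E u) : (E u)⁻¹ = Matrix.diagonal eta * (E u)ᵀ * g u :=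
  Matrix.inv_eq_left_inv h.left_inv

lemma IsON.det_ne (h : IsON g E u) : (E u).det ≠ 0 := fun h0 => by
  have := congrArg Matrix.det h.left_inv
  simp [h0] at this

lemma IsON.metric_det_ne (h : IsON g E u) : (g u).det ≠ 0 := fun h0 => by
  have := congrArg Matrix.det h.left_inv
  simp [h0] at this

lemma IsON.inv_mul (h : IsON g E u) : (E u)⁻¹ * E u = 1 :=
  Matrix.nonsing_inv_mul _ (isUnit_iff_ne_zero.mpr h.det_ne)

lemma IsON.mul_inv (h : IsON g E u) : E u * (E u)⁻¹ = 1 :=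
  Matrix.mul_nonsing_inv _ (isUnit_iff_ne_zero.mpr h.det_ne)

lemma IsON.gInv_eq (h : IsON g E u) : gInv g u = E u * Matrix.diagonal eta * (E u)ᵀ := by
  refine Matrix.inv_eq_left_inv ?_
  have h1 := h.mul_inv
  rwa [h.inv_eq, ← Matrix.mul_assoc, ← Matrix.mul_assoc] at h1

/-- The connection matrices of the frame `E`, with form index in coordinates. -/
def fconn (g E : Coord → Mat) (a : Fin 4) (u : Coord) : Mat :=
  (E u)⁻¹ * (mpd a E u + conn g a u * E u)

lemma IsON.mul_fconn (h : IsON g E u) (a : Fin 4) :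
    E u * fconn g E a u = mpd a E u + conn g a u * E u := by
  rw [fconn, ← Matrix.mul_assoc, h.mul_inv, Matrix.one_mul]

lemma IsON.mpd_eq (h : IsON g E u) (a : Fin 4) :
    mpd a E u = E u * fconn g E a u - conn g a u * E u := by
  rw [h.mul_fconn, add_sub_cancel_right]

lemma MSm.fconn (hg : MSm g u) (hE : MSm E u) (h : IsON g E u) (a : Fin 4) :
    MSm (fconn g E a) u :=
  (hE.inv h.det_ne).mul ((hE.mpd a).add ((hg.conn h.metric_det_ne a).mul hE))

/-- Cartan's second structure equation. Differentiate `E ω_d = ∂_d E + Γ_d E` and antisymmetrise in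
`c, d`; the second derivatives of `E` cancel. -/
lemma fconn_curv (hg : MSm g u) (hE : MSm E u) (h : ∀ᶠ v in 𝓝 u, IsON g E v) (c d : Fin 4) :
    mpd c (fconn g E d) u - mpd d (fconn g E c) u + fconn g E c u * fconn g E d u
      - fconn g E d u * fconn g E c u = (E u)⁻¹ * curvM g c d u * E u := by
  have hu := h.self_of_nhds
  have key : ∀ c d, mpd c E u * fconn g E d u + E u * mpd c (fconn g E d) u =
      mpd c (mpd d E) u + (mpd c (Spacetime.conn g d) u * E u
        + Spacetime.conn g d u * mpd c E u) := by
    intro c d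
    have hev : (fun v => E v * Spacetime.fconn g E d v) =ᶠ[𝓝 u]
        fun v => mpd d E v + Spacetime.conn g d v * E v := h.mono fun v hv => hv.mul_fconn d
    have h1 := mpd_congr hev c
    have hΓ := (hg.conn hu.metric_det_ne d)
    rwa [mpd_mul hE.diff (hg.fconn hE hu d).diff,
      mpd_add (hE.mpd d).diff (hΓ.mul hE).diff,
      mpd_mul hΓ.diff hE.diff] at h1
  have k1 := key c d
  have k2 := key d c
  rw [mpd_comm hE d c] at k2
  have key2 : E u * (mpd c (Spacetime.fconn g E d) u - mpd d (Spacetime.fconn g E c) u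
      + Spacetime.fconn g E c u * Spacetime.fconn g E d u
      - Spacetime.fconn g E d u * Spacetime.fconn g E c u) = curvM g c d u * E u := by
    have e1 : E u * mpd c (Spacetime.fconn g E d) u = mpd c (mpd d E) u
      + (mpd c (Spacetime.conn g d) u * E u + Spacetime.conn g d u * mpd c E u)
      - mpd c E u * Spacetime.fconn g E d u := eq_sub_of_add_eq' k1
    have e2 : E u * mpd d (Spacetime.fconn g E c) u = mpd c (mpd d E) u
      + (mpd d (Spacetime.conn g c) u * E u + Spacetime.conn g c u * mpd d E u)
      - mpd d E u * Spacetime.fconn g E c u := eq_sub_of_add_eq' k2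
    rw [Matrix.mul_sub, Matrix.mul_add, Matrix.mul_sub, e1, e2, hu.mpd_eq c, hu.mpd_eq d, curvM]
    noncomm_ring
  rw [Matrix.mul_assoc, ← key2, ← Matrix.mul_assoc, hu.inv_mul, Matrix.one_mul]

/-- Differentiate the constant `Eᵀ g E = η`; by metric compatibility only the frame connection
survives. -/
lemma fconn_anti (hgs : ∀ v, (g v)ᵀ = g v) (hg : MSm g u) (hE : MSm E u)
    (h : ∀ᶠ v in 𝓝 u, IsON g E v) (a : Fin 4) :
    (Matrix.diagonal eta * fconn g E a u)ᵀ = -(Matrix.diagonal eta * fconn g E a u) := by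
  have hu := h.self_of_nhds
  have h1 : mpd a (fun v => (E v)ᵀ * g v * E v) u = 0 :=
    (mpd_congr (T := fun _ => Matrix.diagonal eta) h a).trans (mpd_const _ _ _)
  rw [mpd_mul (hE.transpose.mul hg).diff hE.diff, mpd_mul hE.transpose.diff hg.diff,
    mpd_transpose, metric_compat hgs hu.metric_det_ne, hu.mpd_eq] at h1
  have h2 : (Matrix.diagonal eta : Mat) = (E u)ᵀ * g u * E u := hu.symm
  rw [eq_neg_iff_add_eq_zero, Matrix.transpose_mul, Matrix.diagonal_transpose, h2, ← h1,
    Matrix.transpose_sub, Matrix.transpose_mul, Matrix.transpose_mul]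
  noncomm_ring

end

section
variable {g T E : Coord → Mat} {u : Coord}

/-! ### Frame components -/

/-- The derivative along the `k`-th frame vector. -/
def fd (E : Coord → Mat) (k : Fin 4) (f : Coord → ℝ) (u : Coord) : ℝ := ∑ a, E u a k * pd a f u

/-- The connection coefficients `γ k i j = θ^i(∇_{e_k} e_j)` of a frame. -/
def gam (g E : Coord → Mat) (u : Coord) (k : Fin 4) : Mat := ∑ a, E u a k • fconn g E a u

lemma gam_apply (k i j : Fin 4) : gam g E u k i j = ∑ a, E u a k * fconn g E a u i j := by
  simp [gam, Matrix.sum_apply]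

lemma Sm.gam (hg : MSm g u) (hE : MSm E u) (h : IsON g E u) (k i j : Fin 4) :
    Sm (fun v => gam g E v k i j) u := by
  simp only [gam_apply]
  exact ContDiffAt.sum fun a _ => (hE a k).mul (hg.fconn hE h a i j)

lemma gam_anti (hgs : ∀ v, (g v)ᵀ = g v) (hg : MSm g u) (hE : MSm E u)
    (h : ∀ᶠ v in 𝓝 u, IsON g E v) (k i j : Fin 4) :
    eta i * gam g E u k i j = -(eta j * gam g E u k j i) := by
  have h1 : ∀ a, eta i * fconn g E a u i j = -(eta j * fconn g E a u j i) := fun a => by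
    have h2 := congrFun (congrFun (fconn_anti hgs hg hE h a) j) i
    simpa using h2
  simp only [gam_apply, Finset.mul_sum, ← Finset.sum_neg_distrib]
  refine Finset.sum_congr rfl fun a _ => ?_
  linear_combination E u a k * h1 a

/-- The bracket `[e_k, e_l]` equals `∇_{e_k} e_l - ∇_{e_l} e_k` because the Christoffel symbols are
symmetric. -/
lemma fd_frame (hgs : ∀ v, (g v)ᵀ = g v) (h : IsON g E u) (a k l : Fin 4) :
    fd E k (fun v => E v a l) u - fd E l (fun v => E v a k) u =
      ∑ m, E u a m * (gam g E u k m l - gam g E u l m k) := by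
  have key : ∀ k l, fd E k (fun v => E v a l) u = ∑ m, E u a m * gam g E u k m l
      - ∑ c, ∑ b, conn g c u a b * E u c k * E u b l := by
    intro k l
    have h1 : ∀ c, pd c (fun v => E v a l) u = ∑ m, E u a m * fconn g E c u m l
        - ∑ b, conn g c u a b * E u b l := fun c => by
      have := congrFun (congrFun (h.mpd_eq c) a) l
      simpa [mpd, Matrix.mul_apply] using this
    simp only [fd, h1, mul_sub, Finset.sum_sub_distrib, gam_apply, Finset.mul_sum]
    congr 1
    · rw [Finset.sum_comm]
      exact Finset.sum_congr rfl fun m _ => Finset.sum_congr rfl fun c _ => by ring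
    · exact Finset.sum_congr rfl fun m _ => Finset.sum_congr rfl fun c _ => by ring
  rw [key k l, key l k]
  simp only [mul_sub, Finset.sum_sub_distrib]
  have hs : ∑ c, ∑ b, conn g c u a b * E u c k * E u b l
      = ∑ c, ∑ b, conn g c u a b * E u c l * E u b k := by
    rw [Finset.sum_comm]
    refine Finset.sum_congr rfl fun m _ => Finset.sum_congr rfl fun c _ => ?_
    rw [conn_symm hgs c m a]
    ring
  rw [hs]
  ring

lemma fd_sum_mul {f : Fin 4 → Coord → ℝ} (hE : MSm E u) (hf : ∀ a, DifferentiableAt ℝ (f a) u)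
    (k l : Fin 4) : fd E k (fun v => ∑ a, E v a l * f a v) u =
      ∑ a, fd E k (fun v => E v a l) u * f a u + ∑ a, ∑ c, E u c k * E u a l * pd c (f a) u := by
  have h1 : ∀ c, pd c (fun v => ∑ a, E v a l * f a v) u =
      ∑ a, (pd c (fun v => E v a l) u * f a u + E u a l * pd c (f a) u) := fun c => by
    refine (pd_sum _ (f := fun a v => E v a l * f a v) (fun a _ =>
      ((hE a l).diff).mul (hf a)) c).trans ?_
    exact Finset.sum_congr rfl fun a _ => pd_mul (hE a l).diff (hf a) c
  simp only [fd, h1, Finset.mul_sum, mul_add, Finset.sum_add_distrib, Finset.sum_mul]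
  congr 1
  · rw [Finset.sum_comm]
    exact Finset.sum_congr rfl fun a _ => Finset.sum_congr rfl fun c _ => by ring
  · rw [Finset.sum_comm]
    exact Finset.sum_congr rfl fun a _ => Finset.sum_congr rfl fun c _ => by ring

/-- The exterior derivative of the 1-form `f`, evaluated on frame vectors. -/
lemma fd_sub_fd_of_form (hgs : ∀ v, (g v)ᵀ = g v) (hE : MSm E u) (h : IsON g E u)
    {f : Fin 4 → Coord → ℝ} (hf : ∀ a, DifferentiableAt ℝ (f a) u) (k l : Fin 4) :
    fd E k (fun v => ∑ a, E v a l * f a v) u - fd E l (fun v => ∑ a, E v a k * f a v) u =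
      ∑ m, (gam g E u k m l - gam g E u l m k) * ∑ a, E u a m * f a u
        + ∑ a, ∑ c, E u c k * E u a l * (pd c (f a) u - pd a (f c) u) := by
  rw [fd_sum_mul hE hf, fd_sum_mul hE hf]
  have h1 : ∑ a, fd E k (fun v => E v a l) u * f a u - ∑ a, fd E l (fun v => E v a k) u * f a u
      = ∑ m, (gam g E u k m l - gam g E u l m k) * ∑ a, E u a m * f a u := by
    rw [← Finset.sum_sub_distrib]
    simp only [← sub_mul, fd_frame hgs h, Finset.sum_mul, Finset.mul_sum]
    rw [Finset.sum_comm]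
    exact Finset.sum_congr rfl fun a _ => Finset.sum_congr rfl fun c _ => by ring
  have h2 : ∑ a, ∑ c, E u c k * E u a l * (pd c (f a) u - pd a (f c) u) =
      ∑ a, ∑ c, E u c k * E u a l * pd c (f a) u
        - ∑ a, ∑ c, E u c l * E u a k * pd c (f a) u := by
    rw [Finset.sum_comm (f := fun a c => E u c l * E u a k * pd c (f a) u),
      ← Finset.sum_sub_distrib]
    refine Finset.sum_congr rfl fun a _ => ?_
    rw [← Finset.sum_sub_distrib]
    exact Finset.sum_congr rfl fun c _ => by ring
  rw [h2, ← h1]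
  ring

lemma fd_comm (hgs : ∀ v, (g v)ᵀ = g v) (hE : MSm E u) (h : IsON g E u) {f : Coord → ℝ}
    (hf : Sm f u) (k l : Fin 4) : fd E k (fd E l f) u - fd E l (fd E k f) u =
      ∑ m, (gam g E u k m l - gam g E u l m k) * fd E m f u := by
  have := fd_sub_fd_of_form hgs hE h (f := fun a => pd a f) (fun a => (hf.pd a).diff) k l
  refine this.trans ?_
  rw [Finset.sum_eq_zero (s := Finset.univ)
    (f := fun a => ∑ c, E u c k * E u a l * (pd c (pd a f) u - pd a (pd c f) u)), add_zero]
  · rfl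
  · intro a _
    exact Finset.sum_eq_zero fun c _ => by rw [pd_comm hf c a, sub_self, mul_zero]

/-- The curvature components in the frame `E`. -/
def frameRiem (g E : Coord → Mat) (u : Coord) (i j k l : Fin 4) : ℝ :=
  ((E u)ᵀ * g u * (∑ c, ∑ d, (E u c k * E u d l) • curvM g c d u) * E u) i j

/-- Contract the second structure equation with two frame vectors. Moving `E` inside the derivatives
of `ω` produces the bracket term `(γ k m l - γ l m k) * γ m i j`. -/
lemma frameRiem_eq (hgs : ∀ v, (g v)ᵀ = g v) (hg : MSm g u) (hE : MSm E u)
    (h : ∀ᶠ v in 𝓝 u, IsON g E v) :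
    frameRiem g E u = frameCurv (gam g E u)
      (fun k l => Matrix.of fun i j => fd E k (fun v => gam g E v l i j) u) := by
  have hu := h.self_of_nhds
  have h0 : (E u)ᵀ * g u = Matrix.diagonal eta * (E u)⁻¹ := by
    rw [hu.inv_eq, ← Matrix.mul_assoc, ← Matrix.mul_assoc, eta_mul_eta, Matrix.one_mul]
  funext i j k l
  have h1 : frameRiem g E u i j k l = eta i * ∑ c, ∑ d, E u c k * E u d l *
      (mpd c (fconn g E d) u - mpd d (fconn g E c) u + fconn g E c u * fconn g E d u
      - fconn g E d u * fconn g E c u) i j := by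
    simp only [fconn_curv hg hE h]
    rw [frameRiem, h0, Matrix.mul_assoc, Matrix.mul_assoc, Matrix.diagonal_mul]
    congr 1
    simp only [Finset.sum_mul, Finset.mul_sum, Matrix.sum_apply, Matrix.smul_mul, Matrix.mul_smul,
      Matrix.smul_apply, smul_eq_mul, Matrix.mul_assoc]
  rw [h1]
  simp only [frameCurv]
  congr 1
  have h2 := fd_sub_fd_of_form hgs hE hu (f := fun a v => fconn g E a v i j)
    (fun a => (hg.fconn hE hu a).diff i j) k l
  simp only [← gam_apply] at h2
  rw [Matrix.of_apply, Matrix.of_apply, h2, add_sub_cancel_left]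
  have h3 : ∀ k l, ∑ m, gam g E u k i m * gam g E u l m j =
      ∑ c, ∑ d, E u c k * E u d l * (fconn g E c u * fconn g E d u) i j := by
    intro k l
    rw [← Matrix.mul_apply, gam, gam, Finset.sum_mul]
    simp only [Finset.mul_sum, Matrix.sum_apply, Matrix.smul_mul, Matrix.mul_smul,
      Matrix.smul_apply, smul_eq_mul]
    exact Finset.sum_congr rfl fun a _ => Finset.sum_congr rfl fun c _ => by ring
  rw [Finset.sum_sub_distrib, h3 k l, h3 l k,
    Finset.sum_comm (f := fun c d => E u c l * E u d k * (fconn g E c u * fconn g E d u) i j),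
    Finset.sum_comm (f := fun a c => E u c k * E u a l *
      (pd c (fun v => fconn g E a v i j) u - pd a (fun v => fconn g E c v i j) u)),
    ← Finset.sum_sub_distrib, ← Finset.sum_add_distrib]
  refine Finset.sum_congr rfl fun c _ => ?_
  rw [← Finset.sum_sub_distrib, ← Finset.sum_add_distrib]
  refine Finset.sum_congr rfl fun d _ => ?_
  simp only [Matrix.sub_apply, Matrix.add_apply, mpd, Matrix.of_apply]
  ring

lemma frameCurv_anti {γ : Fin 4 → Mat} {dγ : Fin 4 → Fin 4 → Mat}
    (hγ : ∀ k i j, eta i * γ k i j = -(eta j * γ k j i))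
    (hd : ∀ l k i j, eta i * dγ l k i j = -(eta j * dγ l k j i)) (i j k l : Fin 4) :
    frameCurv γ dγ i j k l = -frameCurv γ dγ j i k l := by
  have h1 : ∑ m, eta i * ((γ k m l - γ l m k) * γ m i j) =
      -∑ m, eta j * ((γ k m l - γ l m k) * γ m j i) := by
    rw [← Finset.sum_neg_distrib]
    refine Finset.sum_congr rfl fun m _ => ?_
    linear_combination (γ k m l - γ l m k) * hγ m i j
  have h2 : ∑ m, eta i * (γ k i m * γ l m j - γ l i m * γ k m j) =
      -∑ m, eta j * (γ k j m * γ l m i - γ l j m * γ k m i) := by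
    rw [← Finset.sum_neg_distrib]
    refine Finset.sum_congr rfl fun m _ => ?_
    linear_combination γ l m j * hγ k i m - γ k m j * hγ l i m - γ k m i * hγ l m j
      + γ l m i * hγ k m j
  rw [frameCurv, frameCurv, mul_add, mul_sub, mul_sub, mul_add, mul_sub, mul_sub,
    Finset.mul_sum, Finset.mul_sum, Finset.mul_sum, Finset.mul_sum, h1, h2]
  linear_combination hd k l i j - hd l k i j

lemma pd_gam_anti (hgs : ∀ v, (g v)ᵀ = g v) (hg : ∀ᶠ v in 𝓝 u, MSm g v)
    (hE : ∀ᶠ v in 𝓝 u, MSm E v) (h : ∀ᶠ v in 𝓝 u, IsON g E v) (a k i j : Fin 4) :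
    eta i * pd a (fun v => gam g E v k i j) u = -(eta j * pd a (fun v => gam g E v k j i) u) := by
  have hd := fun i j => (Sm.gam hg.self_of_nhds hE.self_of_nhds h.self_of_nhds k i j).diff
  rw [← pd_const_mul (hd i j), ← pd_const_mul (hd j i), ← pd_neg]
  refine pd_congr ?_ a
  filter_upwards [hg, hE, h.eventually_nhds] with v h1 h2 h3 using gam_anti hgs h1 h2 h3 k i j

lemma frameRiem_apply (i j k l : Fin 4) : frameRiem g E u i j k l =
    ∑ e, ((E u)ᵀ * g u) i e *
      ∑ b, ∑ c, ∑ d, E u b j * E u c k * E u d l * curvM g c d u e b := by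
  rw [frameRiem, Matrix.mul_assoc, Matrix.mul_apply]
  refine Finset.sum_congr rfl fun e _ => ?_
  congr 1
  rw [Matrix.mul_apply]
  refine Finset.sum_congr rfl fun b _ => ?_
  simp only [Matrix.sum_apply, Matrix.smul_apply, smul_eq_mul, Finset.sum_mul]
  exact Finset.sum_congr rfl fun a _ => Finset.sum_congr rfl fun c _ => by ring

/-- Antisymmetry in the first pair is taken from the orthonormal frame, where the connection is
skew; the other two symmetries are inherited from the coordinate curvature matrices. -/
lemma frameRiem_curvatureLike (hgs : ∀ v, (g v)ᵀ = g v) (hg : ∀ᶠ v in 𝓝 u, MSm g v)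
    (hE : ∀ᶠ v in 𝓝 u, MSm E v) (h : ∀ᶠ v in 𝓝 u, IsON g E v) :
    IsCurvatureLike (frameRiem g E u) := by
  refine ⟨fun i j k l => ?_, fun i j k l => ?_, fun i j k l => ?_⟩
  · rw [frameRiem_eq hgs hg.self_of_nhds hE.self_of_nhds h]
    refine frameCurv_anti (gam_anti hgs hg.self_of_nhds hE.self_of_nhds h) ?_ i j k l
    intro l k i j
    simp only [Matrix.of_apply, fd, Finset.mul_sum, ← Finset.sum_neg_distrib]
    refine Finset.sum_congr rfl fun a _ => ?_
    linear_combination E u a l * pd_gam_anti hgs hg hE h a k i j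
  · simp only [frameRiem_apply]
    rw [← Finset.sum_neg_distrib]
    refine Finset.sum_congr rfl fun e _ => ?_
    rw [← mul_neg, ← Finset.sum_neg_distrib]
    congr 1
    refine Finset.sum_congr rfl fun b _ => ?_
    rw [Finset.sum_comm (f := fun c d => E u b j * E u c l * E u d k * curvM g c d u e b),
      ← Finset.sum_neg_distrib]
    refine Finset.sum_congr rfl fun c _ => ?_
    rw [← Finset.sum_neg_distrib]
    refine Finset.sum_congr rfl fun d _ => ?_
    rw [curvM_anti c d, Matrix.neg_apply]
    ring
  · simp only [frameRiem_apply]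
    rw [← Finset.sum_add_distrib, ← Finset.sum_add_distrib]
    refine Finset.sum_eq_zero fun e _ => ?_
    rw [← mul_add, ← mul_add]
    refine mul_eq_zero_of_right _ ?_
    have h1 : ∑ b, ∑ c, ∑ d, E u b k * E u c l * E u d j * curvM g c d u e b =
        ∑ b, ∑ c, ∑ d, E u b j * E u c k * E u d l * curvM g d b u e c := by
      rw [Finset.sum_comm_cycle]
      exact Finset.sum_congr rfl fun b _ => Finset.sum_congr rfl fun c _ =>
        Finset.sum_congr rfl fun d _ => by ring
    have h2 : ∑ b, ∑ c, ∑ d, E u b l * E u c j * E u d k * curvM g c d u e b =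
        ∑ b, ∑ c, ∑ d, E u b j * E u c k * E u d l * curvM g b c u e d := by
      rw [Finset.sum_comm_cycle, Finset.sum_comm_cycle]
      exact Finset.sum_congr rfl fun b _ => Finset.sum_congr rfl fun c _ =>
        Finset.sum_congr rfl fun d _ => by ring
    rw [h1, h2]
    simp only [← Finset.sum_add_distrib]
    refine Finset.sum_eq_zero fun b _ => Finset.sum_eq_zero fun c _ =>
      Finset.sum_eq_zero fun d _ => ?_
    linear_combination E u b j * E u c k * E u d l * curvM_bianchi hgs e b c d

end

section
variable {g T E : Coord → Mat} {u : Coord}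

/-! ### The Weyl tensor in a frame -/

/-- The components of a tensor of type `(0,4)` with respect to the columns of `e`. -/
def fr4 (e : Mat) (P : Fin 4 → Fin 4 → Fin 4 → Fin 4 → ℝ) (i j k l : Fin 4) : ℝ :=
  ∑ a, ∑ b, ∑ c, ∑ d, e a i * e b j * e c k * e d l * P a b c d

lemma fr4_mul (e : Mat) (A B : Fin 4 → Fin 4 → ℝ) (i j k l : Fin 4) :
    fr4 e (fun a b c d => A a c * B b d) i j k l =
      (∑ a, ∑ c, e a i * e c k * A a c) * ∑ b, ∑ d, e b j * e d l * B b d := by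
  simp only [Finset.sum_mul]
  simp only [fr4, Finset.mul_sum]
  refine Finset.sum_congr rfl fun a _ => ?_
  rw [Finset.sum_comm]
  refine Finset.sum_congr rfl fun c _ => Finset.sum_congr rfl fun b _ =>
    Finset.sum_congr rfl fun d _ => ?_
  ring

lemma fr4_swap (e : Mat) (P : Fin 4 → Fin 4 → Fin 4 → Fin 4 → ℝ) (i j k l : Fin 4) :
    fr4 e (fun a b c d => P a b d c) i j k l = fr4 e P i j l k := by
  simp only [fr4]
  refine Finset.sum_congr rfl fun a _ => Finset.sum_congr rfl fun b _ => ?_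
  rw [Finset.sum_comm]
  refine Finset.sum_congr rfl fun c _ => Finset.sum_congr rfl fun d _ => ?_
  ring

lemma fr4_swap' (e : Mat) (P : Fin 4 → Fin 4 → Fin 4 → Fin 4 → ℝ) (i j k l : Fin 4) :
    fr4 e (fun a b c d => P b a d c) i j k l = fr4 e P j i l k := by
  rw [fr4_swap e (fun a b c d => P b a c d)]
  simp only [fr4]
  rw [Finset.sum_comm]
  refine Finset.sum_congr rfl fun a _ => Finset.sum_congr rfl fun b _ =>
    Finset.sum_congr rfl fun c _ => Finset.sum_congr rfl fun d _ => ?_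
  ring

lemma sum_rotate₄ {α β : Type*} [Fintype α] [AddCommMonoid β] (f : α → α → α → α → β) :
    ∑ i, ∑ a, ∑ b, ∑ c, f i a b c = ∑ a, ∑ b, ∑ c, ∑ i, f i a b c := by
  rw [Finset.sum_comm]
  exact Finset.sum_congr rfl fun a _ => by rw [Finset.sum_comm_cycle, Finset.sum_comm_cycle]

lemma sum_rotate₅ {α β : Type*} [Fintype α] [AddCommMonoid β] (f : α → α → α → α → α → β) :
    ∑ i, ∑ a, ∑ b, ∑ c, ∑ d, f i a b c d = ∑ a, ∑ b, ∑ c, ∑ d, ∑ i, f i a b c d := by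
  rw [Finset.sum_comm]
  exact Finset.sum_congr rfl fun a _ => sum_rotate₄ _

lemma fr4_riemann (i j k l : Fin 4) :
    fr4 (E u) (riemann g u) i j k l = frameRiem g E u i j k l := by
  simp only [frameRiem_apply, Matrix.mul_apply, Matrix.transpose_apply, Finset.sum_mul]
  simp only [fr4, riemann_eq, Matrix.mul_apply, Finset.mul_sum]
  rw [Finset.sum_comm (γ := Fin 4) (f := fun e a => ∑ b, ∑ c, ∑ d, E u a i * g u a e *
    (E u b j * E u c k * E u d l * curvM g c d u e b))]
  refine Finset.sum_congr rfl fun a _ => ?_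
  conv_rhs => rw [sum_rotate₄]
  refine Finset.sum_congr rfl fun b _ => Finset.sum_congr rfl fun c _ =>
    Finset.sum_congr rfl fun d _ => Finset.sum_congr rfl fun e _ => ?_
  ring

lemma IsON.sum_eq (h : IsON g E u) (i k : Fin 4) :
    ∑ a, ∑ c, E u a i * E u c k * g u a c = Matrix.diagonal eta i k := by
  rw [← h, Matrix.mul_apply, Finset.sum_comm]
  simp only [Matrix.mul_apply, Matrix.transpose_apply, Finset.sum_mul]
  refine Finset.sum_congr rfl fun a _ => Finset.sum_congr rfl fun b _ => by ring

lemma IsON.ricci_eq (h : IsON g E u) (j l : Fin 4) :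
    ∑ b, ∑ d, E u b j * E u d l * ricci g u b d = frameRicci (frameRiem g E u) j l := by
  have h1 : ∀ i e, eta i * ((E u)ᵀ * g u) i e = (E u)⁻¹ i e := fun i e => by
    rw [h.inv_eq, Matrix.mul_assoc, Matrix.diagonal_mul]
  have h2 : ∀ c e, ∑ i, E u c i * (E u)⁻¹ i e = if c = e then 1 else 0 := fun c e => by
    rw [← Matrix.mul_apply, h.mul_inv, Matrix.one_apply]
  have h3 : frameRicci (frameRiem g E u) j l = ∑ e, ∑ b, ∑ c, ∑ d,
      (∑ i, E u c i * (E u)⁻¹ i e) * (E u b j * E u d l * curvM g c d u e b) := by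
    simp only [frameRicci, frameRiem_apply, Finset.mul_sum, ← mul_assoc, h1]
    rw [sum_rotate₅]
    refine Finset.sum_congr rfl fun e _ => Finset.sum_congr rfl fun b _ =>
      Finset.sum_congr rfl fun c _ => Finset.sum_congr rfl fun d _ => ?_
    simp only [Finset.sum_mul]
    exact Finset.sum_congr rfl fun i _ => by ring
  rw [h3]
  simp only [h2, ite_mul, one_mul, zero_mul, ricci, riemannUp_eq, Finset.mul_sum]
  rw [Finset.sum_comm_cycle]
  refine Finset.sum_congr rfl fun e _ => Finset.sum_congr rfl fun b _ => ?_
  rw [Finset.sum_comm]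
  simp

lemma IsON.scalarCurv_eq (h : IsON g E u) :
    scalarCurv g u = ∑ m, eta m * frameRicci (frameRiem g E u) m m := by
  have h1 : ∀ b d, gInv g u b d = ∑ m, E u b m * eta m * E u d m := fun b d => by
    rw [h.gInv_eq, Matrix.mul_apply]
    simp [Matrix.mul_diagonal]
  simp only [← h.ricci_eq, scalarCurv, h1, Finset.sum_mul, Finset.mul_sum]
  rw [Finset.sum_comm_cycle]
  refine Finset.sum_congr rfl fun a _ => Finset.sum_congr rfl fun b _ =>
    Finset.sum_congr rfl fun c _ => by ring

lemma fr4_weyl (h : IsON g E u) : fr4 (E u) (weyl g u) = frameWeyl (frameRiem g E u) := by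
  funext i j k l
  have e1 := fr4_mul (E u) (g u) (ricci g u) i j k l
  have e2 := fr4_mul (E u) (g u) (ricci g u) i j l k
  have e3 := fr4_mul (E u) (g u) (ricci g u) j i l k
  have e4 := fr4_mul (E u) (g u) (ricci g u) j i k l
  have e5 := fr4_mul (E u) (g u) (g u) i j k l
  have e6 := fr4_mul (E u) (g u) (g u) i j l k
  rw [← fr4_swap] at e2 e6
  rw [← fr4_swap'] at e3
  rw [← fr4_swap, ← fr4_swap'] at e4
  rw [h.sum_eq] at e1 e2 e3 e4 e5 e6
  rw [h.ricci_eq] at e1 e2 e3 e4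
  rw [h.sum_eq] at e5 e6
  rw [frameWeyl, ← h.scalarCurv_eq, ← fr4_riemann, ← e1, ← e2, ← e3, ← e4, ← e5, ← e6]
  simp only [fr4, Finset.mul_sum, ← Finset.sum_add_distrib, ← Finset.sum_sub_distrib, weyl]
  refine Finset.sum_congr rfl fun a _ => Finset.sum_congr rfl fun b _ =>
    Finset.sum_congr rfl fun c _ => Finset.sum_congr rfl fun d _ => ?_
  ring

lemma sum_fin_succ_fun {n : ℕ} (f : (Fin (n + 1) → Fin 4) → ℝ) :
    ∑ p, f p = ∑ a, ∑ p : Fin n → Fin 4, f (Matrix.vecCons a p) := by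
  rw [← Fintype.sum_prod_type', ← (Fin.consEquiv fun _ => Fin 4).sum_comp]
  rfl

/-- The right side is the determinant of the selected columns of `e`; expanding it multilinearly in
the standard basis gives the fourfold sum. -/
lemma fr4_leviCivita (e : Mat) (i j k l : Fin 4) :
    fr4 e leviCivita i j k l = e.det * leviCivita i j k l := by
  have h1 : e.det * leviCivita i j k l =
      Matrix.detRowAlternating fun r =>
        ∑ a, e a (![i, j, k, l] r) • (Pi.single a 1 : Fin 4 → ℝ) := by
    have h2 : (fun r => ∑ a, e a (![i, j, k, l] r) • (Pi.single a 1 : Fin 4 → ℝ)) =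
        (Matrix.of fun r s : Fin 4 => if ![i, j, k, l] r = s then (1 : ℝ) else 0) * eᵀ := by
      funext r s
      simp [Matrix.mul_apply, Finset.sum_apply, Pi.single_apply]
    rw [h2, leviCivita]
    refine Eq.trans ?_ (Matrix.det_mul _ _).symm
    rw [Matrix.det_transpose, mul_comm]
  rw [h1]
  have h3 := (Matrix.detRowAlternating (n := Fin 4) (R := ℝ)).toMultilinearMap.map_sum
    (fun r a => e a (![i, j, k, l] r) • (Pi.single a 1 : Fin 4 → ℝ))
  refine Eq.trans ?_ h3.symm
  simp only [MultilinearMap.map_smul_univ, sum_fin_succ_fun, Fintype.sum_unique, fr4]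
  refine Finset.sum_congr rfl fun a _ => Finset.sum_congr rfl fun b _ =>
    Finset.sum_congr rfl fun c _ => Finset.sum_congr rfl fun d _ => ?_
  have h4 : leviCivita a b c d = Matrix.detRowAlternating fun r =>
      (Pi.single (![a, b, c, d] r) 1 : Fin 4 → ℝ) := by
    rw [leviCivita]
    change Matrix.det _ = Matrix.det _
    congr 1
    ext r s
    simp [Pi.single_apply, eq_comm]
  rw [h4, smul_eq_mul, Fin.prod_univ_four]
  rfl

/-- `Eᵀ g E = η` gives `|det g| (det E)² = 1`, and positive orientation selects the root `√|det g| ·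
det E = 1`. -/
lemma fr4_volForm (h : IsON g E u) (hdet : 0 < (E u).det) :
    fr4 (E u) (volForm g u) = leviCivita := by
  funext i j k l
  have h1 : fr4 (E u) (volForm g u) i j k l =
      Real.sqrt |(g u).det| * fr4 (E u) leviCivita i j k l := by
    simp only [fr4, Finset.mul_sum, volForm]
    refine Finset.sum_congr rfl fun a _ => Finset.sum_congr rfl fun b _ =>
      Finset.sum_congr rfl fun c _ => Finset.sum_congr rfl fun d _ => ?_
    ring
  have h2 : |(g u).det| * (E u).det ^ 2 = 1 := by
    have h3 := congrArg Matrix.det h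
    rw [Matrix.det_mul, Matrix.det_mul, Matrix.det_transpose, Matrix.det_diagonal] at h3
    have h4 := congrArg abs h3
    rw [abs_mul, abs_mul, abs_of_pos hdet] at h4
    simp [Fin.prod_univ_four, eta] at h4
    linarith
  have h5 : Real.sqrt |(g u).det| * (E u).det = 1 := by
    rw [← Real.sqrt_sq hdet.le, ← Real.sqrt_mul (abs_nonneg _), h2, Real.sqrt_one]
  rw [h1, fr4_leviCivita, ← mul_assoc, h5, one_mul]

end

/-! ### Double 2-forms as matrices on index pairs, and the type D condition in a frame. -/

section
variable {g T E : Coord → Mat} {u : Coord}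

/-- The complexification of a real matrix. -/
def cx (A : Mat) : Matrix (Fin 4) (Fin 4) ℂ := A.map Complex.ofReal

lemma cx_mul (A B : Mat) : cx (A * B) = cx A * cx B := by
  exact Matrix.map_mul (f := Complex.ofRealHom)

lemma cx_one : cx 1 = 1 := by
  simp [cx]

lemma cx_transpose (A : Mat) : cx Aᵀ = (cx A)ᵀ := rfl

/-- A double 2-form as a complex matrix acting on pairs of indices. -/
def pairMat (P : Fin 4 → Fin 4 → Fin 4 → Fin 4 → ℝ) :
    Matrix (Fin 4 × Fin 4) (Fin 4 × Fin 4) ℂ :=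
  Matrix.of fun p q => (P p.1 p.2 q.1 q.2 : ℂ)

/-- A matrix as a vector indexed by pairs. -/
def pairVec (F : Matrix (Fin 4) (Fin 4) ℂ) : Fin 4 × Fin 4 → ℂ := fun p => F p.1 p.2

/-- On vectors indexed by pairs, raising both indices is the Kronecker square of `g⁻¹`. A change of
frame then reduces to associativity of matrix products. -/
lemma pairVec_dblAct (P : Fin 4 → Fin 4 → Fin 4 → Fin 4 → ℝ) (F : Matrix (Fin 4) (Fin 4) ℂ) :
    pairVec (dblAct g u P F) = (1 / 2 : ℂ) •
      (pairMat P *ᵥ ((cx (gInv g u) ⊗ₖ cx (gInv g u)) *ᵥ pairVec F)) := by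
  funext p
  simp only [pairVec, dblAct, Matrix.of_apply, Pi.smul_apply, smul_eq_mul, Matrix.mulVec,
    dotProduct, Fintype.sum_prod_type, pairMat, Matrix.kroneckerMap_apply, cx, Matrix.map_apply,
    Finset.mul_sum, mul_assoc]

lemma pairVec_frameAct (P : Fin 4 → Fin 4 → Fin 4 → Fin 4 → ℝ) (F : Matrix (Fin 4) (Fin 4) ℂ) :
    pairVec (frameAct P F) = (1 / 2 : ℂ) •
      (pairMat P *ᵥ ((cx (diagonal eta) ⊗ₖ cx (diagonal eta)) *ᵥ pairVec F)) := by
  have h : cx (diagonal eta) = diagonal fun i => (eta i : ℂ) := by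
    simp [cx, Matrix.diagonal_map]
  have h2 : (cx (diagonal eta) ⊗ₖ cx (diagonal eta)) *ᵥ pairVec F =
      fun p => ((eta p.1 : ℂ) * eta p.2) * F p.1 p.2 := by
    funext q
    rw [h, Matrix.diagonal_kronecker_diagonal, Matrix.mulVec_diagonal, pairVec]
  funext p
  rw [h2]
  simp only [Pi.smul_apply, Matrix.mulVec, dotProduct, pairVec, pairMat,
    Fintype.sum_prod_type, frameAct, Matrix.of_apply, smul_eq_mul, mul_assoc]

lemma pairMat_fr4 (e : Mat) (P : Fin 4 → Fin 4 → Fin 4 → Fin 4 → ℝ) :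
    pairMat (fr4 e P) = (cx e ⊗ₖ cx e)ᵀ * pairMat P * (cx e ⊗ₖ cx e) := by
  ext p q
  simp only [pairMat, fr4, Matrix.of_apply, Matrix.mul_apply, Fintype.sum_prod_type,
    Matrix.transpose_apply, Matrix.kroneckerMap_apply, cx, Matrix.map_apply, Finset.sum_mul]
  push_cast
  conv_rhs => rw [sum_rotate₄, sum_rotate₄]
  refine Finset.sum_congr rfl fun a _ => Finset.sum_congr rfl fun b _ =>
    Finset.sum_congr rfl fun c _ => Finset.sum_congr rfl fun d _ => ?_
  ring

lemma pairVec_fr2 (e F : Matrix (Fin 4) (Fin 4) ℂ) :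
    pairVec (eᵀ * F * e) = (e ⊗ₖ e)ᵀ *ᵥ pairVec F := by
  funext p
  simp only [pairVec, Matrix.mulVec, dotProduct, Fintype.sum_prod_type, Matrix.mul_apply,
    Matrix.transpose_apply, Matrix.kroneckerMap_apply, Finset.sum_mul]
  rw [Finset.sum_comm]
  exact Finset.sum_congr rfl fun a _ => Finset.sum_congr rfl fun c _ => by ring

/-- The action of double 2-forms in frame components. -/
lemma IsON.frame_dblAct (h : IsON g E u) (P : Fin 4 → Fin 4 → Fin 4 → Fin 4 → ℝ)
    (F : Matrix (Fin 4) (Fin 4) ℂ) :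
    (cx (E u))ᵀ * dblAct g u P F * cx (E u) =
      frameAct (fr4 (E u) P) ((cx (E u))ᵀ * F * cx (E u)) := by
  have h1 : pairVec ((cx (E u))ᵀ * dblAct g u P F * cx (E u)) =
      pairVec (frameAct (fr4 (E u) P) ((cx (E u))ᵀ * F * cx (E u))) := by
    rw [pairVec_fr2, pairVec_dblAct, pairVec_frameAct, pairVec_fr2, pairMat_fr4, h.gInv_eq,
      cx_mul, cx_mul, cx_transpose, Matrix.mul_kronecker_mul, Matrix.mul_kronecker_mul,
      Matrix.mulVec_smul]
    simp only [Matrix.mulVec_mulVec, Matrix.mul_assoc, Matrix.kroneckerMap_transpose]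
  ext i j
  exact congrFun h1 (i, j)

lemma leviCivita_eq (v : Fin 4 → Fin 4) : leviCivita (v 0) (v 1) (v 2) (v 3) =
    Matrix.detRowAlternating fun r => (Pi.single (v r) 1 : Fin 4 → ℝ) := by
  rw [leviCivita]
  change Matrix.det _ = Matrix.det _
  congr 1
  ext r s
  fin_cases r <;> simp [Pi.single_apply, eq_comm] <;> congr

lemma leviCivita_swap (v : Fin 4 → Fin 4) {i j : Fin 4} (hij : i ≠ j) :
    leviCivita (v 0) (v 1) (v 2) (v 3) =
      -leviCivita (v (Equiv.swap i j 0)) (v (Equiv.swap i j 1)) (v (Equiv.swap i j 2))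
        (v (Equiv.swap i j 3)) := by
  rw [leviCivita_eq, leviCivita_eq (fun r => v (Equiv.swap i j r))]
  have := AlternatingMap.map_swap (Matrix.detRowAlternating (n := Fin 4) (R := ℝ))
    (fun r => (Pi.single (v r) 1 : Fin 4 → ℝ)) hij
  exact (neg_eq_iff_eq_neg.mpr this).symm

lemma leviCivita_zero_one_two_three : leviCivita 0 1 2 3 = 1 := by
  rw [leviCivita, ← Matrix.det_one (n := Fin 4)]
  congr 1
  ext r s
  fin_cases r <;> simp [Matrix.one_apply] <;> congr

/-- This justifies the parametrisation `sdForm`: with `ε₀₁₂₃ = 1` and signature `-+++`, `F₂₃ = iF₀₁`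
and its cyclic images express `*F = iF`. -/
lemma frameAct_leviCivita_sdForm (c : Fin 3 → ℂ) :
    frameAct leviCivita (sdForm c) = Complex.I • sdForm c := by
  have s01 : ∀ a b c d, leviCivita a b c d = -leviCivita b a c d := fun a b c d =>
    leviCivita_swap ![a, b, c, d] (i := 0) (j := 1) (by decide)
  have s12 : ∀ a b c d, leviCivita a b c d = -leviCivita a c b d := fun a b c d =>
    leviCivita_swap ![a, b, c, d] (i := 1) (j := 2) (by decide)
  have s23 : ∀ a b c d, leviCivita a b c d = -leviCivita a b d c := fun a b c d =>
    leviCivita_swap ![a, b, c, d] (i := 2) (j := 3) (by decide)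
  have z12 : ∀ a b c, leviCivita a b b c = 0 := fun a b c => by linarith [s12 a b b c]
  have z13 : ∀ a b c, leviCivita a b c b = 0 := fun a b c => by
    linarith [s23 a b c b, z12 a b c]
  have z02 : ∀ a b c, leviCivita a b a c = 0 := fun a b c => by
    linarith [s01 a b a c, z12 b a c]
  have z03 : ∀ a b c, leviCivita a b c a = 0 := fun a b c => by
    linarith [s01 a b c a, z13 b a c]
  have v1 := leviCivita_zero_one_two_three
  have v2 : leviCivita 0 2 3 1 = 1 := by linarith [s12 0 1 2 3, s23 0 2 1 3]
  have v3 : leviCivita 0 3 1 2 = 1 := by linarith [s12 0 2 3 1, s23 0 3 2 1]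
  have v4 : leviCivita 2 3 0 1 = 1 := by linarith [s01 0 2 3 1, s12 2 0 3 1]
  have v5 : leviCivita 3 1 0 2 = 1 := by linarith [s01 0 3 1 2, s12 3 0 1 2]
  have v6 : leviCivita 1 2 0 3 = 1 := by linarith [s01 0 1 2 3, s12 1 0 2 3]
  refine ext_of_anti (fun i j => ?_) (fun i j => ?_) ?_ ?_ ?_ ?_ ?_ ?_
  · simp only [frameAct_apply s23, s01 i j]
    push_cast
    ring
  · rw [Matrix.smul_apply, Matrix.smul_apply, sdForm_anti c i j, smul_neg]
  all_goals
    rw [frameAct_apply s23]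
    simp [sdForm, z12, z13, z02, z03, v1, v2, v3, v4, v5, v6]
  all_goals
    linear_combination -(c _) * Complex.I_mul_I

/-- The Weyl condition of type D, in a positively oriented orthonormal frame. -/
lemma IsTypeDAt.frame (hD : IsTypeDAt g u) (h : IsON g E u) (hdet : 0 < (E u).det) :
    ∃ ρ : ℂ, ∀ c, let φ := frameAct (frameWeyl (frameRiem g E u)) (sdForm c)
        + (2 * ρ) • sdForm c
      frameAct (frameWeyl (frameRiem g E u)) φ - ρ • φ = 0 := by
  obtain ⟨ρ, -, hρ⟩ := hD
  refine ⟨ρ, fun c => ?_⟩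
  have hl : cx (E u) * cx (E u)⁻¹ = 1 := by rw [← cx_mul, h.mul_inv, cx_one]
  have hr : cx (E u)⁻¹ * cx (E u) = 1 := by rw [← cx_mul, h.inv_mul, cx_one]
  have hlt : (cx (E u))ᵀ * (cx (E u)⁻¹)ᵀ = 1 := by
    rw [← Matrix.transpose_mul, hr, Matrix.transpose_one]
  have hrt : (cx (E u)⁻¹)ᵀ * (cx (E u))ᵀ = 1 := by
    rw [← Matrix.transpose_mul, hl, Matrix.transpose_one]
  -- The coordinate 2-form whose frame components are `sdForm c`.
  set F := (cx (E u)⁻¹)ᵀ * sdForm c * cx (E u)⁻¹ with hF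
  have hφ : (cx (E u))ᵀ * F * cx (E u) = sdForm c := by
    rw [hF, Matrix.mul_assoc, Matrix.mul_assoc, Matrix.mul_assoc, hr, Matrix.mul_one,
      ← Matrix.mul_assoc, hlt, Matrix.one_mul]
  have inj : ∀ A B : Matrix (Fin 4) (Fin 4) ℂ,
      (cx (E u))ᵀ * A * cx (E u) = (cx (E u))ᵀ * B * cx (E u) → A = B := by
    intro A B hAB
    have h1 := congrArg (fun X => (cx (E u)⁻¹)ᵀ * X * cx (E u)⁻¹) hAB
    simp only [Matrix.mul_assoc, hl, Matrix.mul_one] at h1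
    simpa only [← Matrix.mul_assoc, hrt, Matrix.one_mul] using h1
  -- Positive orientation of the frame is essential here: a negative one would turn self-dual forms
  -- into anti-self-dual ones.
  have hsd : IsSelfDual g u F := by
    constructor
    · have h1 : (sdForm c)ᵀ = -sdForm c := by
        ext i j
        fin_cases i <;> fin_cases j <;> simp [sdForm]
      rw [hF, Matrix.transpose_mul, Matrix.transpose_mul, h1, Matrix.transpose_transpose]
      noncomm_ring
    · apply inj
      rw [hodge, h.frame_dblAct, fr4_volForm h hdet, hφ, frameAct_leviCivita_sdForm,
        Matrix.mul_smul, Matrix.smul_mul, hφ]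
  have h1 := congrArg (fun X => (cx (E u))ᵀ * X * cx (E u)) (hρ F hsd)
  simp only [weylAct, Matrix.mul_sub, Matrix.sub_mul, Matrix.mul_zero, Matrix.zero_mul,
    h.frame_dblAct, Matrix.mul_add, Matrix.add_mul, Matrix.mul_smul, Matrix.smul_mul, hφ,
    fr4_weyl h] at h1
  exact h1

end

section
variable {g T E : Coord → Mat} {u : Coord}

/-! ### Covariant derivatives in a frame -/

/-- The components of a tensor of type `(0,3)` with respect to the columns of `e`. -/
def fr3 (e : Mat) (X : Fin 4 → Fin 4 → Fin 4 → ℝ) (k i j : Fin 4) : ℝ :=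
  ∑ a, e a k * ∑ b, e b i * ∑ c, e c j * X a b c

lemma eq_zero_of_contract {e : Mat} (he : e.det ≠ 0) {y : Fin 4 → ℝ}
    (h : ∀ i, ∑ a, e a i * y a = 0) : y = 0 := by
  refine Matrix.eq_zero_of_vecMul_eq_zero he (funext fun i => ?_)
  rw [← Pi.zero_apply (M := fun _ => ℝ) i] at h
  simpa [Matrix.vecMul, dotProduct, mul_comm] using h i

lemma eq_zero_of_fr3 {e : Mat} (he : e.det ≠ 0) {X : Fin 4 → Fin 4 → Fin 4 → ℝ}
    (h : ∀ k i j, fr3 e X k i j = 0) (a b c : Fin 4) : X a b c = 0 := by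
  have h1 : ∀ i j a, ∑ b, e b i * ∑ c, e c j * X a b c = 0 := fun i j a =>
    congrFun (eq_zero_of_contract he (y := fun a => ∑ b, e b i * ∑ c, e c j * X a b c)
      fun k => h k i j) a
  have h2 : ∀ j a b, ∑ c, e c j * X a b c = 0 := fun j a b =>
    congrFun (eq_zero_of_contract he (y := fun b => ∑ c, e c j * X a b c) fun i => h1 i j a) b
  exact congrFun (eq_zero_of_contract he (y := fun c => X a b c) fun j => h2 j a b) c

lemma fr3_perm (e : Mat) (X : Fin 4 → Fin 4 → Fin 4 → ℝ) (k i j : Fin 4) :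
    fr3 e (fun a b c => X b a c) k i j = fr3 e X i k j := by
  simp only [fr3, Finset.mul_sum]
  rw [Finset.sum_comm]
  exact Finset.sum_congr rfl fun a _ => Finset.sum_congr rfl fun b _ =>
    Finset.sum_congr rfl fun c _ => by ring

lemma fr3_cycle (e : Mat) (X : Fin 4 → Fin 4 → Fin 4 → ℝ) (k i j : Fin 4) :
    fr3 e (fun a b c => X b c a) k i j = fr3 e X i j k := by
  simp only [fr3, Finset.mul_sum]
  rw [← Finset.sum_comm_cycle]
  exact Finset.sum_congr rfl fun a _ => Finset.sum_congr rfl fun b _ =>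
    Finset.sum_congr rfl fun c _ => by ring

lemma fr3_mul (e : Mat) (A : Fin 4 → Fin 4 → ℝ) (y : Fin 4 → ℝ) (k i j : Fin 4) :
    fr3 e (fun a b c => A a b * y c) k i j =
      (∑ a, ∑ b, e a k * e b i * A a b) * ∑ c, e c j * y c := by
  simp only [Finset.sum_mul]
  simp only [fr3, Finset.mul_sum]
  exact Finset.sum_congr rfl fun a _ => Finset.sum_congr rfl fun b _ =>
    Finset.sum_congr rfl fun c _ => by ring

/-- Replacing `Γ` by the frame connection absorbs the derivatives of `E` coming from the Leibniz
rule. -/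
lemma frame_mpd (hT : EntryDiff T u) (hE : MSm E u) (h : IsON g E u) (a : Fin 4) :
    (E u)ᵀ * (mpd a T u - (conn g a u)ᵀ * T u - T u * conn g a u) * E u =
      mpd a (fun v => (E v)ᵀ * T v * E v) u - (fconn g E a u)ᵀ * ((E u)ᵀ * T u * E u)
        - ((E u)ᵀ * T u * E u) * fconn g E a u := by
  have hTE : EntryDiff (fun v => (E v)ᵀ * T v) u := fun i j => by
    simp only [Matrix.mul_apply]
    exact DifferentiableAt.fun_sum fun k _ => (hE.diff k i).mul (hT k j)
  rw [mpd_mul hTE hE.diff, mpd_mul hE.transpose.diff hT, mpd_transpose, h.mpd_eq,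
    Matrix.transpose_sub, Matrix.transpose_mul, Matrix.transpose_mul]
  noncomm_ring

/-- The frame components of the covariant derivative. -/
def fcov (g T E : Coord → Mat) (u : Coord) (k i j : Fin 4) : ℝ :=
  fd E k (fun v => ((E v)ᵀ * T v * E v) i j) u
    - ∑ m, gam g E u k m i * ((E u)ᵀ * T u * E u) m j
    - ∑ m, gam g E u k m j * ((E u)ᵀ * T u * E u) i m

lemma fr3_covDeriv (hT : EntryDiff T u) (hE : MSm E u) (h : IsON g E u) (k i j : Fin 4) :
    fr3 (E u) (covDeriv g T u) k i j = fcov g T E u k i j := by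
  set Tf := (E u)ᵀ * T u * E u with hTf
  have h1 : ∀ a, ∑ b, E u b i * ∑ c, E u c j * covDeriv g T u a b c =
      pd a (fun v => ((E v)ᵀ * T v * E v) i j) u - ∑ m, fconn g E a u m i * Tf m j
        - ∑ m, Tf i m * fconn g E a u m j := by
    intro a
    have h2 := congrFun (congrFun (frame_mpd hT hE h a) i) j
    simp only [Matrix.sub_apply, ← hTf, Matrix.mul_apply (M := (fconn g E a u)ᵀ),
      Matrix.mul_apply (N := fconn g E a u), Matrix.transpose_apply] at h2
    refine Eq.trans ?_ h2
    rw [Matrix.mul_assoc, Matrix.mul_apply]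
    refine Finset.sum_congr rfl fun b _ => ?_
    rw [Matrix.transpose_apply, Matrix.mul_apply]
    congr 1
    exact Finset.sum_congr rfl fun c _ => by rw [covDeriv_eq, mul_comm]
  simp only [fr3, h1]
  simp only [fcov, fd, gam_apply, mul_sub, Finset.sum_sub_distrib, Finset.sum_mul,
    Finset.mul_sum, ← hTf]
  congr 1
  · congr 1
    rw [Finset.sum_comm]
    exact Finset.sum_congr rfl fun a _ => Finset.sum_congr rfl fun b _ => by ring
  · rw [Finset.sum_comm]
    exact Finset.sum_congr rfl fun a _ => Finset.sum_congr rfl fun b _ => by ring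

/-- The conformal Killing tensor equation in frame components. -/
lemma CKTEqAt.frame (hC : CKTEqAt g T u) (hT : EntryDiff T u) (hE : MSm E u) (h : IsON g E u) :
    ∃ t : Fin 4 → ℝ, ∀ k i j, fcov g T E u k i j + fcov g T E u i j k + fcov g T E u j k i =
      (diagonal eta : Mat) k i * t j + (diagonal eta : Mat) i j * t k
        + (diagonal eta : Mat) j k * t i := by
  obtain ⟨t, ht⟩ := hC
  refine ⟨fun j => ∑ c, E u c j * t c, fun k i j => ?_⟩
  have e1 := fr3_mul (E u) (g u) t
  simp only [h.sum_eq] at e1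
  rw [← e1 k i j, ← e1 i j k, ← e1 j k i, ← fr3_covDeriv hT hE h, ← fr3_covDeriv hT hE h,
    ← fr3_covDeriv hT hE h, ← fr3_cycle (E u) (covDeriv g T u) k i j,
    ← fr3_cycle (E u) (covDeriv g T u) i j k, ← fr3_cycle _ _ k i j,
    ← fr3_cycle _ _ k i j, ← fr3_cycle _ _ i j k, ← fr3_cycle _ _ k i j]
  simp only [fr3, ← Finset.sum_add_distrib, ← mul_add]
  refine Finset.sum_congr rfl fun a _ => ?_
  congr 1
  refine Finset.sum_congr rfl fun b _ => ?_
  congr 1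
  refine Finset.sum_congr rfl fun c _ => ?_
  rw [ht a b c]

/-- The conformal Killing-Yano equation in frame components. -/
lemma CKYEqAt_iff_frame (hT : EntryDiff T u) (hE : MSm E u) (h : IsON g E u) :
    CKYEqAt g T u ↔
    ∃ ξ : Fin 4 → ℝ, ∀ k i j, fcov g T E u k i j + fcov g T E u i k j =
      2 * (diagonal eta : Mat) k i * ξ j - (diagonal eta : Mat) k j * ξ i
        - (diagonal eta : Mat) i j * ξ k := by
  have key : ∀ ξ : Fin 4 → ℝ, ∀ k i j,
      fr3 (E u) (fun a b c => covDeriv g T u a b c + covDeriv g T u b a c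
        - (2 * g u a b * ξ c - g u a c * ξ b - g u b c * ξ a)) k i j =
      fcov g T E u k i j + fcov g T E u i k j -
      (2 * (diagonal eta : Mat) k i * (∑ c, E u c j * ξ c)
        - (diagonal eta : Mat) k j * (∑ c, E u c i * ξ c)
        - (diagonal eta : Mat) i j * (∑ c, E u c k * ξ c)) := by
    intro ξ k i j
    have e1 := fr3_mul (E u) (g u) ξ
    simp only [h.sum_eq] at e1
    have e2 : fr3 (E u) (fun a b c => g u b c * ξ a) k i j =
        (diagonal eta : Mat) i j * (∑ c, E u c k * ξ c) := by
      rw [← e1 i j k, ← fr3_cycle (E u) _ k i j]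
    have e3 : fr3 (E u) (fun a b c => g u a c * ξ b) k i j =
        (diagonal eta : Mat) k j * (∑ c, E u c i * ξ c) := by
      rw [← e1 k j i, ← fr3_cycle (E u) _ i k j, ← fr3_perm (E u) _ k i j]
    rw [mul_assoc, ← e1 k i j, ← e2, ← e3, ← fr3_covDeriv hT hE h, ← fr3_covDeriv hT hE h,
      ← fr3_perm (E u) _ k i j]
    simp only [fr3, Finset.mul_sum, ← Finset.sum_add_distrib, ← Finset.sum_sub_distrib]
    exact Finset.sum_congr rfl fun a _ => Finset.sum_congr rfl fun b _ =>
      Finset.sum_congr rfl fun c _ => by ring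
  constructor
  · rintro ⟨ξ, hξ⟩
    refine ⟨fun j => ∑ c, E u c j * ξ c, fun k i j => ?_⟩
    rw [← sub_eq_zero, ← key ξ k i j]
    simp only [fr3, hξ, sub_self, mul_zero, Finset.sum_const_zero]
  · rintro ⟨ξ, hξ⟩
    have h1 : ∀ j, ∑ c, E u c j * ∑ m, (E u)⁻¹ m c * ξ m = ξ j := by
      intro j
      have h2 : ∀ m, ∑ c, (E u)⁻¹ m c * E u c j = if m = j then 1 else 0 := fun m => by
        rw [← Matrix.mul_apply, h.inv_mul, Matrix.one_apply]
      simp only [Finset.mul_sum]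
      rw [Finset.sum_comm]
      have h3 : ∀ m, ∑ c, E u c j * ((E u)⁻¹ m c * ξ m) = (if m = j then 1 else 0) * ξ m :=
        fun m => by
          rw [← h2, Finset.sum_mul]
          exact Finset.sum_congr rfl fun c _ => by ring
      simp [h3]
    refine ⟨fun c => ∑ m, (E u)⁻¹ m c * ξ m, fun a b c => ?_⟩
    rw [← sub_eq_zero]
    refine eq_zero_of_fr3 h.det_ne (X := fun a b c =>
      covDeriv g T u a b c + covDeriv g T u b a c - (2 * g u a b * (∑ m, (E u)⁻¹ m c * ξ m)
        - g u a c * (∑ m, (E u)⁻¹ m b * ξ m) - g u b c * (∑ m, (E u)⁻¹ m a * ξ m)))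
      (fun k i j => ?_) a b c
    rw [key fun c => ∑ m, (E u)⁻¹ m c * ξ m, h1, h1, h1, hξ, sub_self]

end

/-! ### Umbilicity of the two planes from the conformal Killing tensor. -/

section
/-- Smooth orthonormal frames adapted to a conformal Killing tensor `K` of type 2+2 of a type D
metric, over an open set of coordinates. -/
structure AdaptedFrame (g K E : Coord → Mat) (α β : Coord → ℝ) (Ω : Set Coord) : Prop where
  isOpen : IsOpen Ω
  symm : ∀ v, (g v)ᵀ = g v
  smooth : ∀ v ∈ Ω, MSm g v
  smoothK : ∀ v ∈ Ω, MSm K v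
  smoothE : ∀ v ∈ Ω, MSm E v
  smooth_α : ∀ v ∈ Ω, Sm α v
  smooth_β : ∀ v ∈ Ω, Sm β v
  on : ∀ v ∈ Ω, IsON g E v
  det_pos : ∀ v ∈ Ω, 0 < (E v).det
  diag : ∀ v ∈ Ω, (E v)ᵀ * K v * E v = diagonal fun i => ![α v, α v, β v, β v] i * eta i
  ne : ∀ v ∈ Ω, α v ≠ β v
  typeD : ∀ v ∈ Ω, IsTypeDAt g v
  ckt : ∀ v ∈ Ω, CKTEqAt g K v

variable {g K E F : Coord → Mat} {α β : Coord → ℝ} {Ω : Set Coord} {u : Coord}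

/-- The logarithm of the length of the 2-form to be constructed. -/
def logLen (α β : Coord → ℝ) (v : Coord) : ℝ := Real.log (α v - β v) * 2⁻¹

/-- The twist components of an umbilic frame. -/
def twist (g E : Coord → Mat) (v : Coord) : Fin 4 → ℝ :=
  ![gam g E v 3 0 2, gam g E v 2 1 3, gam g E v 0 2 1, gam g E v 0 3 1]

/-- The frame components of the differential of the phase. -/
def phaseForm (b : Fin 4 → ℝ) : Fin 4 → ℝ := ![b 1, b 0, -b 3, b 2]

/-- For two indices in one plane and one in the other, the conformal Killing equation relates `p -
q` times a symmetrised second fundamental form to `dp`, `dq` and `t`. Eliminating `t` and dividing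
by `p - q` gives umbilicity; the antisymmetric part is unconstrained and named `b`. -/
lemma umbilic_of_equations {γ : Fin 4 → Mat} {p q : ℝ} (hpq : p - q ≠ 0) {dp dq x b t : Fin 4 → ℝ}
    (anti : ∀ k i j, eta i * γ k i j = -(eta j * γ k j i))
    (hx : ∀ k, 2 * (p - q) * x k = dp k - dq k)
    (hb : b = ![γ 3 0 2, γ 2 1 3, γ 0 2 1, γ 0 3 1]) {f : Fin 4 → Fin 4 → Fin 4 → ℝ}
    (hf : ∀ k i j, f k i j = (if i = j then eta i * ![dp k, dp k, dq k, dq k] i else 0)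
        - γ k j i * (![p, p, q, q] j * eta j) - γ k i j * (![p, p, q, q] i * eta i))
    (ht : ∀ k i j, f k i j + f i j k + f j k i =
      (diagonal eta : Mat) k i * t j + (diagonal eta : Mat) i j * t k
        + (diagonal eta : Mat) j k * t i) : Umbilic γ x b := by
  have a00 : ∀ k i, γ k i i = 0 := fun k i => by
    have h1 := self_eq_neg.mp (anti k i i)
    rcases mul_eq_zero.mp h1 with h0 | h0
    · have := eta_mul_self i
      simp [h0] at this
    · exact h0
  have a01 : ∀ k, γ k 0 1 = γ k 1 0 := fun k => by simpa [eta] using anti k 0 1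
  have a02 : ∀ k, γ k 0 2 = γ k 2 0 := fun k => by simpa [eta] using anti k 0 2
  have a03 : ∀ k, γ k 0 3 = γ k 3 0 := fun k => by simpa [eta] using anti k 0 3
  have a12 : ∀ k, γ k 1 2 = -γ k 2 1 := fun k => by simpa [eta] using anti k 1 2
  have a13 : ∀ k, γ k 1 3 = -γ k 3 1 := fun k => by simpa [eta] using anti k 1 3
  have a23 : ∀ k, γ k 2 3 = -γ k 3 2 := fun k => by simpa [eta] using anti k 2 3
  -- The equal-index components determine `t`: it is `dp` along the first plane and `dq` along the
  -- second.
  have t0 := ht 0 0 0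
  have t1 := ht 1 1 1
  have t2 := ht 2 2 2
  have t3 := ht 3 3 3
  have u200 := ht 2 0 0
  have u211 := ht 2 1 1
  have u201 := ht 2 0 1
  have u300 := ht 3 0 0
  have u311 := ht 3 1 1
  have u301 := ht 3 0 1
  have u022 := ht 0 2 2
  have u033 := ht 0 3 3
  have u023 := ht 0 2 3
  have u122 := ht 1 2 2
  have u133 := ht 1 3 3
  have u123 := ht 1 2 3
  have x0 := hx 0
  have x1 := hx 1
  have x2 := hx 2
  have x3 := hx 3
  have b0 : b 0 = γ 3 0 2 := by simp [hb]
  have b1 : b 1 = γ 2 1 3 := by simp [hb]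
  have b2 : b 2 = γ 0 2 1 := by simp [hb]
  have b3 : b 3 = γ 0 3 1 := by simp [hb]
  have hcan : ∀ y z : ℝ, (p - q) * y = (p - q) * z → y = z := fun y z h =>
    mul_left_cancel₀ hpq h
  clear hx ht
  simp [hf, eta, a00, a01, a02, a03, a12, a13, a23]
    at t0 t1 t2 t3 u200 u211 u201 u300 u311 u301 u022 u033 u023 u122 u133 u123
  refine ⟨anti, ?_, ?_, ?_, ?_, ?_, ?_, ?_, ?_, ?_, ?_, ?_, ?_, ?_, ?_, ?_, ?_⟩ <;>
    try simp only [b0, b1, b2, b3, a02, a03, a12, a13]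
  all_goals
    apply hcan
    linarith

namespace AdaptedFrame

/-- `Real.log` is `log |·|`, so only `α ≠ β` matters and not the sign of `α - β`. -/
lemma logLen_smooth (h : AdaptedFrame g K E α β Ω) (hu : u ∈ Ω) : Sm (logLen α β) u :=
  (((h.smooth_α u hu).sub (h.smooth_β u hu)).log (sub_ne_zero.mpr (h.ne u hu))).mul contDiffAt_const

lemma fd_logLen (h : AdaptedFrame g K E α β Ω) (hu : u ∈ Ω) (k : Fin 4) :
    2 * (α u - β u) * fd E k (logLen α β) u = fd E k α u - fd E k β u := by
  have hα := (h.smooth_α u hu).diff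
  have hβ := (h.smooth_β u hu).diff
  have hne := sub_ne_zero.mpr (h.ne u hu)
  have h1 : ∀ a, pd a (logLen α β) u = (pd a α u - pd a β u) / (2 * (α u - β u)) := by
    intro a
    have h2 := ((hα.hasFDerivAt.sub hβ.hasFDerivAt).log hne).mul_const (2⁻¹ : ℝ)
    have h3 : fderiv ℝ (logLen α β) u = _ := h2.fderiv
    simp only [pd, h3]
    simp
    field_simp
  simp only [fd, h1, Finset.mul_sum, ← Finset.sum_sub_distrib]
  refine Finset.sum_congr rfl fun a _ => ?_
  field_simp

lemma umbilic (h : AdaptedFrame g K E α β Ω) (hu : u ∈ Ω) :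
    Umbilic (gam g E u) (fun k => fd E k (logLen α β) u) (twist g E u) := by
  have hev := h.isOpen.eventually_mem hu
  have hK := (h.smoothK u hu).diff
  have hE := h.smoothE u hu
  have anti := gam_anti h.symm (h.smooth u hu) hE (hev.mono h.on)
  obtain ⟨t, ht⟩ := (h.ckt u hu).frame hK hE (h.on u hu)
  have hf : ∀ k i j, fcov g K E u k i j =
      (if i = j then eta i * fd E k (fun v => ![α v, α v, β v, β v] i) u else 0)
        - gam g E u k j i * (![α u, α u, β u, β u] j * eta j)
        - gam g E u k i j * (![α u, α u, β u, β u] i * eta i) := by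
    intro k i j
    have hd : (fun v => ((E v)ᵀ * K v * E v) i j) =ᶠ[𝓝 u]
        fun v => if i = j then ![α v, α v, β v, β v] i * eta i else 0 := by
      filter_upwards [hev] with v hv
      rw [h.diag v hv, Matrix.diagonal_apply]
    rw [fcov, h.diag u hu]
    congr 1
    · congr 1
      · simp only [fd, pd_congr hd]
        split_ifs with hij
        · rw [Finset.mul_sum]
          refine Finset.sum_congr rfl fun a _ => ?_
          have hdi : DifferentiableAt ℝ (fun v => ![α v, α v, β v, β v] i) u := by
            have hα := (h.smooth_α u hu).diff
            have hβ := (h.smooth_β u hu).diff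
            fin_cases i
            exacts [hα, hα, hβ, hβ]
          rw [pd_mul hdi (differentiableAt_const _), pd_const]
          ring
        · simp [pd_const]
      · simp [Matrix.diagonal_apply]
    · simp [Matrix.diagonal_apply]
  refine umbilic_of_equations (sub_ne_zero.mpr (h.ne u hu)) anti (h.fd_logLen hu) rfl
    (f := fcov g K E u) (fun k i j => ?_) ht
  rw [hf]
  congr 3
  fin_cases i <;> rfl

end AdaptedFrame

end

/-! ### Closedness of the phase form and its potential. -/

section
variable {g K E F : Coord → Mat} {α β : Coord → ℝ} {Ω : Set Coord} {u : Coord}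

lemma fd_congr {f h : Coord → ℝ} (hfh : f =ᶠ[𝓝 u] h) (k : Fin 4) : fd E k f u = fd E k h u := by
  simp only [fd, pd_congr hfh]

lemma fd_neg {f : Coord → ℝ} (k : Fin 4) : fd E k (fun v => -f v) u = -fd E k f u := by
  simp only [fd, pd_neg, mul_neg, Finset.sum_neg_distrib]

/-- The umbilicity relations are linear with constant coefficients, hence survive differentiation.
This supplies the derivative hypothesis of the curvature lemmas. -/
lemma Umbilic.frameDeriv {γ : Coord → Fin 4 → Mat} {x b : Coord → Fin 4 → ℝ}
    (h : ∀ᶠ v in 𝓝 u, Umbilic (γ v) (x v) (b v))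
    (hγ : ∀ k i j, DifferentiableAt ℝ (fun v => γ v k i j) u) (l : Fin 4) :
    Umbilic (fun k => Matrix.of fun i j => fd E l (fun v => γ v k i j) u)
      (fun k => fd E l (fun v => x v k) u) (fun k => fd E l (fun v => b v k) u) := by
  constructor
  · intro k i j
    have hc : ∀ (c : ℝ) i j, c * fd E l (fun v => γ v k i j) u =
        fd E l (fun v => c * γ v k i j) u := fun c i j => by
      simp only [fd, pd_const_mul (hγ k i j), Finset.mul_sum]
      exact Finset.sum_congr rfl fun a _ => by ring
    simp only [Matrix.of_apply, hc]
    rw [← fd_neg (E := E)]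
    exact fd_congr (h.mono fun v hv => hv.anti k i j) l
  · exact fd_congr (h.mono fun v hv => hv.h020) l
  · exact (fd_congr (h.mono fun v hv => hv.h121) l).trans (fd_neg l)
  · exact fd_congr (h.mono fun v hv => hv.h021) l
  · exact (fd_congr (h.mono fun v hv => hv.h120) l).trans (fd_neg l)
  · exact fd_congr (h.mono fun v hv => hv.h030) l
  · exact (fd_congr (h.mono fun v hv => hv.h131) l).trans (fd_neg l)
  · exact fd_congr (h.mono fun v hv => hv.h031) l
  · exact (fd_congr (h.mono fun v hv => hv.h130) l).trans (fd_neg l)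
  · exact fd_congr (h.mono fun v hv => hv.h202) l
  · exact fd_congr (h.mono fun v hv => hv.h303) l
  · exact (fd_congr (h.mono fun v hv => hv.h203) l).trans (fd_neg l)
  · exact fd_congr (h.mono fun v hv => hv.h302) l
  · exact (fd_congr (h.mono fun v hv => hv.h212) l).trans (fd_neg l)
  · exact (fd_congr (h.mono fun v hv => hv.h313) l).trans (fd_neg l)
  · exact fd_congr (h.mono fun v hv => hv.h213) l
  · exact (fd_congr (h.mono fun v hv => hv.h312) l).trans (fd_neg l)

/-- The coordinate components of the differential of the phase. -/
def phaseCoord (g E : Coord → Mat) (a : Fin 4) (v : Coord) : ℝ :=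
  ∑ l, (E v)⁻¹ l a * phaseForm (twist g E v) l

namespace AdaptedFrame

lemma twist_smooth (h : AdaptedFrame g K E α β Ω) (hu : u ∈ Ω) (i : Fin 4) :
    Sm (fun v => twist g E v i) u := by
  have := fun k i j => Sm.gam (h.smooth u hu) (h.smoothE u hu) (h.on u hu) k i j
  fin_cases i
  exacts [this _ _ _, this _ _ _, this _ _ _, this _ _ _]

lemma phaseForm_smooth (h : AdaptedFrame g K E α β Ω) (hu : u ∈ Ω) (i : Fin 4) :
    Sm (fun v => phaseForm (twist g E v) i) u := by
  fin_cases i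
  exacts [h.twist_smooth hu 1, h.twist_smooth hu 0, (h.twist_smooth hu 3).neg,
    h.twist_smooth hu 2]

lemma phaseCoord_smooth (h : AdaptedFrame g K E α β Ω) (hu : u ∈ Ω) (a : Fin 4) :
    Sm (phaseCoord g E a) u :=
  ContDiffAt.sum fun l _ =>
    ((h.smoothE u hu).inv (h.on u hu).det_ne l a).mul (h.phaseForm_smooth hu l)

lemma sum_phaseCoord (h : AdaptedFrame g K E α β Ω) (hu : u ∈ Ω) (k : Fin 4) :
    ∑ a, E u a k * phaseCoord g E a u = phaseForm (twist g E u) k := by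
  have h2 : ∀ m, ∑ a, (E u)⁻¹ m a * E u a k = if m = k then 1 else 0 := fun m => by
    rw [← Matrix.mul_apply, (h.on u hu).inv_mul, Matrix.one_apply]
  have h3 : ∀ m, ∑ a, E u a k * ((E u)⁻¹ m a * phaseForm (twist g E u) m) =
      (if m = k then 1 else 0) * phaseForm (twist g E u) m := fun m => by
    rw [← h2, Finset.sum_mul]
    exact Finset.sum_congr rfl fun c _ => by ring
  simp only [phaseCoord, Finset.mul_sum]
  rw [Finset.sum_comm]
  simp [h3]

/-- The geometric core: umbilicity gives `Ψ₀ = Ψ₄ = 0`, type D upgrades this to `Ψ₁ = Ψ₃ = 0`, and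
together with exactness of `x` this closes the phase form. -/
lemma phaseForm_closed (h : AdaptedFrame g K E α β Ω) (hu : u ∈ Ω) (k l : Fin 4) :
    fd E k (fun v => phaseForm (twist g E v) l) u - fd E l (fun v => phaseForm (twist g E v) k) u
      = ∑ m, (gam g E u k m l - gam g E u l m k) * phaseForm (twist g E u) m := by
  have hev := h.isOpen.eventually_mem hu
  have hg := h.smooth u hu
  have hE := h.smoothE u hu
  have hon := hev.mono h.on
  have hU := h.umbilic hu
  have hUd := Umbilic.frameDeriv (E := E) (hev.mono fun v hv => h.umbilic hv)
    (fun k i j => (Sm.gam hg hE (h.on u hu) k i j).diff)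
  have hR := frameRiem_eq h.symm hg hE hon
  have hcl := frameRiem_curvatureLike h.symm (hev.mono h.smooth) (hev.mono h.smoothE) hon
  have h04 := hU.psi_zero_four hUd
  simp only [← hR] at h04
  obtain ⟨ρ, hρ⟩ := (h.typeD u hu).frame (h.on u hu) (h.det_pos u hu)
  obtain ⟨h1, h2, h3, h4⟩ := hcl.psi_one_three hρ h04.1 h04.2.1 h04.2.2.1 h04.2.2.2
  have hx : ∀ k l, fd E k (fun v => fd E l (logLen α β) v) u
      - fd E l (fun v => fd E k (logLen α β) v) u =
      ∑ m, (gam g E u k m l - gam g E u l m k) * fd E m (logLen α β) u :=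
    fd_comm h.symm hE (h.on u hu) (h.logLen_smooth hu)
  have key := hU.closed hUd hx hR hcl.pair h1 h2 h3 h4 k l
  have e : ∀ k l, fd E k (fun v => phaseForm (twist g E v) l) u =
      phaseForm (fun i => fd E k (fun v => twist g E v i) u) l := by
    intro k l
    fin_cases l
    exacts [rfl, rfl, fd_neg k, rfl]
  rw [e, e]
  exact key

/-- In the frame formula for the exterior derivative the bracket terms are already matched by
`phaseForm_closed`; what remains is the coordinate curl contracted with the invertible `E`. -/
lemma phaseCoord_closed (h : AdaptedFrame g K E α β Ω) (hu : u ∈ Ω) (a c : Fin 4) :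
    pd c (phaseCoord g E a) u = pd a (phaseCoord g E c) u := by
  have hev := h.isOpen.eventually_mem hu
  have h1 := fd_sub_fd_of_form h.symm (h.smoothE u hu) (h.on u hu)
    (f := fun a => phaseCoord g E a) (fun a => (h.phaseCoord_smooth hu a).diff)
  have e : ∀ k l, fd E k (fun v => ∑ a, E v a l * phaseCoord g E a v) u =
      fd E k (fun v => phaseForm (twist g E v) l) u := fun k l =>
    fd_congr (hev.mono fun v hv => h.sum_phaseCoord hv l) k
  simp only [e, h.phaseForm_closed hu, h.sum_phaseCoord hu, left_eq_add] at h1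
  have hdet := (h.on u hu).det_ne
  have h2 : ∀ k a, ∑ c, E u c k * (pd c (phaseCoord g E a) u - pd a (phaseCoord g E c) u) = 0 := by
    intro k a
    refine congrFun (eq_zero_of_contract hdet (y := fun a => ∑ c, E u c k *
      (pd c (phaseCoord g E a) u - pd a (phaseCoord g E c) u)) fun l => ?_) a
    rw [← h1 k l]
    simp only [Finset.mul_sum]
    exact Finset.sum_congr rfl fun a _ => Finset.sum_congr rfl fun c _ => by ring
  exact sub_eq_zero.mp (congrFun (eq_zero_of_contract hdet (y := fun c =>
    pd c (phaseCoord g E a) u - pd a (phaseCoord g E c) u) fun k => h2 k a) c)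

/-- The phase: a potential of the closed form `phaseCoord` on convex sets. -/
lemma exists_phase (h : AdaptedFrame g K E α β Ω) (hc : Convex ℝ Ω) :
    ∃ θ : Coord → ℝ, (∀ v ∈ Ω, Sm θ v) ∧
      ∀ v ∈ Ω, ∀ k, fd E k θ v = phaseForm (twist g E v) k := by
  obtain ⟨L, hL⟩ : ∃ L : Fin 4 → Coord →L[ℝ] ℝ, ∀ a y, L a y = y a :=
    ⟨fun a => EuclideanSpace.proj a, fun _ _ => rfl⟩
  set η : Coord → Coord →L[ℝ] ℝ := fun v => ∑ a, phaseCoord g E a v • L a with hη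
  have hsm : ∀ v ∈ Ω, ContDiffAt ℝ ∞ η v := fun v hv =>
    ContDiffAt.sum fun a _ => (h.phaseCoord_smooth hv a).smul contDiffAt_const
  have hfd : ∀ v ∈ Ω, ∀ x y, fderiv ℝ η v x y =
      ∑ a, fderiv ℝ (phaseCoord g E a) v x * y a := by
    intro v hv x y
    have h1 : HasFDerivAt η (∑ a, (fderiv ℝ (phaseCoord g E a) v).smulRight (L a)) v :=
      HasFDerivAt.fun_sum fun a _ => by
        have h2 := (h.phaseCoord_smooth hv a).diff.hasFDerivAt.smul_const (L a)
        exact h2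
    rw [h1.fderiv]
    simp [hL]
  -- The Poincaré lemma on a convex open set; closedness is symmetry of the derivative of `η`.
  obtain ⟨θ, hθ⟩ := hc.exists_forall_hasFDerivAt_of_fderiv_symmetric h.isOpen
    (fun v hv => ((hsm v hv).differentiableAt (by simp)).differentiableWithinAt :
      DifferentiableOn ℝ η Ω) (by
      intro v hv x y
      have e : ∀ a (x : Coord), fderiv ℝ (phaseCoord g E a) v x =
          ∑ c, x c * pd c (phaseCoord g E a) v := fun a x => by
        rw [fderiv_apply_eq_sum]
        rfl
      simp only [hfd v hv, e, Finset.sum_mul]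
      rw [Finset.sum_comm]
      refine Finset.sum_congr rfl fun a _ => Finset.sum_congr rfl fun c _ => ?_
      rw [h.phaseCoord_closed hv c a]
      ring)
  have hpd : ∀ v ∈ Ω, ∀ a, pd a θ v = phaseCoord g E a v := by
    intro v hv a
    simp only [pd, (hθ v hv).fderiv, hη]
    simp [hL]
  refine ⟨θ, fun v hv => ?_, fun v hv k => ?_⟩
  -- The potential comes only as a differentiable function; it is smooth because its derivative `η`
  -- is.
  · have h1 : ContDiffOn ℝ ∞ θ Ω := by
      rw [contDiffOn_infty_iff_fderiv_of_isOpen h.isOpen]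
      refine ⟨fun w hw => (hθ w hw).differentiableAt.differentiableWithinAt, ?_⟩
      have h2 : ContDiffOn ℝ ∞ η Ω := fun w hw => (hsm w hw).contDiffWithinAt
      exact h2.congr fun w hw => (hθ w hw).fderiv
    exact h1.contDiffAt (h.isOpen.mem_nhds hv)
  · simp only [fd, hpd v hv, h.sum_phaseCoord hv]

end AdaptedFrame

end

section
variable {g K E F : Coord → Mat} {α β : Coord → ℝ} {Ω : Set Coord} {u : Coord}

/-! ### Conformal Killing-Yano tensors in an adapted frame -/

/-- The 2-forms spanned by the volume forms of the two planes of the frame. -/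
def planeForm (p q : ℝ) : Mat := !![0, p, 0, 0; -p, 0, 0, 0; 0, 0, 0, q; 0, 0, -q, 0]

/-- Boosts and rotations preserve both area forms, so `μ` and `ν` drop out. Eliminating `ξ` leaves
one complex equation, `d(p + iq) = (x + iφ)(p + iq)`. -/
lemma cky_frame_iff {γ : Fin 4 → Mat} {x b : Fin 4 → ℝ} (h : Umbilic γ x b) (p q : ℝ)
    (dp dq : Fin 4 → ℝ) {f : Fin 4 → Fin 4 → Fin 4 → ℝ}
    (hf : ∀ k i j, f k i j = planeForm (dp k) (dq k) i j
      - ∑ m, γ k m i * planeForm p q m j - ∑ m, γ k m j * planeForm p q i m) :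
    (∃ ξ : Fin 4 → ℝ, ∀ k i j, f k i j + f i k j = 2 * (diagonal eta : Mat) k i * ξ j
      - (diagonal eta : Mat) k j * ξ i - (diagonal eta : Mat) i j * ξ k) ↔
    ∀ k, dp k = x k * p - phaseForm b k * q ∧ dq k = x k * q + phaseForm b k * p := by
  obtain ⟨μ, ν, rfl⟩ := h.eq
  constructor
  · rintro ⟨ξ, hξ⟩
    have e1 := hξ 0 0 1
    have e2 := hξ 0 0 2
    have e3 := hξ 0 0 3
    have e4 := hξ 1 1 0
    have e5 := hξ 2 2 0
    have e6 := hξ 2 2 1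
    have e7 := hξ 2 2 3
    have e8 := hξ 3 3 2
    have e9 := hξ 0 2 3
    have e10 := hξ 1 2 3
    have e11 := hξ 2 0 1
    have e12 := hξ 3 0 1
    simp [hf, planeForm, Fin.sum_univ_four, eta] at e1 e2 e3 e4 e5 e6 e7 e8 e9 e10 e11 e12
    intro k
    fin_cases k <;> simp [phaseForm] <;> constructor <;> linarith
  · intro h1
    have h0 := fun k => (h1 k).1
    have h2 := fun k => (h1 k).2
    -- Forced by the components `(k, k, j)` with both indices in one plane, for instance `dp 0 = -ξ
    -- 1` from `(0, 0, 1)`.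
    refine ⟨![-dp 1, -dp 0, -dq 3, dq 2], fun k i j => ?_⟩
    simp only [hf, h0, h2, Fin.sum_univ_four]
    fin_cases k <;> fin_cases i <;> fin_cases j <;>
      simp [planeForm, phaseForm, eta] <;> ring

lemma fd_add {f h : Coord → ℝ} (hf : DifferentiableAt ℝ f u) (hh : DifferentiableAt ℝ h u)
    (k : Fin 4) : fd E k (fun v => f v + h v) u = fd E k f u + fd E k h u := by
  simp only [fd, pd_add hf hh, mul_add, Finset.sum_add_distrib]

lemma fd_sub {f h : Coord → ℝ} (hf : DifferentiableAt ℝ f u) (hh : DifferentiableAt ℝ h u)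
    (k : Fin 4) : fd E k (fun v => f v - h v) u = fd E k f u - fd E k h u := by
  simp only [fd, pd_sub hf hh, mul_sub, Finset.sum_sub_distrib]

lemma fd_mul {f h : Coord → ℝ} (hf : DifferentiableAt ℝ f u) (hh : DifferentiableAt ℝ h u)
    (k : Fin 4) : fd E k (fun v => f v * h v) u = fd E k f u * h u + f u * fd E k h u := by
  simp only [fd, pd_mul hf hh, Finset.sum_mul, Finset.mul_sum, ← Finset.sum_add_distrib]
  exact Finset.sum_congr rfl fun a _ => by ring

lemma fd_const_mul {f : Coord → ℝ} (hf : DifferentiableAt ℝ f u) (c : ℝ)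
    (k : Fin 4) : fd E k (fun v => c * f v) u = c * fd E k f u := by
  simp only [fd, pd_const_mul hf, Finset.mul_sum]
  exact Finset.sum_congr rfl fun a _ => by ring

lemma fd_comp {f : Coord → ℝ} {φ : ℝ → ℝ} {φ' : ℝ} (hφ : HasDerivAt φ φ' (f u))
    (hf : DifferentiableAt ℝ f u) (k : Fin 4) :
    fd E k (fun v => φ (f v)) u = φ' * fd E k f u := by
  have h1 : ∀ a, pd a (fun v => φ (f v)) u = φ' * pd a f u := fun a => by
    have := hφ.comp_hasFDerivAt u hf.hasFDerivAt
    have h2 : fderiv ℝ (fun v => φ (f v)) u = φ' • fderiv ℝ f u := this.fderiv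
    simp [pd, h2]
  simp only [fd, h1, Finset.mul_sum]
  exact Finset.sum_congr rfl fun a _ => by ring

lemma fderiv_eq_zero_of_fd {f : Coord → ℝ} (hE : (E u).det ≠ 0) (h : ∀ k, fd E k f u = 0) :
    fderiv ℝ f u = 0 := by
  have h1 := eq_zero_of_contract hE (y := fun a => pd a f u) h
  ext w
  rw [fderiv_apply_eq_sum]
  have h2 : ∀ a, fderiv ℝ f u (EuclideanSpace.single a 1) = 0 := fun a => congrFun h1 a
  simp [h2]

lemma eventually_const_of_fderiv {f : Coord → ℝ}
    (h : ∀ᶠ v in 𝓝 u, DifferentiableAt ℝ f v ∧ fderiv ℝ f v = 0) : ∀ᶠ v in 𝓝 u, f v = f u := by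
  obtain ⟨r, hr, hb⟩ := Metric.eventually_nhds_iff_ball.mp h
  filter_upwards [Metric.ball_mem_nhds u hr] with v hv
  exact Metric.isOpen_ball.is_const_of_fderiv_eq_zero (convex_ball u r).isPreconnected
    (fun w hw => (hb w hw).1.differentiableWithinAt) (fun w hw => (hb w hw).2) hv
    (Metric.mem_ball_self hr)

/-- The frame components of a conformal Killing-Yano tensor in the span of the plane forms. -/
structure IsSolAt (g E : Coord → Mat) (α β p q : Coord → ℝ) (u : Coord) : Prop where
  smooth₁ : Sm p u
  smooth₂ : Sm q u
  eqn₁ : ∀ k, fd E k p u = fd E k (logLen α β) u * p u - phaseForm (twist g E u) k * q u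
  eqn₂ : ∀ k, fd E k q u = fd E k (logLen α β) u * q u + phaseForm (twist g E u) k * p u

namespace AdaptedFrame

lemma cky_iff (h : AdaptedFrame g K E α β Ω) (hu : u ∈ Ω) {p q : Coord → ℝ}
    (hF : EntryDiff F u) (hpq : ∀ᶠ v in 𝓝 u, (E v)ᵀ * F v * E v = planeForm (p v) (q v)) :
    CKYEqAt g F u ↔
      (∀ k, fd E k p u = fd E k (logLen α β) u * p u - phaseForm (twist g E u) k * q u ∧
        fd E k q u = fd E k (logLen α β) u * q u + phaseForm (twist g E u) k * p u) := by
  rw [CKYEqAt_iff_frame hF (h.smoothE u hu) (h.on u hu)]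
  refine cky_frame_iff (h.umbilic hu) (p u) (q u) (fun k => fd E k p u) (fun k => fd E k q u)
    fun k i j => ?_
  have e : fd E k (fun v => ((E v)ᵀ * F v * E v) i j) u =
      fd E k (fun v => planeForm (p v) (q v) i j) u :=
    fd_congr (hpq.mono fun v hv => by rw [hv]) k
  have z : fd E k (fun _ => (0 : ℝ)) u = 0 := by simp [fd, pd_const]
  rw [fcov, e, hpq.self_of_nhds]
  congr 2
  fin_cases i <;> fin_cases j <;>
    first | exact z | rfl | exact fd_neg k

/-- Take `p + iq = exp(logLen + iθ)`, whose logarithmic derivative is `x + iφ` and whose modulus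
never vanishes. -/
lemma exists_sol (h : AdaptedFrame g K E α β Ω) (hc : Convex ℝ Ω) :
    ∃ p q : Coord → ℝ, ∀ v ∈ Ω, IsSolAt g E α β p q v ∧ p v ^ 2 + q v ^ 2 ≠ 0 := by
  obtain ⟨θ, hθ, hd⟩ := h.exists_phase hc
  refine ⟨fun v => Real.exp (logLen α β v) * Real.cos (θ v),
    fun v => Real.exp (logLen α β v) * Real.sin (θ v), fun v hv => ⟨?_, ?_⟩⟩
  · have hφ := h.logLen_smooth hv
    have hs := hθ v hv
    have hexp : Sm (fun v => Real.exp (logLen α β v)) v := hφ.exp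
    have hcos : Sm (fun v => Real.cos (θ v)) v := hs.cos
    have hsin : Sm (fun v => Real.sin (θ v)) v := hs.sin
    have e1 : ∀ k, fd E k (fun v => Real.exp (logLen α β v)) v = _ :=
      fd_comp (Real.hasDerivAt_exp _) hφ.diff
    have e2 : ∀ k, fd E k (fun v => Real.cos (θ v)) v = _ :=
      fd_comp (Real.hasDerivAt_cos _) hs.diff
    have e3 : ∀ k, fd E k (fun v => Real.sin (θ v)) v = _ :=
      fd_comp (Real.hasDerivAt_sin _) hs.diff
    refine ⟨hexp.mul hcos, hexp.mul hsin, fun k => ?_, fun k => ?_⟩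
    · rw [fd_mul hexp.diff hcos.diff, e1, e2, hd v hv]
      ring
    · rw [fd_mul hexp.diff hsin.diff, e1, e3, hd v hv]
      ring
  · have : (Real.exp (logLen α β v) * Real.cos (θ v)) ^ 2
        + (Real.exp (logLen α β v) * Real.sin (θ v)) ^ 2 = Real.exp (logLen α β v) ^ 2 := by
      rw [mul_pow, mul_pow, ← mul_add, Real.cos_sq_add_sin_sq, mul_one]
    rw [this]
    positivity

end AdaptedFrame

/-- This is multiplication of `p + iq` by the constant `a + ib`; multiplication by `i` is, up to
sign, Hodge duality. -/
lemma IsSolAt.comb {p q : Coord → ℝ} (h : IsSolAt g E α β p q u) (a b : ℝ) :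
    IsSolAt g E α β (fun v => a * p v - b * q v) (fun v => a * q v + b * p v) u := by
  have hp := h.smooth₁.diff
  have hq := h.smooth₂.diff
  refine ⟨(contDiffAt_const.mul h.smooth₁).sub (contDiffAt_const.mul h.smooth₂),
    (contDiffAt_const.mul h.smooth₂).add (contDiffAt_const.mul h.smooth₁),
    fun k => ?_, fun k => ?_⟩
  · rw [fd_sub (hp.const_mul a) (hq.const_mul b), fd_const_mul hp, fd_const_mul hq, h.eqn₁, h.eqn₂]
    ring
  · rw [fd_add (hq.const_mul a) (hp.const_mul b), fd_const_mul hp, fd_const_mul hq, h.eqn₁, h.eqn₂]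
    ring

/-- Two solutions differ by a constant complex factor. -/
lemma IsSolAt.eventually_comb {p q P Q : Coord → ℝ} (hE : ∀ᶠ v in 𝓝 u, (E v).det ≠ 0)
    (h : ∀ᶠ v in 𝓝 u, IsSolAt g E α β p q v ∧ p v ^ 2 + q v ^ 2 ≠ 0)
    (h' : ∀ᶠ v in 𝓝 u, DifferentiableAt ℝ P v ∧ DifferentiableAt ℝ Q v ∧
      ∀ k, fd E k P v = fd E k (logLen α β) v * P v - phaseForm (twist g E v) k * Q v ∧
        fd E k Q v = fd E k (logLen α β) v * Q v + phaseForm (twist g E v) k * P v) :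
    ∃ a b : ℝ, ∀ᶠ v in 𝓝 u, P v = a * p v - b * q v ∧ Q v = a * q v + b * p v := by
  -- Here `c + is = (P + iQ)/(p + iq)`. Numerator and denominator solve the same linear equation, so
  -- the quotient has zero derivative and is locally constant.
  set N : Coord → ℝ := fun v => (p v * p v + q v * q v)⁻¹
  set c : Coord → ℝ := fun v => (P v * p v + Q v * q v) * N v
  set s : Coord → ℝ := fun v => (Q v * p v - P v * q v) * N v
  have key : ∀ᶠ v in 𝓝 u, (DifferentiableAt ℝ c v ∧ fderiv ℝ c v = 0) ∧
      (DifferentiableAt ℝ s v ∧ fderiv ℝ s v = 0) := by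
    filter_upwards [hE, h, h'] with v hEv hv hv'
    have hp := hv.1.smooth₁.diff
    have hq := hv.1.smooth₂.diff
    obtain ⟨hP, hQ, hPQ⟩ := hv'
    have hpp : DifferentiableAt ℝ (fun v => p v * p v + q v * q v) v :=
      (hp.fun_mul hp).add (hq.fun_mul hq)
    have hne : p v * p v + q v * q v ≠ 0 := by
      have := hv.2
      rwa [pow_two, pow_two] at this
    have hN : DifferentiableAt ℝ N v := hpp.inv hne
    have eN : ∀ k, fd E k N v = -(2 * fd E k (logLen α β) v) * N v := by
      intro k
      have h1 : fd E k N v = _ := fd_comp (hasDerivAt_inv hne) hpp k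
      rw [h1, fd_add (hp.fun_mul hp) (hq.fun_mul hq), fd_mul hp hp, fd_mul hq hq, hv.1.eqn₁,
        hv.1.eqn₂, ← inv_pow]
      linear_combination (-2 * fd E k (logLen α β) v * N v) * mul_inv_cancel₀ hne
    have hc₀ : DifferentiableAt ℝ (fun v => P v * p v + Q v * q v) v :=
      (hP.fun_mul hp).add (hQ.fun_mul hq)
    have hs₀ : DifferentiableAt ℝ (fun v => Q v * p v - P v * q v) v :=
      (hQ.fun_mul hp).sub (hP.fun_mul hq)
    refine ⟨⟨hc₀.mul hN, fderiv_eq_zero_of_fd hEv fun k => ?_⟩,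
      ⟨hs₀.mul hN, fderiv_eq_zero_of_fd hEv fun k => ?_⟩⟩
    · rw [fd_mul hc₀ hN, fd_add (hP.fun_mul hp) (hQ.fun_mul hq), fd_mul hP hp, fd_mul hQ hq,
        hv.1.eqn₁, hv.1.eqn₂, (hPQ k).1, (hPQ k).2, eN]
      ring
    · rw [fd_mul hs₀ hN, fd_sub (hQ.fun_mul hp) (hP.fun_mul hq), fd_mul hP hq, fd_mul hQ hp,
        hv.1.eqn₁, hv.1.eqn₂, (hPQ k).1, (hPQ k).2, eN]
      ring
  refine ⟨c u, s u, ?_⟩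
  filter_upwards [eventually_const_of_fderiv (key.mono fun v hv => hv.1),
    eventually_const_of_fderiv (key.mono fun v hv => hv.2), h] with v h1 h2 hv
  have hne : p v * p v + q v * q v ≠ 0 := by
    have := hv.2
    rwa [pow_two, pow_two] at this
  rw [← h1, ← h2]
  simp only [c, s, N]
  exact ⟨by linear_combination (-P v) * mul_inv_cancel₀ hne,
    by linear_combination (-Q v) * mul_inv_cancel₀ hne⟩

end

section
variable {g K : Coord → Mat} {Ω : Set Coord} {u : Coord}

/-! ### Existence of smooth adapted frames -/

/-- Smooth Gram–Schmidt for a 2×2 symmetric matrix with entries `G₁, G₂, G₃` that equals `diag(ε,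
δ)` at `u`; by continuity the square roots involve positive quantities near `u`. -/
lemma exists_cholesky {G₁ G₂ G₃ : Coord → ℝ} {ε δ : ℝ} (hε : ε * ε = 1) (hδ : δ * δ = 1)
    (h : ∀ᶠ v in 𝓝 u, Sm G₁ v ∧ Sm G₂ v ∧ Sm G₃ v) (h₁ : G₁ u = ε) (h₂ : G₂ u = 0)
    (h₃ : G₃ u = δ) : ∃ a b c : Coord → ℝ, a u = 1 ∧ b u = 0 ∧ c u = 1 ∧ ∀ᶠ v in 𝓝 u,
      (Sm a v ∧ Sm b v ∧ Sm c v) ∧ a v ^ 2 * G₁ v = ε ∧ b v * G₁ v + c v * G₂ v = 0 ∧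
        b v ^ 2 * G₁ v + 2 * b v * c v * G₂ v + c v ^ 2 * G₃ v = δ := by
  have hε0 : ε ≠ 0 := fun h0 => by simp [h0] at hε
  -- The Schur complement, normalised by its sign `δ`: the length of the second vector after
  -- projecting off the first.
  set H : Coord → ℝ := fun v => δ * (G₃ v - G₂ v ^ 2 / G₁ v)
  have hHu : H u = 1 := by simp [H, h₂, h₃, hδ]
  have hGu : ε * G₁ u = 1 := by rw [h₁, hε]
  have hu := h.self_of_nhds
  have hG₁ : ∀ᶠ v in 𝓝 u, 0 < ε * G₁ v :=
    (continuousAt_const.mul hu.1.continuousAt).eventually (lt_mem_nhds (by simp [hGu]))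
  have hHs : ∀ v, G₁ v ≠ 0 → Sm G₁ v ∧ Sm G₂ v ∧ Sm G₃ v → Sm H v := fun v h0 hv =>
    contDiffAt_const.mul (hv.2.2.sub ((hv.2.1.pow 2).div hv.1 h0))
  have hH : ∀ᶠ v in 𝓝 u, 0 < H v :=
    (hHs u (by rwa [h₁]) hu).continuousAt.eventually (lt_mem_nhds (by simp [hHu]))
  refine ⟨fun v => (√(ε * G₁ v))⁻¹, fun v => -(√(H v))⁻¹ * (G₂ v / G₁ v), fun v => (√(H v))⁻¹,
    by simp [hGu], by simp [h₂], by simp [hHu], ?_⟩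
  filter_upwards [h, hG₁, hH] with v hv hv₁ hv₂
  have h0 : G₁ v ≠ 0 := fun h0 => by simp [h0] at hv₁
  have s1 : Sm (fun v => (√(H v))⁻¹) v :=
    ((hHs v h0 hv).sqrt hv₂.ne').inv (Real.sqrt_ne_zero'.mpr hv₂)
  have e1 : ((√(H v))⁻¹) ^ 2 * H v = 1 := by
    rw [inv_pow, Real.sq_sqrt hv₂.le, inv_mul_cancel₀ hv₂.ne']
  have e2 : ((√(ε * G₁ v))⁻¹) ^ 2 * (ε * G₁ v) = 1 := by
    rw [inv_pow, Real.sq_sqrt hv₁.le, inv_mul_cancel₀ hv₁.ne']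
  have e3 : G₂ v / G₁ v * G₁ v = G₂ v := div_mul_cancel₀ _ h0
  refine ⟨⟨((contDiffAt_const.mul hv.1).sqrt hv₁.ne').inv (Real.sqrt_ne_zero'.mpr hv₁),
    s1.neg.mul (hv.2.1.div hv.1 h0), s1⟩, ?_, ?_, ?_⟩
  · linear_combination ε * e2 - ((√(ε * G₁ v))⁻¹) ^ 2 * G₁ v * hε
  · linear_combination (-(√(H v))⁻¹) * e3
  · have e4 : G₂ v ^ 2 / G₁ v = G₂ v / G₁ v * G₂ v := by ring
    simp only [H, e4] at e1 ⊢
    set c := (√(δ * (G₃ v - G₂ v / G₁ v * G₂ v)))⁻¹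
    linear_combination c ^ 2 * (G₂ v / G₁ v) * e3 + δ * e1
      - c ^ 2 * (G₃ v - G₂ v / G₁ v * G₂ v) * hδ

/-- The reflection exchanging the sign of the second plane. -/
def planeSign : Fin 4 → ℝ := ![1, 1, -1, -1]

lemma planeSign_mul_self : (diagonal planeSign : Mat) * diagonal planeSign = 1 := by
  rw [diagonal_mul_diagonal, ← diagonal_one]
  congr 1
  funext i
  fin_cases i <;> simp [planeSign]

/-- Adapted bases at a point. -/
structure IsAdapted (G k e : Mat) (a b : ℝ) : Prop where
  on : eᵀ * G * e = diagonal eta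
  diag : eᵀ * k * e = diagonal fun i => ![a, a, b, b] i * eta i
  ne : a ≠ b

/-- The trace-free part of the endomorphism of a symmetric tensor. -/
def traceFree (G k : Mat) : Mat := G⁻¹ * k - ((G⁻¹ * k).trace / 4) • 1

lemma IsAdapted.traceFree_eq {G k e : Mat} {a b : ℝ} (h : IsAdapted G k e a b) :
    (G⁻¹ * k).trace / 4 = (a + b) / 2 ∧
      traceFree G k * e = ((a - b) / 2) • (e * diagonal planeSign) := by
  have hon : IsON (fun _ => G) (fun _ => e) 0 := h.on
  have h1 : e⁻¹ = diagonal eta * eᵀ * G := hon.inv_eq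
  have h2 : G⁻¹ = e * diagonal eta * eᵀ := hon.gInv_eq
  have h3 : G⁻¹ * k * e = e * diagonal ![a, a, b, b] := by
    rw [h2, Matrix.mul_assoc, Matrix.mul_assoc, ← Matrix.mul_assoc eᵀ, h.diag, Matrix.mul_assoc,
      diagonal_mul_diagonal]
    congr 2
    funext i
    rw [mul_left_comm, eta_mul_self, mul_one]
  have ht : (G⁻¹ * k).trace = 2 * a + 2 * b := by
    have h4 : G⁻¹ * k = e * diagonal ![a, a, b, b] * e⁻¹ := by
      rw [← h3, Matrix.mul_assoc _ e, show e * e⁻¹ = 1 from hon.mul_inv, Matrix.mul_one]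
    rw [h4, Matrix.trace_mul_comm, ← Matrix.mul_assoc, show e⁻¹ * e = 1 from hon.inv_mul,
      Matrix.one_mul, Matrix.trace_diagonal, Fin.sum_univ_four]
    simp
    ring
  refine ⟨by rw [ht]; ring, ?_⟩
  rw [traceFree, ht, Matrix.sub_mul, h3, Matrix.smul_mul, Matrix.one_mul]
  have h5 : (diagonal ![a, a, b, b] : Mat) = ((2 * a + 2 * b) / 4) • 1
      + ((a - b) / 2) • diagonal planeSign := by
    rw [← diagonal_one, ← diagonal_smul, ← diagonal_smul, diagonal_add]
    congr 1
    funext i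
    fin_cases i <;> simp [planeSign] <;> ring
  rw [h5, Matrix.mul_add, Matrix.mul_smul, Matrix.mul_smul, Matrix.mul_one, add_sub_cancel_left]

lemma IsAdapted.sq {G k e : Mat} {a b : ℝ} (h : IsAdapted G k e a b) :
    traceFree G k * traceFree G k = ((a - b) / 2) ^ 2 • 1 := by
  have hon : IsON (fun _ => G) (fun _ => e) 0 := h.on
  have h2 : traceFree G k * traceFree G k * e = (((a - b) / 2) ^ 2 • (1 : Mat)) * e := by
    rw [Matrix.mul_assoc, h.traceFree_eq.2, Matrix.mul_smul, ← Matrix.mul_assoc,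
      h.traceFree_eq.2, Matrix.smul_mul, Matrix.mul_assoc, planeSign_mul_self, smul_smul,
      Matrix.mul_one, Matrix.smul_mul, Matrix.one_mul, pow_two]
  have h3 := congrArg (fun A : Mat => A * e⁻¹) h2
  simpa only [Matrix.mul_assoc, show e * e⁻¹ = 1 from hon.mul_inv, Matrix.mul_one] using h3

/-- The trace-free part is `(a - b)/2` times an involution, so `(a - b)²` is polynomial in `G⁻¹ k`.
This yields smooth eigenvalues from merely pointwise adapted bases. -/
lemma IsAdapted.trace_sq {G k e : Mat} {a b : ℝ} (h : IsAdapted G k e a b) :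
    (traceFree G k * traceFree G k).trace / 4 = ((a - b) / 2) ^ 2 := by
  rw [h.sq, Matrix.trace_smul, Matrix.trace_one]
  simp

/-- If necessary, reverse the last frame vector, which stays in the second plane. -/
lemma IsAdapted.flip {G k e : Mat} {a b : ℝ} (h : IsAdapted G k e a b) :
    ∃ e', IsAdapted G k e' a b ∧ 0 < e'.det := by
  have hon : IsON (fun _ => G) (fun _ => e) 0 := h.on
  have h0 : e.det ≠ 0 := hon.det_ne
  rcases h0.lt_or_gt with h1 | h1
  · set D : Mat := diagonal ![1, 1, 1, -1]
    refine ⟨e * D, ⟨?_, ?_, h.ne⟩, ?_⟩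
    · rw [Matrix.transpose_mul, Matrix.mul_assoc, ← Matrix.mul_assoc _ e, Matrix.mul_assoc Dᵀ,
        ← Matrix.mul_assoc eᵀ, ← Matrix.mul_assoc eᵀ, h.on]
      simp only [D, diagonal_transpose, diagonal_mul_diagonal]
      congr 1
      funext i
      fin_cases i <;> simp
    · rw [Matrix.transpose_mul, Matrix.mul_assoc, ← Matrix.mul_assoc _ e, Matrix.mul_assoc Dᵀ,
        ← Matrix.mul_assoc eᵀ, ← Matrix.mul_assoc eᵀ, h.diag]
      simp only [D, diagonal_transpose, diagonal_mul_diagonal]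
      congr 1
      funext i
      fin_cases i <;> simp
    · rw [Matrix.det_mul, Matrix.det_diagonal, Fin.prod_univ_four]
      simpa using h1
  · exact ⟨e, h, h1⟩

/-- Upper triangular block matrices. -/
def triBlock (a b c a' b' c' : ℝ) : Mat := !![a, b, 0, 0; 0, c, 0, 0; 0, 0, a', b'; 0, 0, 0, c']

/-- Commuting with `planeSign` makes the Gram matrix block diagonal, so each plane can be
orthonormalised separately. -/
lemma triBlock_gram {M : Mat} {a b c a' b' c' : ℝ} (hs : Mᵀ = M)
    (hM : M * diagonal planeSign = diagonal planeSign * M)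
    (h₁ : a ^ 2 * M 0 0 = -1) (h₂ : b * M 0 0 + c * M 0 1 = 0)
    (h₃ : b ^ 2 * M 0 0 + 2 * b * c * M 0 1 + c ^ 2 * M 1 1 = 1)
    (h₁' : a' ^ 2 * M 2 2 = 1) (h₂' : b' * M 2 2 + c' * M 2 3 = 0)
    (h₃' : b' ^ 2 * M 2 2 + 2 * b' * c' * M 2 3 + c' ^ 2 * M 3 3 = 1) :
    (triBlock a b c a' b' c')ᵀ * M * triBlock a b c a' b' c' = diagonal eta := by
  have hz : ∀ i j, M i j * planeSign j = planeSign i * M i j := fun i j => by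
    have := congrFun (congrFun hM i) j
    rwa [mul_diagonal, diagonal_mul] at this
  have ht : ∀ i j, M i j = M j i := fun i j => congrFun (congrFun hs.symm i) j
  have z02 : M 0 2 = 0 := by have := hz 0 2; simp [planeSign] at this; linarith
  have z03 : M 0 3 = 0 := by have := hz 0 3; simp [planeSign] at this; linarith
  have z12 : M 1 2 = 0 := by have := hz 1 2; simp [planeSign] at this; linarith
  have z13 : M 1 3 = 0 := by have := hz 1 3; simp [planeSign] at this; linarith
  have t10 := ht 1 0
  have t32 := ht 3 2
  have z20 := (ht 2 0).trans z02
  have z30 := (ht 3 0).trans z03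
  have z21 := (ht 2 1).trans z12
  have z31 := (ht 3 1).trans z13
  ext i j
  fin_cases i <;> fin_cases j <;>
    simp [triBlock, Matrix.mul_apply, Fin.sum_univ_four, eta, z02, z03, z12, z13, z20, z30, z21,
      z31, t10, t32]
  · linarith
  · linear_combination a * h₂
  · exact Or.inl h₂
  · linarith
  · linarith
  · linear_combination a' * h₂'
  · exact Or.inl h₂'
  · linarith

lemma triBlock_comm (a b c a' b' c' : ℝ) : diagonal planeSign * triBlock a b c a' b' c' =
    triBlock a b c a' b' c' * diagonal planeSign := by
  ext i j
  rw [mul_diagonal, diagonal_mul]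
  fin_cases i <;> fin_cases j <;> simp [triBlock, planeSign]

lemma triBlock_one : triBlock 1 0 1 1 0 1 = 1 := by
  ext i j
  fin_cases i <;> fin_cases j <;> simp [triBlock]

/-- An adapted basis at `u` is frozen in coordinates, projected to the smoothly varying eigenplanes
and orthonormalised in each plane. The smoothness thus comes from spectral projections, not from the
arbitrary pointwise bases. -/
lemma exists_adapted (hΩ : IsOpen Ω) (hgs : ∀ v, (g v)ᵀ = g v) (hKs : ∀ v, (K v)ᵀ = K v)
    (hg : ∀ v ∈ Ω, MSm g v) (hK : ∀ v ∈ Ω, MSm K v)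
    (h : ∀ v ∈ Ω, ∃ e a b, IsAdapted (g v) (K v) e a b) (hu : u ∈ Ω) :
    ∃ (E : Coord → Mat) (α β : Coord → ℝ), ∀ᶠ v in 𝓝 u, (MSm E v ∧ Sm α v ∧ Sm β v) ∧
      0 < (E v).det ∧ IsAdapted (g v) (K v) (E v) (α v) (β v) := by
  obtain ⟨e₁, a₀, b₀, he₁⟩ := h u hu
  obtain ⟨e₀, he₀, hdet₀⟩ := he₁.flip
  have hdet : ∀ v ∈ Ω, (g v).det ≠ 0 := fun v hv => by
    obtain ⟨e, a, b, he⟩ := h v hv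
    exact IsON.metric_det_ne (g := g) (E := fun _ => e) he.on
  set A : Coord → Mat := fun v => (g v)⁻¹ * K v
  set τ : Coord → ℝ := fun v => (A v).trace / 4
  set L : Coord → Mat := fun v => traceFree (g v) (K v)
  set m : Coord → ℝ := fun v => (L v * L v).trace / 4
  -- The sign of `α - β` at `u`, kept constant nearby.
  set σ : ℝ := (a₀ - b₀) / 2 / √(m u)
  have hAs : ∀ v ∈ Ω, MSm A v := fun v hv => ((hg v hv).inv (hdet v hv)).mul (hK v hv)
  have htr : ∀ {B : Coord → Mat} {v : Coord}, MSm B v → Sm (fun v => (B v).trace / 4) v :=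
    fun hB => (ContDiffAt.sum fun i _ => hB i i).div_const 4
  have hτ : ∀ v ∈ Ω, Sm τ v := fun v hv => htr (hAs v hv)
  have hL : ∀ v ∈ Ω, MSm L v := fun v hv =>
    (hAs v hv).sub (MSm.smul (hτ v hv) (MSm.const 1 v))
  have hm : ∀ v ∈ Ω, Sm m v := fun v hv => htr ((hL v hv).mul (hL v hv))
  have hm0 : ∀ v ∈ Ω, 0 < m v := fun v hv => by
    obtain ⟨e, a, b, he⟩ := h v hv
    have h0 : a - b ≠ 0 := sub_ne_zero.mpr he.ne
    have h1 : m v = _ := he.trace_sq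
    rw [h1]
    positivity
  have hLL : ∀ v ∈ Ω, L v * L v = m v • 1 := fun v hv => by
    obtain ⟨e, a, b, he⟩ := h v hv
    have h1 : m v = _ := he.trace_sq
    rw [h1]
    exact he.sq
  have hs0 : ∀ v ∈ Ω, √(m v) ≠ 0 := fun v hv => Real.sqrt_ne_zero'.mpr (hm0 v hv)
  have hss : ∀ v ∈ Ω, √(m v) * √(m v) = m v := fun v hv => Real.mul_self_sqrt (hm0 v hv).le
  have hσ : σ * σ = 1 := by
    have h1 : m u = _ := he₀.trace_sq
    have h2 : σ * σ = ((a₀ - b₀) / 2) ^ 2 / (√(m u) * √(m u)) := by simp only [σ]; ring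
    rw [h2, hss u hu, ← h1, div_self (hm0 u hu).ne']
  -- The smooth involution which at `u` is `+1` on the time-like plane and `-1` on the space-like
  -- one.
  set P : Coord → Mat := fun v => (σ * (√(m v))⁻¹) • L v
  have hPs : ∀ v ∈ Ω, MSm P v := fun v hv =>
    MSm.smul (contDiffAt_const.mul (((hm v hv).sqrt (hm0 v hv).ne').inv (hs0 v hv))) (hL v hv)
  have hPP : ∀ v ∈ Ω, P v * P v = 1 := fun v hv => by
    simp only [P, Matrix.smul_mul, Matrix.mul_smul, hLL v hv, smul_smul]
    have : σ * (√(m v))⁻¹ * (σ * (√(m v))⁻¹) * m v = 1 := by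
      have e1 := mul_inv_cancel₀ (hs0 v hv)
      linear_combination (-(σ * (√(m v))⁻¹) ^ 2) * hss v hv + hσ
        + σ ^ 2 * (√(m v) * (√(m v))⁻¹ + 1) * e1
    rw [← mul_assoc, this, one_smul]
  have hLP : ∀ v ∈ Ω, L v = (σ * √(m v)) • P v := fun v hv => by
    simp only [P, smul_smul]
    have : σ * √(m v) * (σ * (√(m v))⁻¹) = 1 := by
      have := hs0 v hv
      field_simp
      rw [pow_two, hσ]
    rw [this, one_smul]
  have hgA : ∀ v ∈ Ω, g v * A v = K v := fun v hv =>
    Matrix.mul_nonsing_inv_cancel_left _ _ (isUnit_iff_ne_zero.mpr (hdet v hv))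
  have hAL : ∀ v, A v = L v + τ v • 1 := fun v => (sub_add_cancel _ _).symm
  have hgP : ∀ v ∈ Ω, (P v)ᵀ * g v = g v * P v := fun v hv => by
    have h1 : (L v)ᵀ * g v = g v * L v := by
      have h2 : g v * L v = K v - τ v • g v := by
        rw [show L v = A v - τ v • 1 from rfl, Matrix.mul_sub, hgA v hv, Matrix.mul_smul,
          Matrix.mul_one]
      have h3 := congrArg Matrix.transpose h2
      rw [Matrix.transpose_mul, hgs, Matrix.transpose_sub, hKs, Matrix.transpose_smul, hgs] at h3
      rw [h3, h2]
    simp only [P, Matrix.transpose_smul, Matrix.smul_mul, Matrix.mul_smul, h1]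
  set J : Mat := diagonal planeSign
  have hJJ : J * J = 1 := planeSign_mul_self
  have hJt : Jᵀ = J := diagonal_transpose _
  -- The first two columns of `e₀` are projected by `(1 + P)/2`, the last two by `(1 - P)/2`.
  set Y : Coord → Mat := fun v => (1 / 2 : ℝ) • (e₀ + P v * e₀ * J)
  have hYs : ∀ v ∈ Ω, MSm Y v := fun v hv => MSm.smul contDiffAt_const
    ((MSm.const e₀ v).add (((hPs v hv).mul (MSm.const e₀ v)).mul (MSm.const J v)))
  have hPY : ∀ v ∈ Ω, P v * Y v = Y v * J := fun v hv => by
    simp only [Y, Matrix.mul_smul, Matrix.smul_mul, Matrix.mul_add, Matrix.add_mul]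
    rw [Matrix.mul_assoc (P v) e₀ J, ← Matrix.mul_assoc (P v) (P v), hPP v hv, Matrix.one_mul,
      Matrix.mul_assoc (P v), Matrix.mul_assoc e₀ J J, hJJ, Matrix.mul_one, add_comm]
  have hYu : Y u = e₀ := by
    have h1 : P u * e₀ = e₀ * J := by
      have h2 : L u * e₀ = _ := he₀.traceFree_eq.2
      simp only [P, Matrix.smul_mul, h2, smul_smul]
      have h3 : σ * (√(m u))⁻¹ * ((a₀ - b₀) / 2) = 1 := by
        rw [← hσ]
        simp only [σ]
        ring
      rw [h3, one_smul]
    simp only [Y, h1]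
    rw [Matrix.mul_assoc, hJJ, Matrix.mul_one, ← two_smul ℝ e₀, smul_smul]
    norm_num
  set G : Coord → Mat := fun v => (Y v)ᵀ * g v * Y v
  have hGs : ∀ v ∈ Ω, MSm G v := fun v hv =>
    ((hYs v hv).transpose.mul (hg v hv)).mul (hYs v hv)
  have hGt : ∀ v, (G v)ᵀ = G v := fun v => by
    simp only [G, Matrix.transpose_mul, Matrix.transpose_transpose, hgs, Matrix.mul_assoc]
  have hGJ : ∀ v ∈ Ω, G v * J = J * G v := fun v hv => by
    have h1 := congrArg Matrix.transpose (hPY v hv)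
    rw [Matrix.transpose_mul, Matrix.transpose_mul, hJt] at h1
    simp only [G]
    rw [Matrix.mul_assoc, ← hPY v hv, ← Matrix.mul_assoc, Matrix.mul_assoc _ (g v),
      ← hgP v hv, ← Matrix.mul_assoc (Y v)ᵀ, h1]
    simp only [Matrix.mul_assoc]
  have hGu : G u = diagonal eta := by simp only [G, hYu, he₀.on]
  have hev := hΩ.eventually_mem hu
  -- The columns of `Y` are orthonormal at `u`, so Gram–Schmidt applies nearby in the first plane,
  -- with signs `-1, 1`, and likewise in the second, with signs `1, 1`.
  obtain ⟨a, b, c, hau, hbu, hcu, habc⟩ := exists_cholesky (G₁ := fun v => G v 0 0)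
    (G₂ := fun v => G v 0 1) (G₃ := fun v => G v 1 1) (ε := -1) (δ := 1) (by norm_num)
    (by norm_num) (hev.mono fun v hv => ⟨hGs v hv _ _, hGs v hv _ _, hGs v hv _ _⟩)
    (by simp [hGu, eta]) (by simp [hGu]) (by simp [hGu, eta])
  obtain ⟨a', b', c', hau', hbu', hcu', habc'⟩ := exists_cholesky (G₁ := fun v => G v 2 2)
    (G₂ := fun v => G v 2 3) (G₃ := fun v => G v 3 3) (ε := 1) (δ := 1) (by norm_num)
    (by norm_num) (hev.mono fun v hv => ⟨hGs v hv _ _, hGs v hv _ _, hGs v hv _ _⟩)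
    (by simp [hGu, eta]) (by simp [hGu]) (by simp [hGu, eta])
  set R : Coord → Mat := fun v => triBlock (a v) (b v) (c v) (a' v) (b' v) (c' v)
  have hRs : ∀ᶠ v in 𝓝 u, MSm R v := by
    filter_upwards [habc, habc'] with v hv hv'
    intro i j
    fin_cases i <;> fin_cases j
    exacts [hv.1.1, hv.1.2.1, contDiffAt_const, contDiffAt_const, contDiffAt_const, hv.1.2.2,
      contDiffAt_const, contDiffAt_const, contDiffAt_const, contDiffAt_const, hv'.1.1, hv'.1.2.1,
      contDiffAt_const, contDiffAt_const, contDiffAt_const, hv'.1.2.2]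
  have hEs : ∀ᶠ v in 𝓝 u, MSm (fun v => Y v * R v) v :=
    (hev.and hRs).mono fun v hv => (hYs v hv.1).mul hv.2
  have hEu : Y u * R u = e₀ := by
    simp only [R, hau, hbu, hcu, hau', hbu', hcu', triBlock_one, hYu, Matrix.mul_one]
  have hdetE : ∀ᶠ v in 𝓝 u, 0 < (Y v * R v).det :=
    hEs.self_of_nhds.det.continuousAt.eventually (lt_mem_nhds (by simpa [hEu] using hdet₀))
  refine ⟨fun v => Y v * R v, fun v => τ v + σ * √(m v), fun v => τ v - σ * √(m v), ?_⟩
  filter_upwards [hev, hEs, hdetE, habc, habc'] with v hv hEv hdv h1 h2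
  have hsm : Sm (fun v => σ * √(m v)) v := contDiffAt_const.mul ((hm v hv).sqrt (hm0 v hv).ne')
  have hon : (Y v * R v)ᵀ * g v * (Y v * R v) = diagonal eta := by
    rw [← triBlock_gram (hGt v) (hGJ v hv) h1.2.1 h1.2.2.1 h1.2.2.2 h2.2.1 h2.2.2.1 h2.2.2.2,
      Matrix.transpose_mul]
    simp only [G, R, Matrix.mul_assoc]
  have hAE : A v * (Y v * R v) = Y v * R v *
      diagonal ![τ v + σ * √(m v), τ v + σ * √(m v), τ v - σ * √(m v), τ v - σ * √(m v)] := by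
    have h3 : (diagonal ![τ v + σ * √(m v), τ v + σ * √(m v), τ v - σ * √(m v),
        τ v - σ * √(m v)] : Mat) = (σ * √(m v)) • J + τ v • 1 := by
      rw [← diagonal_one, ← diagonal_smul, ← diagonal_smul, diagonal_add]
      congr 1
      funext i
      fin_cases i <;> simp [planeSign] <;> ring
    have h4 : L v * (Y v * R v) = (σ * √(m v)) • (Y v * R v * J) := by
      rw [hLP v hv, Matrix.smul_mul, ← Matrix.mul_assoc, hPY v hv, Matrix.mul_assoc _ J,
        triBlock_comm, Matrix.mul_assoc]
    generalize Y v * R v = e at h4 ⊢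
    rw [h3, hAL, Matrix.add_mul, Matrix.mul_add, h4, Matrix.smul_mul, Matrix.mul_smul,
      Matrix.mul_smul, Matrix.one_mul, Matrix.mul_one]
  refine ⟨⟨hEv, (hτ v hv).add hsm, (hτ v hv).sub hsm⟩, hdv, hon, ?_, ?_⟩
  · rw [← hgA v hv, Matrix.mul_assoc, Matrix.mul_assoc, hAE, ← Matrix.mul_assoc (g v),
      ← Matrix.mul_assoc, ← Matrix.mul_assoc (Y v * R v)ᵀ, hon, diagonal_mul_diagonal]
    congr 1
    funext i
    rw [mul_comm]
  · have h4 : σ * √(m v) ≠ 0 := mul_ne_zero (fun h0 => by simp [h0] at hσ) (hs0 v hv)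
    intro h5
    apply h4
    linarith

/-- Adapted frames exist near every point. -/
lemma exists_adaptedFrame (hΩ : IsOpen Ω) (hgs : ∀ v, (g v)ᵀ = g v) (hKs : ∀ v, (K v)ᵀ = K v)
    (hg : ∀ v ∈ Ω, MSm g v) (hK : ∀ v ∈ Ω, MSm K v)
    (h : ∀ v ∈ Ω, ∃ e a b, IsAdapted (g v) (K v) e a b) (hD : ∀ v ∈ Ω, IsTypeDAt g v)
    (hC : ∀ v ∈ Ω, CKTEqAt g K v) (hu : u ∈ Ω) :
    ∃ r > 0, Metric.ball u r ⊆ Ω ∧ ∃ (E : Coord → Mat) (α β : Coord → ℝ),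
      AdaptedFrame g K E α β (Metric.ball u r) := by
  obtain ⟨E, α, β, hE⟩ := exists_adapted hΩ hgs hKs hg hK h hu
  obtain ⟨r, hr, hb⟩ := Metric.eventually_nhds_iff_ball.mp (hE.and (hΩ.eventually_mem hu))
  exact ⟨r, hr, fun v hv => (hb v hv).2, E, α, β,
    { isOpen := Metric.isOpen_ball
      symm := hgs
      smooth := fun v hv => hg v (hb v hv).2
      smoothK := fun v hv => hK v (hb v hv).2
      smoothE := fun v hv => (hb v hv).1.1.1
      smooth_α := fun v hv => (hb v hv).1.1.2.1
      smooth_β := fun v hv => (hb v hv).1.1.2.2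
      on := fun v hv => (hb v hv).1.2.2.on
      det_pos := fun v hv => (hb v hv).1.2.1
      diag := fun v hv => (hb v hv).1.2.2.diag
      ne := fun v hv => (hb v hv).1.2.2.ne
      typeD := fun v hv => hD v (hb v hv).2
      ckt := fun v hv => hC v (hb v hv).2 }⟩

end

section
/-! ### Gluing local sections that agree up to locally constant changes -/

section Gluing

variable {X F : Type*} {V : X → Type*}

open scoped Classical in
/-- The change of the parameter `y` between two families of local sections. -/
def paramChange (Φ : X → ∀ z, F → V z) (p q x : X) (y : F) : F :=
  if h : ∃ y', Φ p x y = Φ q x y' then h.choose else y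

/-- The default branch of `paramChange` is never reached on overlaps, where a matching parameter
always exists. -/
lemma paramChange_spec {Φ : X → ∀ z, F → V z} {p q x : X} {y y' : F}
    (h : Φ p x y = Φ q x y') : Φ q x (paramChange Φ p q x y) = Φ p x y := by
  have hex : ∃ y', Φ p x y = Φ q x y' := ⟨y', h⟩
  rw [paramChange, dif_pos hex]
  exact hex.choose_spec.symm

variable [TopologicalSpace X] [TopologicalSpace F] [DiscreteTopology F]

/-- The bundle with discrete fibres of locally constant combinations of the local sections. -/
def paramBundle (N : X → Set X) (hN : ∀ p, IsOpen (N p)) (hp : ∀ p, p ∈ N p)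
    (Φ : X → ∀ z, F → V z) (inj : ∀ p, ∀ z ∈ N p, Function.Injective (Φ p z))
    (loc : ∀ p q, ∀ x ∈ N p ∩ N q, ∀ y, ∃ y', ∀ᶠ z in 𝓝 x, Φ p z y = Φ q z y') :
    FiberBundleCore X X F where
  baseSet := N
  isOpen_baseSet := hN
  indexAt := id
  mem_baseSet_at := hp
  coordChange := paramChange Φ
  coordChange_self p x hx v := inj p x hx (paramChange_spec rfl)
  -- With discrete fibre, continuity means local constancy: by injectivity the matching parameter at
  -- `x` remains the matching one nearby.
  continuousOn_coordChange p q := by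
    rintro ⟨x, y⟩ ⟨hx, -⟩
    obtain ⟨y', hy'⟩ := loc p q x hx y
    refine ContinuousAt.continuousWithinAt ?_
    have hev : ∀ᶠ w : X × F in 𝓝 (x, y), paramChange Φ p q w.1 w.2 = y' := by
      rw [nhds_prod_eq, nhds_discrete F, prod_pure, eventually_map]
      filter_upwards [hy', (hN q).eventually_mem hx.2] with z hz hzq
      exact inj q z hzq ((paramChange_spec hz).trans hz)
    exact (continuousAt_const (y := y')).congr (hev.mono fun w hw => hw.symm)
  coordChange_comp p q r x hx v := by
    obtain ⟨y₁, h₁⟩ := loc p q x hx.1 v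
    obtain ⟨y₂, h₂⟩ := loc q r x ⟨hx.1.2, hx.2⟩ (paramChange Φ p q x v)
    obtain ⟨y₃, h₃⟩ := loc p r x ⟨hx.1.1, hx.2⟩ v
    refine inj r x hx.2 ?_
    rw [paramChange_spec h₂.self_of_nhds, paramChange_spec h₁.self_of_nhds,
      paramChange_spec h₃.self_of_nhds]

end Gluing

/-- Over a simply connected space, local sections that agree up to locally constant changes of a
parameter can be glued. -/
lemma exists_glued_section {X F : Type*} {V : X → Type*} [TopologicalSpace X]
    [SimplyConnectedSpace X] [LocallyPathConnectedSpace X] [Nonempty F] (N : X → Set X)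
    (hN : ∀ p, IsOpen (N p)) (hp : ∀ p, p ∈ N p) (Φ : X → ∀ z, F → V z)
    (inj : ∀ p, ∀ z ∈ N p, Function.Injective (Φ p z))
    (loc : ∀ p q, ∀ x ∈ N p ∩ N q, ∀ y, ∃ y', ∀ᶠ z in 𝓝 x, Φ p z y = Φ q z y') :
    ∃ s : ∀ z, V z, ∀ x, ∃ y, ∀ᶠ z in 𝓝 x, s z = Φ x z y := by
  -- The discrete topology makes the fibre bundle a covering.
  let _ : TopologicalSpace F := ⊥
  have : DiscreteTopology F := ⟨rfl⟩
  set Z := paramBundle N hN hp Φ inj loc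
  have hcov : IsCoveringMap (Bundle.TotalSpace.proj : Z.TotalSpace → X) :=
    FiberBundle.isCoveringMap
  obtain ⟨x₀⟩ : Nonempty X := inferInstance
  obtain ⟨y₀⟩ := ‹Nonempty F›
  -- Lifting the identity of a simply connected, locally path connected base gives a global section
  -- of the covering.
  obtain ⟨f, ⟨-, hf⟩, -⟩ := hcov.existsUnique_continuousMap_lifts (ContinuousMap.id X) x₀
    (⟨x₀, y₀⟩ : Z.TotalSpace) rfl
  have hfx : ∀ x, (f x).proj = x := fun x => congrFun hf x
  -- The fibre coordinate of `f z` refers to the index `(f z).proj`, which equals `z` only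
  -- propositionally; `paramChange` transports it to the index `z`.
  refine ⟨fun z => Φ z z (paramChange Φ (f z).proj z z (f z).2), fun x => ?_⟩
  have hcont : ContinuousAt (fun z => (Z.localTriv x (f z)).2) x := by
    refine continuous_snd.continuousAt.comp (ContinuousAt.comp ?_ f.continuous.continuousAt)
    refine (Z.localTriv x).continuousAt ?_
    rw [FiberBundleCore.mem_localTriv_source, hfx]
    exact hp x
  have hev : ∀ᶠ z in 𝓝 x, (Z.localTriv x (f z)).2 = (Z.localTriv x (f x)).2 := by
    have := hcont.tendsto
    rw [nhds_discrete F, tendsto_pure] at this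
    exact this
  refine ⟨(Z.localTriv x (f x)).2, ?_⟩
  filter_upwards [hev, (hN x).eventually_mem (hp x)] with z hz hzx
  rw [← hz]
  change _ = Φ x z (paramChange Φ (f z).proj x (f z).proj (f z).2)
  generalize (f z).2 = y
  have hpr := hfx z
  generalize (f z).proj = w at y hpr
  change Φ z z (paramChange Φ w z z y) = _
  subst hpr
  obtain ⟨y₁, h₁⟩ := loc w x w ⟨hp w, hzx⟩ y
  exact (paramChange_spec rfl).trans (paramChange_spec h₁.self_of_nhds).symm

end

section
variable {g g' T T' : Coord → Mat} {φ : Coord → Coord} {u : Coord}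

/-! ### Changes of coordinates -/

/-- The Jacobian matrix. -/
def jac (φ : Coord → Coord) (v : Coord) : Mat := Matrix.of fun m a => pd a (fun w => φ w m) v

lemma Sm.coord (hφ : Sm φ u) (m : Fin 4) : Sm (fun w => φ w m) u :=
  (EuclideanSpace.proj (𝕜 := ℝ) m).contDiff.contDiffAt.comp u hφ

lemma MSm.jac (hφ : Sm φ u) : MSm (jac φ) u := fun m a => (hφ.coord m).pd a

lemma fderiv_coord (hφ : DifferentiableAt ℝ φ u) (w : Coord) (m : Fin 4) :
    fderiv ℝ (fun v => φ v m) u w = fderiv ℝ φ u w m := by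
  have h := (EuclideanSpace.proj (𝕜 := ℝ) m).hasFDerivAt.comp u hφ.hasFDerivAt
  have h2 : fderiv ℝ (fun v => φ v m) u = _ := h.fderiv
  rw [h2]
  rfl

lemma pd_comp {f : Coord → ℝ} (hf : DifferentiableAt ℝ f (φ u)) (hφ : DifferentiableAt ℝ φ u)
    (a : Fin 4) : pd a (fun v => f (φ v)) u = ∑ m, jac φ u m a * pd m f (φ u) := by
  have h2 : fderiv ℝ (fun v => f (φ v)) u = _ := (hf.hasFDerivAt.comp u hφ.hasFDerivAt).fderiv
  rw [pd, h2, ContinuousLinearMap.comp_apply, fderiv_apply_eq_sum (fderiv ℝ f (φ u))]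
  refine Finset.sum_congr rfl fun m _ => ?_
  simp [jac, pd, fderiv_coord hφ]

lemma mpd_comp {S : Coord → Mat} (hS : EntryDiff S (φ u)) (hφ : DifferentiableAt ℝ φ u)
    (a : Fin 4) : mpd a (fun v => S (φ v)) u = ∑ m, jac φ u m a • mpd m S (φ u) := by
  ext i j
  rw [Matrix.sum_apply]
  exact pd_comp (hS i j) hφ a

/-- The components of a bilinear form in new coordinates. -/
def IsPullback (φ : Coord → Coord) (T' T : Coord → Mat) (u : Coord) : Prop :=
  ∀ᶠ v in 𝓝 u, T v = (jac φ v)ᵀ * T' (φ v) * jac φ v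

lemma EntryDiff.comp {S : Coord → Mat} (hS : EntryDiff S (φ u)) (hφ : DifferentiableAt ℝ φ u) :
    EntryDiff (fun v => S (φ v)) u :=
  fun i j => (hS i j).comp u hφ

lemma EntryDiff.mul {S T : Coord → Mat} (hS : EntryDiff S u) (hT : EntryDiff T u) :
    EntryDiff (fun v => S v * T v) u := fun i j => by
  simp only [Matrix.mul_apply]
  exact DifferentiableAt.fun_sum fun k _ => (hS i k).mul (hT k j)

lemma IsPullback.mpd_eq (h : IsPullback φ T' T u) (hT : EntryDiff T' (φ u)) (hφ : Sm φ u)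
    (a : Fin 4) : mpd a T u = (mpd a (jac φ) u)ᵀ * T' (φ u) * jac φ u
      + (jac φ u)ᵀ * (∑ m, jac φ u m a • mpd m T' (φ u)) * jac φ u
      + (jac φ u)ᵀ * T' (φ u) * mpd a (jac φ) u := by
  have hφd : DifferentiableAt ℝ φ u := hφ.differentiableAt (by simp)
  have hJ := (MSm.jac hφ).diff
  have hJt := (MSm.jac hφ).transpose.diff
  have hTc := hT.comp hφd
  rw [mpd_congr h a, mpd_mul (hJt.mul hTc) hJ, mpd_mul hJt hTc, mpd_transpose,
    mpd_comp hT hφd, Matrix.add_mul]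

/-- The transformed connection is symmetric, because second derivatives of `φ` commute, and
compatible with the pulled-back metric; uniqueness identifies it with the Levi-Civita connection. -/
lemma IsPullback.conn_eq (h : IsPullback φ g' g u) (hφ : Sm φ u) (hg' : EntryDiff g' (φ u))
    (hs : ∀ v, (g v)ᵀ = g v) (hs' : ∀ v, (g' v)ᵀ = g' v) (hdet : (g u).det ≠ 0) (a : Fin 4) :
    jac φ u * conn g a u =
      mpd a (jac φ) u + (∑ m, jac φ u m a • conn g' m (φ u)) * jac φ u := by
  set J := jac φ u
  have hgu : g u = Jᵀ * g' (φ u) * J := h.self_of_nhds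
  have hJ : IsUnit J.det := by
    refine isUnit_iff_ne_zero.mpr fun h0 => hdet ?_
    rw [hgu, Matrix.det_mul, h0, mul_zero]
  have hdet' : (g' (φ u)).det ≠ 0 := fun h0 => hdet (by
    rw [hgu, Matrix.det_mul, Matrix.det_mul, h0, mul_zero, zero_mul])
  set Γ : Fin 4 → Mat := fun a => mpd a (jac φ) u + (∑ m, J m a • conn g' m (φ u)) * J
  have hΓ : ∀ a, J * (J⁻¹ * Γ a) = Γ a := fun a => Matrix.mul_nonsing_inv_cancel_left _ _ hJ
  have hΓs : ∀ a b m, Γ a m b = Γ b m a := by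
    intro a b m
    have h1 : mpd a (jac φ) u m b = mpd b (jac φ) u m a := pd_comm (hφ.coord m) a b
    simp only [Γ, Matrix.add_apply, h1, Matrix.mul_apply, Matrix.sum_apply, Matrix.smul_apply,
      smul_eq_mul, Finset.sum_mul]
    rw [Finset.sum_comm]
    congr 1
    refine Finset.sum_congr rfl fun l _ => Finset.sum_congr rfl fun n _ => ?_
    rw [conn_symm hs']
    ring
  rw [conn_unique hs hdet (Γ := fun a => J⁻¹ * Γ a) (fun a b k => ?_) (fun a => ?_) a, hΓ]
  · simp only [Matrix.mul_apply, hΓs a b]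
  · have h2 : (∑ m, J m a • mpd m g' (φ u)) = (∑ m, J m a • conn g' m (φ u))ᵀ * g' (φ u)
        + g' (φ u) * ∑ m, J m a • conn g' m (φ u) := by
      simp only [metric_compat hs' hdet', smul_add, Finset.sum_add_distrib, Matrix.transpose_sum,
        Matrix.transpose_smul, Finset.sum_mul, Finset.mul_sum, Matrix.smul_mul, Matrix.mul_smul]
    have h3 : (J⁻¹ * Γ a)ᵀ * g u + g u * (J⁻¹ * Γ a) =
        (Γ a)ᵀ * g' (φ u) * J + Jᵀ * g' (φ u) * Γ a := by
      have h4 : (J⁻¹ * Γ a)ᵀ * g u = (J * (J⁻¹ * Γ a))ᵀ * g' (φ u) * J := by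
        rw [hgu, Matrix.transpose_mul J]
        simp only [Matrix.mul_assoc]
      have h5 : g u * (J⁻¹ * Γ a) = Jᵀ * g' (φ u) * (J * (J⁻¹ * Γ a)) := by
        rw [hgu]
        simp only [Matrix.mul_assoc]
      rw [h4, h5, hΓ]
    rw [h3, h.mpd_eq hg' hφ, h2]
    simp only [Γ, Matrix.transpose_add, Matrix.transpose_mul]
    noncomm_ring

/-- The derivatives of the Jacobian from the Leibniz rule cancel the inhomogeneous terms in
`conn_eq`. This is needed because solutions are built in one chart but must satisfy the equation in
all of them. -/
lemma IsPullback.covDeriv_eq (h : IsPullback φ g' g u) (hT : IsPullback φ T' T u) (hφ : Sm φ u)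
    (hg' : EntryDiff g' (φ u)) (hT' : EntryDiff T' (φ u)) (hs : ∀ v, (g v)ᵀ = g v)
    (hs' : ∀ v, (g' v)ᵀ = g' v) (hdet : (g u).det ≠ 0) (a b c : Fin 4) :
    covDeriv g T u a b c = fr3 (jac φ u) (covDeriv g' T' (φ u)) a b c := by
  have hc := h.conn_eq hφ hg' hs hs' hdet a
  have h1 : mpd a T u - (conn g a u)ᵀ * T u - T u * conn g a u = (jac φ u)ᵀ *
      (∑ m, jac φ u m a • (mpd m T' (φ u) - (conn g' m (φ u))ᵀ * T' (φ u)
        - T' (φ u) * conn g' m (φ u))) * jac φ u := by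
    have h2 : (∑ m, jac φ u m a • (mpd m T' (φ u) - (conn g' m (φ u))ᵀ * T' (φ u)
        - T' (φ u) * conn g' m (φ u))) = (∑ m, jac φ u m a • mpd m T' (φ u))
        - (∑ m, jac φ u m a • conn g' m (φ u))ᵀ * T' (φ u)
        - T' (φ u) * ∑ m, jac φ u m a • conn g' m (φ u) := by
      simp only [smul_sub, Finset.sum_sub_distrib, Matrix.transpose_sum,
        Matrix.transpose_smul, Finset.sum_mul, Finset.mul_sum, Matrix.smul_mul, Matrix.mul_smul]
    have h3 : (conn g a u)ᵀ * T u = (jac φ u * conn g a u)ᵀ * T' (φ u) * jac φ u := by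
      rw [hT.self_of_nhds, Matrix.transpose_mul]
      simp only [Matrix.mul_assoc]
    have h4 : T u * conn g a u = (jac φ u)ᵀ * T' (φ u) * (jac φ u * conn g a u) := by
      rw [hT.self_of_nhds]
      simp only [Matrix.mul_assoc]
    rw [hT.mpd_eq hT' hφ, h2, h3, h4, hc, Matrix.transpose_add, Matrix.transpose_mul]
    noncomm_ring
  rw [Spacetime.covDeriv_eq, h1]
  simp only [fr3, Matrix.mul_apply, Matrix.sum_apply, Matrix.smul_apply, Matrix.transpose_apply,
    smul_eq_mul, Finset.sum_mul, Finset.mul_sum, ← Spacetime.covDeriv_eq]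
  refine Finset.sum_comm_cycle.symm.trans ?_
  exact Finset.sum_congr rfl fun m _ => Finset.sum_congr rfl fun n _ =>
    Finset.sum_congr rfl fun l _ => by ring

/-- The conformal Killing-Yano equation does not depend on the coordinates. -/
lemma IsPullback.cky (h : IsPullback φ g' g u) (hT : IsPullback φ T' T u) (hφ : Sm φ u)
    (hg' : EntryDiff g' (φ u)) (hT' : EntryDiff T' (φ u)) (hs : ∀ v, (g v)ᵀ = g v)
    (hs' : ∀ v, (g' v)ᵀ = g' v) (hdet : (g u).det ≠ 0) (hC : CKYEqAt g' T' (φ u)) :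
    CKYEqAt g T u := by
  obtain ⟨ξ, hξ⟩ := hC
  set J := jac φ u
  have hgu : ∀ i k, ∑ a, ∑ b, J a i * J b k * g' (φ u) a b = g u i k := by
    intro i k
    rw [h.self_of_nhds, Matrix.mul_assoc, Matrix.mul_apply]
    refine Finset.sum_congr rfl fun a _ => ?_
    rw [Matrix.transpose_apply, Matrix.mul_apply, Finset.mul_sum]
    exact Finset.sum_congr rfl fun b _ => by ring
  have e1 := fr3_mul J (g' (φ u)) ξ
  simp only [hgu] at e1
  refine ⟨fun c => ∑ l, J l c * ξ l, fun k i j => ?_⟩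
  have e2 : fr3 J (fun a b c => g' (φ u) b c * ξ a) k i j = g u i j * (∑ c, J c k * ξ c) := by
    rw [← e1 i j k, ← fr3_cycle J _ k i j]
  have e3 : fr3 J (fun a b c => g' (φ u) a c * ξ b) k i j = g u k j * (∑ c, J c i * ξ c) := by
    rw [← e1 k j i, ← fr3_cycle J _ i k j, ← fr3_perm J _ k i j]
  rw [h.covDeriv_eq hT hφ hg' hT' hs hs' hdet, h.covDeriv_eq hT hφ hg' hT' hs hs' hdet, mul_assoc,
    ← e1 k i j, ← e2, ← e3, ← fr3_perm J _ k i j]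
  simp only [fr3, Finset.mul_sum, ← Finset.sum_add_distrib, ← Finset.sum_sub_distrib]
  refine Finset.sum_congr rfl fun a _ => Finset.sum_congr rfl fun b _ =>
    Finset.sum_congr rfl fun c _ => ?_
  linear_combination J a k * J b i * J c j * hξ a b c

end

section
variable {g E F : Coord → Mat} {u : Coord}

/-! ### Non-null 2-forms -/

lemma frameAct_leviCivita_planeForm (p q : ℝ) :
    frameAct leviCivita (cx (planeForm p q)) = cx (planeForm q (-p)) := by
  have s01 : ∀ a b c d, leviCivita a b c d = -leviCivita b a c d := fun a b c d =>
    leviCivita_swap ![a, b, c, d] (i := 0) (j := 1) (by decide)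
  have s12 : ∀ a b c d, leviCivita a b c d = -leviCivita a c b d := fun a b c d =>
    leviCivita_swap ![a, b, c, d] (i := 1) (j := 2) (by decide)
  have s23 : ∀ a b c d, leviCivita a b c d = -leviCivita a b d c := fun a b c d =>
    leviCivita_swap ![a, b, c, d] (i := 2) (j := 3) (by decide)
  have z12 : ∀ a b c, leviCivita a b b c = 0 := fun a b c => by linarith [s12 a b b c]
  have z13 : ∀ a b c, leviCivita a b c b = 0 := fun a b c => by
    linarith [s23 a b c b, z12 a b c]
  have z02 : ∀ a b c, leviCivita a b a c = 0 := fun a b c => by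
    linarith [s01 a b a c, z12 b a c]
  have z03 : ∀ a b c, leviCivita a b c a = 0 := fun a b c => by
    linarith [s01 a b c a, z13 b a c]
  have v1 := leviCivita_zero_one_two_three
  have v4 : leviCivita 2 3 0 1 = 1 := by
    linarith [s12 0 1 2 3, s23 0 2 1 3, s01 0 2 3 1, s12 2 0 3 1]
  have key : ∀ i j, frameAct leviCivita (cx (planeForm p q)) i j =
      -leviCivita i j 0 1 * p + leviCivita i j 2 3 * q := by
    intro i j
    simp [frameAct, Fin.sum_univ_four, eta, planeForm, cx, s23 i j 1 0, s23 i j 3 2]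
    ring
  refine ext_of_anti (fun i j => ?_) (fun i j => ?_) ?_ ?_ ?_ ?_ ?_ ?_
  · simp only [key, s01 i j]
    push_cast
    ring
  · fin_cases i <;> fin_cases j <;> simp [cx, planeForm]
  all_goals
    rw [key]
    simp [planeForm, cx, z12, z13, z02, z03, v1, v4]

lemma formInner_eq_trace (F H : Matrix (Fin 4) (Fin 4) ℂ) :
    formInner g u F H = 1 / 2 * (Fᵀ * cx (gInv g u) * H * (cx (gInv g u))ᵀ).trace := by
  simp only [formInner, Matrix.trace, Matrix.diag, Matrix.mul_apply, Matrix.transpose_apply, cx,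
    Matrix.map_apply, Finset.sum_mul]
  congr 1
  rw [Finset.sum_comm]
  refine Finset.sum_congr rfl fun b _ => ?_
  refine Finset.sum_comm_cycle.trans (Finset.sum_congr rfl fun d _ => ?_)
  rw [Finset.sum_comm]
  exact Finset.sum_congr rfl fun c _ => Finset.sum_congr rfl fun a _ => by ring

lemma IsON.formInner_planeForm (h : IsON g E u) {F H : Matrix (Fin 4) (Fin 4) ℂ} {p q r s : ℝ}
    (hF : (cx (E u))ᵀ * F * cx (E u) = cx (planeForm p q))
    (hH : (cx (E u))ᵀ * H * cx (E u) = cx (planeForm r s)) :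
    formInner g u F H = ((q * s - p * r : ℝ) : ℂ) := by
  have h1 : (Fᵀ * cx (gInv g u) * H * (cx (gInv g u))ᵀ).trace =
      ((cx (planeForm p q))ᵀ * cx (diagonal eta) * cx (planeForm r s)
        * cx (diagonal eta)).trace := by
    rw [← hF, ← hH, h.gInv_eq]
    simp only [cx_mul, cx_transpose, Matrix.transpose_mul, Matrix.transpose_transpose]
    have : (cx (diagonal eta))ᵀ = cx (diagonal eta) := by
      rw [← cx_transpose, diagonal_transpose]
    rw [this]
    simp only [← Matrix.mul_assoc]
    rw [Matrix.trace_mul_comm]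
    simp only [← Matrix.mul_assoc]
  rw [formInner_eq_trace, h1]
  simp [Matrix.trace, Matrix.mul_apply, Fin.sum_univ_four, planeForm, cx, eta,
    Matrix.diagonal_apply]
  ring

lemma IsON.isNonNullAt_of_det_pos (h : IsON g E u) (hdet : 0 < (E u).det) {p q : ℝ}
    (hF : (E u)ᵀ * F u * E u = planeForm p q) (hpq : p ^ 2 + q ^ 2 ≠ 0) : IsNonNullAt g F u := by
  have h1 : (cx (E u))ᵀ * cx (F u) * cx (E u) = cx (planeForm p q) := by
    rw [← hF, cx_mul, cx_mul, cx_transpose]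
  have h2 : (cx (E u))ᵀ * hodge g u (cx (F u)) * cx (E u) = cx (planeForm q (-p)) := by
    rw [hodge, h.frame_dblAct, fr4_volForm h hdet, h1, frameAct_leviCivita_planeForm]
  rw [IsNonNullAt]
  change formInner g u (cx (F u)) (cx (F u)) ≠ 0 ∨
    formInner g u (cx (F u)) (hodge g u (cx (F u))) ≠ 0
  rw [h.formInner_planeForm h1 h1, h.formInner_planeForm h1 h2]
  by_contra! h0
  rw [Complex.ofReal_eq_zero, Complex.ofReal_eq_zero] at h0
  -- The two invariants are `q² - p²` and `-2pq`, and the sum of their squares is `(p² + q²)²`.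
  have e : (p ^ 2 + q ^ 2) ^ 2 = 0 := by
    linear_combination (q * q - p * p) * h0.1 - 2 * p * q * h0.2
  exact hpq (pow_eq_zero_iff (two_ne_zero) |>.mp e)

/-- Reversing `e₃` makes the frame positively oriented and only changes the sign of `q`. Frames
transported to another chart may have either orientation. -/
lemma IsON.isNonNullAt (h : IsON g E u) {p q : ℝ}
    (hF : (E u)ᵀ * F u * E u = planeForm p q) (hpq : p ^ 2 + q ^ 2 ≠ 0) : IsNonNullAt g F u := by
  rcases h.det_ne.lt_or_gt with h1 | h1
  · set D : Mat := diagonal ![1, 1, 1, -1]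
    have hD : ∀ A : Mat, (E u * D)ᵀ * A * (E u * D) = D * ((E u)ᵀ * A * E u) * D := fun A => by
      rw [Matrix.transpose_mul, diagonal_transpose]
      simp only [Matrix.mul_assoc]
      rfl
    refine IsON.isNonNullAt_of_det_pos (E := fun v => E v * D) (p := p) (q := -q) ?_ ?_ ?_
      (by simpa using hpq)
    · refine (hD (g u)).trans ?_
      rw [show (E u)ᵀ * g u * E u = diagonal eta from h]
      simp only [D, diagonal_mul_diagonal]
      congr 1
      funext i
      fin_cases i <;> simp
    · rw [Matrix.det_mul, Matrix.det_diagonal, Fin.prod_univ_four]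
      simpa using h1
    · refine (hD (F u)).trans ?_
      rw [hF]
      ext i j
      simp only [D, mul_diagonal, diagonal_mul]
      fin_cases i <;> fin_cases j <;> simp [planeForm]
  · exact h.isNonNullAt_of_det_pos h1 hF hpq

end

section
variable {M : Type*} [TopologicalSpace M]

/-! ### Fields in charts -/

/-- The change of coordinates. -/
def coordChange (e e' : OpenPartialHomeomorph M Coord) (u : Coord) : Coord := e' (e.symm u)

variable {e e' : OpenPartialHomeomorph M Coord} {u : Coord}

lemma eventually_overlap (hu : u ∈ e.target) (hu' : e.symm u ∈ e'.source) :
    ∀ᶠ v in 𝓝 u, v ∈ e.target ∧ e.symm v ∈ e'.source :=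
  (e.open_target.eventually_mem hu).and
    ((e.continuousAt_symm hu).eventually (e'.open_source.eventually_mem hu'))

variable [ChartedSpace Coord M]

/-- The coordinate vector fields of a chart. -/
def coordVec (e : OpenPartialHomeomorph M Coord) (u : Coord) (i : Fin 4) : Coord :=
  mfderiv (𝓡 4) (𝓡 4) e.symm u (EuclideanSpace.single i 1 : Coord)

/-- A field of bilinear forms, with tangent vectors in the model space. -/
def bil (T : BilinField M) (x : M) : Coord →ₗ[ℝ] Coord →ₗ[ℝ] ℝ := T x

lemma components_apply (e : OpenPartialHomeomorph M Coord) (T : BilinField M) (u : Coord)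
    (i j : Fin 4) : components e T u i j =
      bil T (e.symm u) (coordVec e u i) (coordVec e u j) := rfl

lemma coordChange_smooth [IsManifold (𝓡 4) ∞ M] (he : e ∈ IsManifold.maximalAtlas (𝓡 4) ∞ M)
    (he' : e' ∈ IsManifold.maximalAtlas (𝓡 4) ∞ M) (hu : u ∈ e.target)
    (hu' : e.symm u ∈ e'.source) : Sm (coordChange e e') u :=
  ((contMDiffAt_of_mem_maximalAtlas he' hu').comp u
    (contMDiffAt_symm_of_mem_maximalAtlas he hu)).contDiffAt

lemma coordVec_eq [IsManifold (𝓡 4) ∞ M] (he : e ∈ IsManifold.maximalAtlas (𝓡 4) ∞ M)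
    (he' : e' ∈ IsManifold.maximalAtlas (𝓡 4) ∞ M) (hu : u ∈ e.target)
    (hu' : e.symm u ∈ e'.source) (i : Fin 4) :
    coordVec e u i = ∑ m, jac (coordChange e e') u m i • coordVec e' (coordChange e e' u) m := by
  have hφ := coordChange_smooth he he' hu hu'
  have hφd : DifferentiableAt ℝ (coordChange e e') u := hφ.differentiableAt (by simp)
  have ht : coordChange e e' u ∈ e'.target := e'.map_source hu'
  have h1 : e.symm =ᶠ[𝓝 u] e'.symm ∘ coordChange e e' := by
    filter_upwards [eventually_overlap hu hu'] with v hv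
    exact (e'.left_inv hv.2).symm
  have hd : MDifferentiableAt (𝓡 4) (𝓡 4) e'.symm (coordChange e e' u) :=
    (contMDiffAt_symm_of_mem_maximalAtlas he' ht).mdifferentiableAt (by simp)
  have h2 : HasMFDerivAt (𝓡 4) (𝓡 4) e.symm u
      ((mfderiv (𝓡 4) (𝓡 4) e'.symm (coordChange e e' u)).comp (fderiv ℝ (coordChange e e') u)) :=
    (HasMFDerivAt.comp u hd.hasMFDerivAt hφd.hasFDerivAt.hasMFDerivAt).congr_of_eventuallyEq h1
  have h3 : coordVec e u i = (mfderiv (𝓡 4) (𝓡 4) e'.symm (coordChange e e' u))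
      (fderiv ℝ (coordChange e e') u (EuclideanSpace.single i 1)) := by
    have := h2.mfderiv
    exact congrArg (fun A : Coord →L[ℝ] Coord => A (EuclideanSpace.single i 1)) this
  rw [h3]
  refine (fderiv_apply_eq_sum (F := Coord)
    (mfderiv (𝓡 4) (𝓡 4) e'.symm (coordChange e e' u)) _).trans ?_
  refine Finset.sum_congr rfl fun m _ => ?_
  rw [← fderiv_coord hφd]
  rfl

lemma components_coordChange [IsManifold (𝓡 4) ∞ M] (he : e ∈ IsManifold.maximalAtlas (𝓡 4) ∞ M)
    (he' : e' ∈ IsManifold.maximalAtlas (𝓡 4) ∞ M) (hu : u ∈ e.target)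
    (hu' : e.symm u ∈ e'.source) (T : BilinField M) :
    components e T u =
      (jac (coordChange e e') u)ᵀ * components e' T (coordChange e e' u)
        * jac (coordChange e e') u := by
  have hx : e'.symm (coordChange e e' u) = e.symm u := e'.left_inv hu'
  ext i j
  rw [components_apply, coordVec_eq he he' hu hu' i, coordVec_eq he he' hu hu' j, Matrix.mul_assoc,
    Matrix.mul_apply]
  simp only [Matrix.mul_apply, Matrix.transpose_apply, components_apply, hx, map_sum, map_smul,
    LinearMap.sum_apply, LinearMap.smul_apply, smul_eq_mul, Finset.mul_sum]
  rw [Finset.sum_comm]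
  exact Finset.sum_congr rfl fun m _ => Finset.sum_congr rfl fun n _ => by ring

lemma isPullback_components [IsManifold (𝓡 4) ∞ M] (he : e ∈ IsManifold.maximalAtlas (𝓡 4) ∞ M)
    (he' : e' ∈ IsManifold.maximalAtlas (𝓡 4) ∞ M) (hu : u ∈ e.target)
    (hu' : e.symm u ∈ e'.source) (T : BilinField M) :
    IsPullback (coordChange e e') (components e' T) (components e T) u := by
  filter_upwards [eventually_overlap hu hu'] with v hv
  exact components_coordChange he he' hv.1 hv.2 T

/-- The coordinate differentials of a chart. -/
def dcoord (e : OpenPartialHomeomorph M Coord) (x : M) (i : Fin 4) : Coord →ₗ[ℝ] ℝ :=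
  (EuclideanSpace.proj (𝕜 := ℝ) i).toLinearMap ∘ₗ
    (show Coord →L[ℝ] Coord from mfderiv (𝓡 4) (𝓡 4) e x).toLinearMap

lemma mdifferentiable_of_mem [IsManifold (𝓡 4) ∞ M]
    (he : e ∈ IsManifold.maximalAtlas (𝓡 4) ∞ M) : e.MDifferentiable (𝓡 4) (𝓡 4) :=
  ⟨(contMDiffOn_of_mem_maximalAtlas he).mdifferentiableOn (by simp),
    (contMDiffOn_symm_of_mem_maximalAtlas he).mdifferentiableOn (by simp)⟩

lemma dcoord_coordVec [IsManifold (𝓡 4) ∞ M] (he : e ∈ IsManifold.maximalAtlas (𝓡 4) ∞ M)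
    (hu : u ∈ e.target) (i j : Fin 4) :
    dcoord e (e.symm u) i (coordVec e u j) = if i = j then 1 else 0 := by
  have h1 := congrArg (fun A : Coord →L[ℝ] Coord => A (EuclideanSpace.single j 1) i)
    ((mdifferentiable_of_mem he).comp_symm_deriv hu)
  refine Eq.trans h1 ?_
  change (EuclideanSpace.single j (1 : ℝ) : Coord) i = _
  simp

lemma sum_dcoord [IsManifold (𝓡 4) ∞ M] (he : e ∈ IsManifold.maximalAtlas (𝓡 4) ∞ M)
    (hu : u ∈ e.target) (v : Coord) : v = ∑ i, dcoord e (e.symm u) i v • coordVec e u i := by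
  have h1 : (mfderiv (𝓡 4) (𝓡 4) e.symm (e (e.symm u)) : Coord →L[ℝ] Coord)
      ((mfderiv (𝓡 4) (𝓡 4) e (e.symm u) : Coord →L[ℝ] Coord) v) = v :=
    congrArg (fun A : Coord →L[ℝ] Coord => A v)
      ((mdifferentiable_of_mem he).symm_comp_deriv (e.map_target hu))
  rw [e.right_inv hu] at h1
  refine h1.symm.trans ?_
  exact fderiv_apply_eq_sum (F := Coord) (mfderiv (𝓡 4) (𝓡 4) e.symm u) _

/-- The field with given components in a chart. -/
def ofComponents (e : OpenPartialHomeomorph M Coord) (C : Coord → Mat) : BilinField M := fun x =>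
  (∑ i, ∑ j, C (e x) i j • (dcoord e x i).smulRight (dcoord e x j) :
    Coord →ₗ[ℝ] Coord →ₗ[ℝ] ℝ)

lemma components_ofComponents [IsManifold (𝓡 4) ∞ M]
    (he : e ∈ IsManifold.maximalAtlas (𝓡 4) ∞ M) (hu : u ∈ e.target) (C : Coord → Mat) :
    components e (ofComponents e C) u = C u := by
  ext i j
  rw [components_apply]
  change (∑ i, ∑ j, C (e (e.symm u)) i j • (dcoord e (e.symm u) i).smulRight
    (dcoord e (e.symm u) j) : Coord →ₗ[ℝ] Coord →ₗ[ℝ] ℝ) _ _ = _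
  simp [LinearMap.sum_apply, LinearMap.smul_apply, dcoord_coordVec he hu, e.right_inv hu]

lemma bil_sum (T : BilinField M) {X : Mat} {w : Fin 4 → Coord}
    (hw : ∀ j, w j = ∑ i, X i j • coordVec e u i) (i j : Fin 4) :
    (Xᵀ * components e T u * X) i j = bil T (e.symm u) (w i) (w j) := by
  rw [hw i, hw j, Matrix.mul_assoc, Matrix.mul_apply]
  simp only [Matrix.mul_apply, Matrix.transpose_apply, components_apply, map_sum, map_smul,
    LinearMap.sum_apply, LinearMap.smul_apply, smul_eq_mul, Finset.mul_sum]
  rw [Finset.sum_comm]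
  exact Finset.sum_congr rfl fun m _ => Finset.sum_congr rfl fun n _ => by ring

lemma bil_ext [IsManifold (𝓡 4) ∞ M] (he : e ∈ IsManifold.maximalAtlas (𝓡 4) ∞ M)
    (hu : u ∈ e.target) {T T' : BilinField M} (h : components e T u = components e T' u) :
    T (e.symm u) = T' (e.symm u) := by
  have key : ∀ v w : Coord, bil T (e.symm u) v w = bil T' (e.symm u) v w := by
    intro v w
    have hij : ∀ i j, bil T (e.symm u) (coordVec e u i) (coordVec e u j) =
        bil T' (e.symm u) (coordVec e u i) (coordVec e u j) := fun i j =>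
      congrFun (congrFun h i) j
    rw [sum_dcoord he hu v, sum_dcoord he hu w]
    simp only [map_sum, map_smul, LinearMap.sum_apply, LinearMap.smul_apply, hij]
  exact LinearMap.ext fun v => LinearMap.ext fun w => key v w

lemma bil_anti [IsManifold (𝓡 4) ∞ M] (he : e ∈ IsManifold.maximalAtlas (𝓡 4) ∞ M)
    (hu : u ∈ e.target) {T : BilinField M} (h : (components e T u)ᵀ = -components e T u)
    (v w : Coord) : bil T (e.symm u) v w = -bil T (e.symm u) w v := by
  have hij : ∀ i j, bil T (e.symm u) (coordVec e u i) (coordVec e u j) =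
      -bil T (e.symm u) (coordVec e u j) (coordVec e u i) := fun i j =>
    congrFun (congrFun h j) i
  rw [sum_dcoord he hu v, sum_dcoord he hu w]
  simp only [map_sum, map_smul, LinearMap.sum_apply, LinearMap.smul_apply, smul_eq_mul,
    Finset.mul_sum, ← Finset.sum_neg_distrib]
  rw [Finset.sum_comm]
  refine Finset.sum_congr rfl fun i _ => Finset.sum_congr rfl fun j _ => ?_
  rw [hij]
  ring

lemma SmoothOn.mSm {T : BilinField M} (hT : SmoothOn T Set.univ)
    (he : e ∈ IsManifold.maximalAtlas (𝓡 4) ∞ M) (hu : u ∈ e.target) :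
    MSm (components e T) u := fun i j => by
  have h := hT e he i j
  rw [Set.preimage_univ, Set.inter_univ] at h
  exact h.contDiffAt (e.open_target.mem_nhds hu)

lemma components_symm {T : BilinField M} (hT : ∀ x v w, T x v w = T x w v)
    (e : OpenPartialHomeomorph M Coord) (u : Coord) :
    (components e T u)ᵀ = components e T u := by
  ext i j
  exact hT _ _ _

lemma LorentzMetric.IsTwoPlusTwo.isAdapted [IsManifold (𝓡 4) ∞ M] {g : LorentzMetric M}
    {K : BilinField M} (hK : g.IsTwoPlusTwo K) (he : e ∈ IsManifold.maximalAtlas (𝓡 4) ∞ M)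
    (hu : u ∈ e.target) :
    ∃ X a b, IsAdapted (components e g.val u) (components e K u) X a b := by
  obtain ⟨b, hb, α, β, hne, hk⟩ := hK (e.symm u)
  set X : Mat := Matrix.of fun i j => dcoord e (e.symm u) i (b j)
  have hX : ∀ j, (b j : Coord) = ∑ i, X i j • coordVec e u i := fun j => sum_dcoord he hu (b j)
  have hg : ∀ i j, bil g.val (e.symm u) (b i) (b j) = (diagonal eta : Mat) i j := fun i j => by
    refine (hb i j).trans ?_
    fin_cases i <;> fin_cases j <;> simp [eta]
  refine ⟨X, α, β, ?_, ?_, hne⟩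
  · ext i j
    rw [bil_sum g.val hX, hg]
  · ext i j
    rw [bil_sum K hX]
    have h1 : bil K (e.symm u) (b i) (b j) =
        (if i = 0 ∨ i = 1 then α else β) * bil g.val (e.symm u) (b i) (b j) := hk i (b j)
    rw [h1, hg]
    fin_cases i <;> fin_cases j <;> simp

end

section
variable {g g' K K' T T' E : Coord → Mat} {α β : Coord → ℝ} {Ω : Set Coord} {φ : Coord → Coord}
  {u : Coord}

/-! ### Conformal Killing-Yano tensors commuting with a conformal Killing tensor -/

/-- `T` is a smooth 2-form that satisfies the conformal Killing-Yano equation and commutes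
with `K`. -/
structure IsAdaptedCKY (g K T : Coord → Mat) (u : Coord) : Prop where
  smooth : MSm T u
  anti : (T u)ᵀ = -T u
  comm : T u * (g u)⁻¹ * K u = K u * (g u)⁻¹ * T u
  cky : CKYEqAt g T u

lemma CKYEqAt.congr (h : CKYEqAt g T u) (hT : T' =ᶠ[𝓝 u] T) : CKYEqAt g T' u := by
  have h1 : ∀ a b c, covDeriv g T' u a b c = covDeriv g T u a b c := fun a b c => by
    simp only [covDeriv, hT.self_of_nhds]
    congr 2
    exact pd_congr (hT.mono fun v hv => by simp only [hv]) a
  obtain ⟨ξ, hξ⟩ := h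
  exact ⟨ξ, fun a b c => by rw [h1, h1, hξ]⟩

lemma IsAdaptedCKY.congr (h : IsAdaptedCKY g K T u) (hT : T' =ᶠ[𝓝 u] T) :
    IsAdaptedCKY g K T' u where
  smooth := h.smooth.congr hT
  anti := by rw [hT.self_of_nhds, h.anti]
  comm := by rw [hT.self_of_nhds, h.comm]
  cky := h.cky.congr hT

lemma MSm.comp {S : Coord → Mat} (hS : MSm S (φ u)) (hφ : Sm φ u) : MSm (fun v => S (φ v)) u :=
  fun i j => (hS i j).comp u hφ

lemma IsPullback.jac_isUnit (h : IsPullback φ g' g u) (hdet : (g u).det ≠ 0) :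
    IsUnit (jac φ u).det := by
  refine isUnit_iff_ne_zero.mpr fun h0 => hdet ?_
  rw [h.self_of_nhds, Matrix.det_mul, h0, mul_zero]

/-- Every clause is tensorial; in the commutation relation the Jacobians between the factors cancel
against those of the inverse metric. -/
lemma IsAdaptedCKY.pullback (h : IsAdaptedCKY g' K' T' (φ u)) (hφ : Sm φ u)
    (hg : IsPullback φ g' g u) (hK : IsPullback φ K' K u) (hT : IsPullback φ T' T u)
    (hg' : MSm g' (φ u)) (hs : ∀ v, (g v)ᵀ = g v) (hs' : ∀ v, (g' v)ᵀ = g' v)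
    (hdet : (g u).det ≠ 0) : IsAdaptedCKY g K T u := by
  have hJ := hg.jac_isUnit hdet
  have hJt : IsUnit (jac φ u)ᵀ.det := by rwa [Matrix.det_transpose]
  have key : ∀ A B : Mat, (jac φ u)ᵀ * A * jac φ u * (g u)⁻¹ * ((jac φ u)ᵀ * B * jac φ u) =
      (jac φ u)ᵀ * (A * (g' (φ u))⁻¹ * B) * jac φ u := by
    intro A B
    rw [hg.self_of_nhds, Matrix.mul_inv_rev, Matrix.mul_inv_rev]
    simp only [Matrix.mul_assoc]
    rw [Matrix.mul_nonsing_inv_cancel_left _ _ hJ, Matrix.nonsing_inv_mul_cancel_left _ _ hJt]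
  refine ⟨?_, ?_, ?_, hg.cky hT hφ hg'.diff h.smooth.diff hs hs' hdet h.cky⟩
  · exact (((MSm.jac hφ).transpose.mul (h.smooth.comp hφ)).mul (MSm.jac hφ)).congr hT
  · rw [hT.self_of_nhds, Matrix.transpose_mul, Matrix.transpose_mul, h.anti,
      Matrix.transpose_transpose]
    noncomm_ring
  · rw [hT.self_of_nhds, hK.self_of_nhds, key, key, h.comm]

lemma planeForm_transpose (p q : ℝ) : (planeForm p q)ᵀ = -planeForm p q := by
  ext i j
  fin_cases i <;> fin_cases j <;> simp [planeForm]

lemma planeForm_comm (p q a b : ℝ) :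
    planeForm p q * diagonal ![a, a, b, b] = diagonal ![a, a, b, b] * planeForm p q := by
  ext i j
  rw [mul_diagonal, diagonal_mul]
  fin_cases i <;> fin_cases j <;> simp [planeForm, mul_comm]

/-- Commutation kills the entries joining the two distinct eigenspaces, and antisymmetry leaves one
entry in each 2×2 block. -/
lemma eq_planeForm {A : Mat} {a b : ℝ} (hA : Aᵀ = -A) (hne : a ≠ b)
    (hc : A * diagonal ![a, a, b, b] = diagonal ![a, a, b, b] * A) :
    A = planeForm (A 0 1) (A 2 3) := by
  have hij : ∀ i j, A j i = -A i j := fun i j => congrFun (congrFun hA i) j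
  have hz : ∀ i j, A i j * ![a, a, b, b] j = ![a, a, b, b] i * A i j := fun i j => by
    have := congrFun (congrFun hc i) j
    rwa [mul_diagonal, diagonal_mul] at this
  have hii : ∀ i, A i i = 0 := fun i => by linarith [hij i i]
  have hab : a - b ≠ 0 := sub_ne_zero.mpr hne
  have hz' : ∀ i j, (![a, a, b, b] i - ![a, a, b, b] j) * A i j = 0 := fun i j => by
    linear_combination -hz i j
  have z02 : A 0 2 = 0 := (mul_eq_zero.mp (hz' 0 2)).resolve_left hab
  have z03 : A 0 3 = 0 := (mul_eq_zero.mp (hz' 0 3)).resolve_left hab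
  have z12 : A 1 2 = 0 := (mul_eq_zero.mp (hz' 1 2)).resolve_left hab
  have z13 : A 1 3 = 0 := (mul_eq_zero.mp (hz' 1 3)).resolve_left hab
  ext i j
  fin_cases i <;> fin_cases j <;> simp [planeForm, hii, z02, z03, z12, z13, hij 0 2, hij 0 3,
    hij 1 2, hij 1 3, hij 0 1, hij 2 3]

namespace IsAdapted

variable {G k e A : Mat} {a b : ℝ}

lemma mul_inv (h : IsAdapted G k e a b) : e * e⁻¹ = 1 :=
  IsON.mul_inv (g := fun _ => G) (E := fun _ => e) (u := 0) h.on

lemma inv_mul_metric (h : IsAdapted G k e a b) : G⁻¹ * k * e = e * diagonal ![a, a, b, b] := by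
  have h2 : G⁻¹ = e * diagonal eta * eᵀ :=
    IsON.gInv_eq (g := fun _ => G) (E := fun _ => e) (u := 0) h.on
  rw [h2, Matrix.mul_assoc, Matrix.mul_assoc, ← Matrix.mul_assoc eᵀ, h.diag, Matrix.mul_assoc,
    diagonal_mul_diagonal]
  congr 2
  funext i
  rw [mul_left_comm, eta_mul_self, mul_one]

lemma conj_inj (h : IsAdapted G k e a b) {B : Mat} (hAB : eᵀ * A * e = eᵀ * B * e) : A = B := by
  have hlt : (e⁻¹)ᵀ * eᵀ = 1 := by rw [← Matrix.transpose_mul, h.mul_inv, Matrix.transpose_one]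
  have h1 := congrArg (fun X => (e⁻¹)ᵀ * X * e⁻¹) hAB
  simp only [Matrix.mul_assoc, h.mul_inv, Matrix.mul_one] at h1
  simpa only [← Matrix.mul_assoc, hlt, Matrix.one_mul] using h1

/-- The left side is independent of frame and chart. It allows 2-forms built from unrelated adapted
frames to be compared on overlaps. -/
lemma comm_iff (h : IsAdapted G k e a b) (hG : Gᵀ = G) (hk : kᵀ = k) :
    A * G⁻¹ * k = k * G⁻¹ * A ↔
      (eᵀ * A * e) * diagonal ![a, a, b, b] = diagonal ![a, a, b, b] * (eᵀ * A * e) := by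
  have h1 : eᵀ * (A * G⁻¹ * k) * e = (eᵀ * A * e) * diagonal ![a, a, b, b] := by
    rw [Matrix.mul_assoc eᵀ A, Matrix.mul_assoc A, Matrix.mul_assoc eᵀ, Matrix.mul_assoc A,
      Matrix.mul_assoc _ _ (diagonal _), Matrix.mul_assoc A, ← h.inv_mul_metric]
  have h2 : eᵀ * (k * G⁻¹ * A) * e = diagonal ![a, a, b, b] * (eᵀ * A * e) := by
    have h3 := congrArg Matrix.transpose h.inv_mul_metric
    rw [Matrix.transpose_mul, Matrix.transpose_mul, Matrix.transpose_mul, hk,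
      Matrix.transpose_nonsing_inv, hG, diagonal_transpose] at h3
    rw [← Matrix.mul_assoc, h3]
    simp only [Matrix.mul_assoc]
  rw [← h1, ← h2]
  exact ⟨fun h4 => by rw [h4], h.conj_inj⟩

/-- The 2-forms commuting with `k` are spanned by the volume forms of the two planes. -/
lemma eq_planeForm (h : IsAdapted G k e a b) (hG : Gᵀ = G) (hk : kᵀ = k) (hA : Aᵀ = -A)
    (hc : A * G⁻¹ * k = k * G⁻¹ * A) :
    eᵀ * A * e = planeForm ((eᵀ * A * e) 0 1) ((eᵀ * A * e) 2 3) := by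
  refine Spacetime.eq_planeForm ?_ h.ne ((h.comm_iff hG hk).mp hc)
  rw [Matrix.transpose_mul, Matrix.transpose_mul, hA, Matrix.transpose_transpose]
  noncomm_ring

end IsAdapted

/-- The 2-form with frame components `planeForm p q`. -/
def planeField (E : Coord → Mat) (p q : Coord → ℝ) (v : Coord) : Mat :=
  ((E v)⁻¹)ᵀ * planeForm (p v) (q v) * (E v)⁻¹

namespace AdaptedFrame

variable {p q : Coord → ℝ}

lemma isAdapted (h : AdaptedFrame g K E α β Ω) (hu : u ∈ Ω) :
    IsAdapted (g u) (K u) (E u) (α u) (β u) := ⟨h.on u hu, h.diag u hu, h.ne u hu⟩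

lemma conj_planeField (h : AdaptedFrame g K E α β Ω) (hu : u ∈ Ω) :
    (E u)ᵀ * planeField E p q u * E u = planeForm (p u) (q u) := by
  have hrt : (E u)ᵀ * ((E u)⁻¹)ᵀ = 1 := by
    rw [← Matrix.transpose_mul, (h.on u hu).inv_mul, Matrix.transpose_one]
  rw [planeField, Matrix.mul_assoc, Matrix.mul_assoc, Matrix.mul_assoc, (h.on u hu).inv_mul,
    Matrix.mul_one, ← Matrix.mul_assoc, hrt, Matrix.one_mul]

lemma isAdaptedCKY_planeField (h : AdaptedFrame g K E α β Ω) (hKs : ∀ v, (K v)ᵀ = K v)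
    (hu : u ∈ Ω) (hpq : IsSolAt g E α β p q u) : IsAdaptedCKY g K (planeField E p q) u := by
  have hE := (h.smoothE u hu).inv (h.on u hu).det_ne
  have hP : MSm (fun v => planeForm (p v) (q v)) u := fun i j => by
    have h0 : Sm (fun _ : Coord => (0 : ℝ)) u := contDiffAt_const
    fin_cases i <;> fin_cases j
    exacts [h0, hpq.smooth₁, h0, h0, hpq.smooth₁.neg, h0, h0, h0, h0, h0, h0, hpq.smooth₂, h0, h0,
      hpq.smooth₂.neg, h0]
  have hs : MSm (planeField E p q) u := (hE.transpose.mul hP).mul hE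
  refine ⟨hs, ?_, ?_, ?_⟩
  · rw [planeField, Matrix.transpose_mul, Matrix.transpose_mul, planeForm_transpose,
      Matrix.transpose_transpose]
    noncomm_ring
  · rw [(h.isAdapted hu).comm_iff (h.symm u) (hKs u), h.conj_planeField hu, planeForm_comm]
  · rw [h.cky_iff hu hs.diff ((h.isOpen.eventually_mem hu).mono fun v hv => h.conj_planeField hv)]
    exact fun k => ⟨hpq.eqn₁ k, hpq.eqn₂ k⟩

/-- Adapted conformal Killing-Yano tensors are constant combinations of a given one and its
dual. -/
lemma eventually_eq_planeField (h : AdaptedFrame g K E α β Ω) (hKs : ∀ v, (K v)ᵀ = K v)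
    (hu : u ∈ Ω) (hpq : ∀ v ∈ Ω, IsSolAt g E α β p q v ∧ p v ^ 2 + q v ^ 2 ≠ 0)
    (hT : ∀ᶠ v in 𝓝 u, IsAdaptedCKY g K T v) :
    ∃ y : ℝ × ℝ, ∀ᶠ v in 𝓝 u, T v = planeField E (fun v => y.1 * p v - y.2 * q v)
      (fun v => y.1 * q v + y.2 * p v) v := by
  have hΩ := h.isOpen.eventually_mem hu
  set A : Coord → Mat := fun v => (E v)ᵀ * T v * E v
  have hA : ∀ᶠ v in 𝓝 u, A v = planeForm (A v 0 1) (A v 2 3) := by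
    filter_upwards [hΩ, hT] with v hv hTv
    exact (h.isAdapted hv).eq_planeForm (h.symm v) (hKs v) hTv.anti hTv.comm
  have hAs : ∀ᶠ v in 𝓝 u, MSm A v := by
    filter_upwards [hΩ, hT] with v hv hTv
    exact ((h.smoothE v hv).transpose.mul hTv.smooth).mul (h.smoothE v hv)
  -- Since `T` commutes with `K`, its two frame entries solve the same linear system as `p, q`, so
  -- they differ from them by a constant complex factor.
  obtain ⟨a, b, hab⟩ := IsSolAt.eventually_comb (P := fun v => A v 0 1) (Q := fun v => A v 2 3)
    (hΩ.mono fun v hv => (h.on v hv).det_ne) (hΩ.mono hpq) (by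
      filter_upwards [hΩ, hT, hAs, hA.eventually_nhds] with v hv hTv hAv hev
      exact ⟨hAv.diff 0 1, hAv.diff 2 3, (h.cky_iff hv hTv.smooth.diff hev).mp hTv.cky⟩)
  refine ⟨(a, b), ?_⟩
  filter_upwards [hΩ, hA, hab] with v hv hAv habv
  refine (h.isAdapted hv).conj_inj ?_
  rw [h.conj_planeField hv]
  change A v = _
  rw [hAv]
  exact congrArg₂ planeForm habv.1 habv.2

end AdaptedFrame

end

section
variable {M : Type*} [TopologicalSpace M] [ChartedSpace Coord M]

/-! ### Local and global solutions -/

/-- An adapted frame and a solution of the conformal Killing-Yano equation, over part of a chart. -/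
structure SolChart (g : LorentzMetric M) (K : BilinField M) where
  /-- the chart -/
  e : OpenPartialHomeomorph M Coord
  mem : e ∈ IsManifold.maximalAtlas (𝓡 4) ∞ M
  /-- the coordinate domain -/
  Ω : Set Coord
  subset : Ω ⊆ e.target
  /-- the frame -/
  E : Coord → Mat
  /-- the eigenvalue of the time-like plane -/
  α : Coord → ℝ
  /-- the eigenvalue of the space-like plane -/
  β : Coord → ℝ
  frame : AdaptedFrame (components e g.val) (components e K) E α β Ω
  /-- the time-like component of the solution -/
  p : Coord → ℝ
  /-- the space-like component of the solution -/
  q : Coord → ℝ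
  sol : ∀ v ∈ Ω, IsSolAt (components e g.val) E α β p q v ∧ p v ^ 2 + q v ^ 2 ≠ 0

/-- `T` is, in a neighbourhood of `x`, an adapted conformal Killing-Yano tensor. -/
def IsAdaptedNear (g : LorentzMetric M) (K T : BilinField M) (x : M) : Prop :=
  ∀ e ∈ IsManifold.maximalAtlas (𝓡 4) ∞ M, x ∈ e.source →
    ∀ᶠ v in 𝓝 (e x), IsAdaptedCKY (components e g.val) (components e K) (components e T) v

variable {g : LorentzMetric M} {K : BilinField M}

lemma exists_solChart [IsManifold (𝓡 4) ∞ M] (hD : g.IsTypeD) (hC : g.IsConformalKillingTensor K)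
    (hK : g.IsTwoPlusTwo K) (x : M) : ∃ S : SolChart g K, x ∈ S.e.source ∧ S.e x ∈ S.Ω := by
  set e := chartAt Coord x
  have he : e ∈ IsManifold.maximalAtlas (𝓡 4) ∞ M := IsManifold.chart_mem_maximalAtlas x
  have hx : x ∈ e.source := mem_chart_source Coord x
  obtain ⟨r, hr, hsub, E, α, β, hF⟩ := exists_adaptedFrame (Ω := e.target) (u := e x)
    e.open_target (components_symm g.symm e) (components_symm hC.symm e)
    (fun v hv => g.smooth.mSm he hv) (fun v hv => hC.smooth.mSm he hv)
    (fun v hv => hK.isAdapted he hv) (hD e he) (hC.eqn e he) (e.map_source hx)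
  obtain ⟨p, q, hpq⟩ := hF.exists_sol (convex_ball (e x) r)
  exact ⟨⟨e, he, _, hsub, E, α, β, hF, p, q, hpq⟩, hx, Metric.mem_ball_self hr⟩

namespace SolChart

variable (S : SolChart g K)

/-- The open set covered by the chart. -/
def dom : Set M := S.e.source ∩ S.e ⁻¹' S.Ω

lemma isOpen_dom : IsOpen S.dom := S.e.isOpen_inter_preimage S.frame.isOpen

/-- The components of the combinations of the solution and its dual. -/
def comp (y : ℝ × ℝ) : Coord → Mat :=
  planeField S.E (fun v => y.1 * S.p v - y.2 * S.q v) (fun v => y.1 * S.q v + y.2 * S.p v)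

/-- The combinations of the solution and its dual. -/
def field (y : ℝ × ℝ) : BilinField M := ofComponents S.e (S.comp y)

variable {S}

lemma field_zero : S.field 0 = 0 := by
  have h1 : S.comp 0 = 0 := by
    have h2 : planeForm 0 0 = 0 := by
      ext i j
      fin_cases i <;> fin_cases j <;> simp [planeForm]
    funext v
    simp [comp, planeField, h2]
  funext x
  change (∑ i, ∑ j, S.comp 0 (S.e x) i j • (dcoord S.e x i).smulRight (dcoord S.e x j) :
    Coord →ₗ[ℝ] Coord →ₗ[ℝ] ℝ) = 0
  simp [h1]

/-- Multiplicativity of the complex modulus. -/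
lemma comb_ne {y : ℝ × ℝ} (hy : y ≠ 0) {v : Coord} (hv : v ∈ S.Ω) :
    (y.1 * S.p v - y.2 * S.q v) ^ 2 + (y.1 * S.q v + y.2 * S.p v) ^ 2 ≠ 0 := by
  have h1 : y.1 ^ 2 + y.2 ^ 2 ≠ 0 := fun h0 => hy (by
    have h2 : y.1 = 0 := by nlinarith [sq_nonneg y.1, sq_nonneg y.2]
    have h3 : y.2 = 0 := by nlinarith [sq_nonneg y.1, sq_nonneg y.2]
    exact Prod.ext h2 h3)
  have h2 : (y.1 * S.p v - y.2 * S.q v) ^ 2 + (y.1 * S.q v + y.2 * S.p v) ^ 2 =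
      (y.1 ^ 2 + y.2 ^ 2) * (S.p v ^ 2 + S.q v ^ 2) := by ring
  rw [h2]
  exact mul_ne_zero h1 (S.sol v hv).2

variable [IsManifold (𝓡 4) ∞ M]

lemma components_field (y : ℝ × ℝ) {v : Coord} (hv : v ∈ S.Ω) :
    components S.e (S.field y) v = S.comp y v :=
  components_ofComponents S.mem (S.subset hv) _

lemma eventually_components_field (y : ℝ × ℝ) {v : Coord} (hv : v ∈ S.Ω) :
    components S.e (S.field y) =ᶠ[𝓝 v] S.comp y :=
  (S.frame.isOpen.eventually_mem hv).mono fun _ hw => components_field y hw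

lemma isAdaptedCKY_field (hC : g.IsConformalKillingTensor K) (y : ℝ × ℝ) {v : Coord}
    (hv : v ∈ S.Ω) : IsAdaptedCKY (components S.e g.val) (components S.e K)
      (components S.e (S.field y)) v :=
  (S.frame.isAdaptedCKY_planeField (components_symm hC.symm S.e) hv
    ((S.sol v hv).1.comb y.1 y.2)).congr (eventually_components_field y hv)

lemma field_injective {x : M} (hx : x ∈ S.dom) :
    Function.Injective fun y : ℝ × ℝ => S.field y x := by
  intro y y' h
  by_contra hne
  have hxe := S.e.left_inv hx.1
  have h1 : components S.e (S.field y) (S.e x) = components S.e (S.field y') (S.e x) := by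
    have h0 : S.field y (S.e.symm (S.e x)) = S.field y' (S.e.symm (S.e x)) := by
      rw [hxe]
      exact h
    ext i j
    simp only [components, Matrix.of_apply, h0]
  rw [components_field y hx.2, components_field y' hx.2] at h1
  have h2 := congrArg (fun A : Mat => (S.E (S.e x))ᵀ * A * S.E (S.e x)) h1
  simp only [comp, S.frame.conj_planeField hx.2] at h2
  have h3 := congrFun (congrFun h2 0) 1
  have h4 := congrFun (congrFun h2 2) 3
  simp [planeForm] at h3 h4
  refine comb_ne (sub_ne_zero.mpr hne) hx.2 ?_
  simp only [Prod.fst_sub, Prod.snd_sub]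
  have h5 : (y.1 - y'.1) * S.p (S.e x) - (y.2 - y'.2) * S.q (S.e x) = 0 := by
    linear_combination h3
  have h6 : (y.1 - y'.1) * S.q (S.e x) + (y.2 - y'.2) * S.p (S.e x) = 0 := by
    linear_combination h4
  rw [h5, h6]
  ring

lemma isAdaptedNear_field (hC : g.IsConformalKillingTensor K) (hK : g.IsTwoPlusTwo K)
    (y : ℝ × ℝ) {x : M} (hx : x ∈ S.dom) : IsAdaptedNear g K (S.field y) x := by
  intro e he hxe
  have hΩ : ∀ᶠ v in 𝓝 (e x), e.symm v ∈ S.dom := by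
    refine (e.continuousAt_symm (e.map_source hxe)).eventually ?_
    rw [e.left_inv hxe]
    exact S.isOpen_dom.eventually_mem hx
  filter_upwards [hΩ, e.open_target.eventually_mem (e.map_source hxe)] with v hv hvt
  obtain ⟨X, a, b, hX⟩ := hK.isAdapted he hvt
  exact (isAdaptedCKY_field hC y hv.2).pullback (coordChange_smooth he S.mem hvt hv.1)
    (isPullback_components he S.mem hvt hv.1 _) (isPullback_components he S.mem hvt hv.1 _)
    (isPullback_components he S.mem hvt hv.1 _) (g.smooth.mSm S.mem (S.subset hv.2))
    (components_symm g.symm e) (components_symm g.symm S.e)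
    (IsON.metric_det_ne (g := components e g.val) (E := fun _ => X) hX.on)

/-- Local uniqueness up to a constant parameter; it makes the transition functions between charts
locally constant. -/
lemma eventually_eq_field (hC : g.IsConformalKillingTensor K) {T : BilinField M} {x : M}
    (hx : x ∈ S.dom) (hT : IsAdaptedNear g K T x) :
    ∃ y : ℝ × ℝ, ∀ᶠ z in 𝓝 x, T z = S.field y z := by
  obtain ⟨y, hy⟩ := S.frame.eventually_eq_planeField (components_symm hC.symm S.e) hx.2 S.sol
    (hT S.e S.mem hx.1)
  refine ⟨y, ?_⟩
  filter_upwards [(S.e.continuousAt hx.1).eventually hy, S.isOpen_dom.eventually_mem hx]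
    with z hz hzd
  have h1 := bil_ext S.mem (S.subset hzd.2) (T := T) (T' := S.field y)
    (hz.trans (components_field y hzd.2).symm)
  have h2 := S.e.left_inv hzd.1
  rw [h2] at h1
  exact h1

lemma isNonNullAt_field (hK : g.IsTwoPlusTwo K) {y : ℝ × ℝ} (hy : y ≠ 0)
    {e : OpenPartialHomeomorph M Coord} (he : e ∈ IsManifold.maximalAtlas (𝓡 4) ∞ M) {u : Coord}
    (hu : u ∈ e.target) (hx : e.symm u ∈ S.dom) :
    IsNonNullAt (components e g.val) (components e (S.field y)) u := by
  obtain ⟨X, a, b, hX⟩ := hK.isAdapted he hu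
  have hdet : (components e g.val u).det ≠ 0 :=
    IsON.metric_det_ne (g := components e g.val) (E := fun _ => X) hX.on
  have hJ := (isPullback_components he S.mem hu hx.1 g.val).jac_isUnit hdet
  set J := jac (coordChange e S.e) u
  set u' := coordChange e S.e u
  have hu' : u' ∈ S.Ω := hx.2
  -- `J⁻¹ E` is the frame of `S` expressed in the chart `e`, so all frame components are unchanged.
  have key : ∀ T : BilinField M, (J⁻¹ * S.E u')ᵀ * components e T u * (J⁻¹ * S.E u') =
      (S.E u')ᵀ * components S.e T u' * S.E u' := by
    intro T
    have hJt : IsUnit Jᵀ.det := by rwa [Matrix.det_transpose]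
    rw [components_coordChange he S.mem hu hx.1, Matrix.transpose_mul,
      Matrix.transpose_nonsing_inv]
    simp only [Matrix.mul_assoc]
    rw [Matrix.mul_nonsing_inv_cancel_left _ _ hJ, Matrix.nonsing_inv_mul_cancel_left _ _ hJt]
  refine IsON.isNonNullAt (E := fun _ => J⁻¹ * S.E u') ((key g.val).trans (S.frame.on u' hu'))
    ((key (S.field y)).trans ?_) (comb_ne hy hu')
  rw [components_field y hu']
  exact S.frame.conj_planeField hu'

end SolChart

/-- Fields that are locally nonzero combinations of local solutions are non-null conformal
Killing-Yano tensors. -/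
lemma isConformalKillingYanoOn_of_locally [IsManifold (𝓡 4) ∞ M]
    (hC : g.IsConformalKillingTensor K) (hK : g.IsTwoPlusTwo K) {F : BilinField M} {N : Set M}
    (h : ∀ x ∈ N, ∃ S : SolChart g K, x ∈ S.dom ∧ ∃ y ≠ 0, ∀ᶠ z in 𝓝 x, F z = S.field y z) :
    g.IsConformalKillingYanoOn F N ∧ g.IsNonNullOn F N := by
  have hev : ∀ e : OpenPartialHomeomorph M Coord, ∀ u ∈ e.target, ∀ T : BilinField M,
      (∀ᶠ z in 𝓝 (e.symm u), F z = T z) → components e F =ᶠ[𝓝 u] components e T := by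
    intro e u hu T hT
    filter_upwards [(e.continuousAt_symm hu).eventually hT] with v hv
    ext i j
    simp only [components, Matrix.of_apply, hv]
  have hA : ∀ e ∈ IsManifold.maximalAtlas (𝓡 4) ∞ M, ∀ u ∈ e.target, e.symm u ∈ N →
      IsAdaptedCKY (components e g.val) (components e K) (components e F) u := by
    intro e he u hu hx
    obtain ⟨S, hS, y, -, hy⟩ := h _ hx
    have h1 := (SolChart.isAdaptedNear_field hC hK y hS e he (e.map_target hu)).self_of_nhds
    rw [e.right_inv hu] at h1
    exact h1.congr (hev e u hu _ hy)
  refine ⟨⟨fun x hx v w => ?_, fun e he i j u hu => ?_, fun e he u hu hx => (hA e he u hu hx).cky⟩,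
    fun e he u hu hx => ?_⟩
  · have he := IsManifold.chart_mem_maximalAtlas (I := 𝓡 4) (n := ∞) x
    have hxs := mem_chart_source Coord x
    have hl := (chartAt Coord x).left_inv hxs
    have ht := (chartAt Coord x).map_source hxs
    have h1 := bil_anti he ht (hA _ he _ ht (by rwa [hl])).anti
    rw [hl] at h1
    exact h1 v w
  · exact ((hA e he u hu.1 hu.2).smooth i j).contDiffWithinAt
  · obtain ⟨S, hS, y, hy0, hy⟩ := h _ hx
    have h1 := SolChart.isNonNullAt_field hK hy0 he hu hS
    have h2 := (hev e u hu _ hy).self_of_nhds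
    simpa only [IsNonNullAt, h2] using h1

end

end Spacetime

end

/-! ### The theorem: local solutions and their gluing. -/

theorem mainTheorem5 (M : Type*) [TopologicalSpace M] [T2Space M] [SecondCountableTopology M]
    [ChartedSpace Spacetime.Coord M] [IsManifold (𝓡 4) ∞ M]
    (g : Spacetime.LorentzMetric M) (hD : g.IsTypeD)
    (hK : ∃ K : Spacetime.BilinField M, g.IsConformalKillingTensor K ∧ g.IsTwoPlusTwo K) :
    (∀ p : M, ∃ N : Set M, IsOpen N ∧ p ∈ N ∧ ∃ F : Spacetime.BilinField M,
      g.IsConformalKillingYanoOn F N ∧ g.IsNonNullOn F N) ∧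
    (SimplyConnectedSpace M → ∃ F : Spacetime.BilinField M,
      g.IsConformalKillingYanoOn F Set.univ ∧ g.IsNonNullOn F Set.univ) := by
  obtain ⟨K, hC, hK⟩ := hK
  choose S hS hS' using Spacetime.exists_solChart hD hC hK
  have hdom : ∀ p, p ∈ (S p).dom := fun p => ⟨hS p, hS' p⟩
  refine ⟨fun p => ⟨(S p).dom, (S p).isOpen_dom, hdom p, (S p).field (1, 0),
    Spacetime.isConformalKillingYanoOn_of_locally hC hK fun x hx =>
      ⟨S p, hx, (1, 0), by simp, Filter.Eventually.of_forall fun _ => rfl⟩⟩, fun hM => ?_⟩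
  have : LocallyPathConnectedSpace M :=
    ChartedSpace.locallyPathConnectedSpace Spacetime.Coord M
  -- Zero is removed from the parameter space so that the glued 2-form is non-null everywhere.
  have : Nonempty {y : ℝ × ℝ // y ≠ 0} := ⟨⟨(1, 0), by simp⟩⟩
  obtain ⟨F, hF⟩ := Spacetime.exists_glued_section (F := {y : ℝ × ℝ // y ≠ 0})
    (fun p => (S p).dom) (fun p => (S p).isOpen_dom) hdom (fun p z y => (S p).field y z)
    (fun p z hz => (Spacetime.SolChart.field_injective hz).comp Subtype.val_injective) (by
      intro p q x hx y
      obtain ⟨y', hy'⟩ := Spacetime.SolChart.eventually_eq_field hC hx.2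
        (Spacetime.SolChart.isAdaptedNear_field hC hK y hx.1)
      -- The matching parameter is again nonzero: otherwise the field with parameter `y` would
      -- vanish at `x`, and injectivity would give `y = 0`.
      refine ⟨⟨y', fun h0 => y.2 ?_⟩, hy'⟩
      refine Spacetime.SolChart.field_injective hx.1 (hy'.self_of_nhds.trans ?_)
      change (S q).field y' x = (S p).field 0 x
      rw [h0, Spacetime.SolChart.field_zero, Spacetime.SolChart.field_zero])
  exact ⟨F, Spacetime.isConformalKillingYanoOn_of_locally hC hK fun x _ =>
    ⟨S x, hdom x, (hF x).choose, (hF x).choose.2, (hF x).choose_spec⟩⟩
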